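/- Conventions. A noncommutative probability space (NCP) is a pair $(\mathcal A,\varphi)$ of a unital complex $*$-algebra and a positive linear functional with $\varphi(1)=1$. Subsets $S_i\subseteq\mathcal A$ ($i\in I$) are free if $\varphi(x_1\cdots x_k)=0$ whenever $k\ge 1$, $x_j$ lies in the unital $*$-subalgebra generated by $S_{i(j)}$, $\varphi(x_j)=0$ for all $j$, and $i(j)\ne i(j+1)$ for $1\le j<k$; an element is identified with its singleton. A self-adjoint $s\in\mathcal A$ is semicircular if $\varphi(s^p)=\frac1{2\pi}\int_{-2}^2t^p\sqrt{4-t^2}\,dt$ for all $p\ge 0$. For $-1\le\rho\le1$, $e\in\mathcal A$ is elliptic with parameter $\rho$ if $e=\sqrt{\frac{1+\rho}2}\,s_1+i\sqrt{\frac{1-\rho}2}\,s_2$ with $s_1,s_2\in\mathcal A$ free semicircular elements. Families of $n\times n$ random matrices $(X_n^{(i)})_{i\in I}$ converge jointly in $*$-distribution to $(a_i)_{i\in I}$ in $(\mathcal A,\varphi)$ if for all $k$, all $i_1,\dots,i_k\in I$ and $\epsilon_1,\dots,\epsilon_k\in\{1,*\}$, $$\lim_{n\to\infty}\tfrac1n\mathbf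 E\operatorname{Tr}\big((X_n^{(i_1)})^{\epsilon_1}\cdots (X_n^{(i_k)})^{\epsilon_k}\big)=\varphi(a_{i_1}^{\epsilon_1}\cdots a_{i_k}^{\epsilon_k}).$$ A sequence $A_n=(a_{ij})_{1\le i,j\le n}$ of real random matrices (entries may depend on $n$) is elliptic with correlation $\rho$ if for each $n$ the family $\{a_{ii}\}_{i}\cup\{(a_{ij},a_{ji})\}_{i<j}$ is independent, $\mathbf E[a_{ij}]=0$ and $\mathbf E[a_{ij}^2]=1$ for all $i,j$, $\mathbf E[a_{ij}a_{ji}]=\rho$ for $i\neq j$, and for every $k$, $\mathbf E|a_{ij}|^k$ is bounded uniformly in $n,i,j$. Theorem. Let $A_n^{(1)},\dots,A_n^{(m)}$ be elliptic with correlations $\rho_1,\dots,\rho_m$, and independent for each $n$. Put $\overline A_n^{(\tau)}=n^{-1/2}A_n^{(\tau)}$. (1) There are free elements $e_1,\dots,e_m$ in some NCP with $e_\tau$ elliptic with parameter $\rho_\tau$, and for all such elements (in any NCP), $\overline A_n^{(1)},\dots,\overline A_n^{(m)}$ converge jointly in $*$-distribution to $e_1,\dots,e_m$. (2) Suppose in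 addition that for all $n,\tau$ the entries of $A_n^{(\tau)}$ are jointly Gaussian, and that $D_n^{(1)},\dots,D_n^{(\ell)}$ are deterministic complex $n\times n$ matrices converging jointly in $*$-distribution to $d_1,\dots,d_\ell$ in an NCP $(\mathcal A,\varphi)$. Then there are elements $e_1,\dots,e_m,d_1',\dots,d_\ell'$ of some NCP such that $(d_1',\dots,d_\ell')$ has the same joint $*$-moments as $(d_1,\dots,d_\ell)$, $e_\tau$ is elliptic with parameter $\rho_\tau$, and $e_1,\dots,e_m,\{d_1',\dots,d_\ell'\}$ are free; and for all such elements (in any NCP, in particular with $d_j'=d_j$ if $\mathcal A$ contains suitable $e_\tau$), $\overline A_n^{(1)},\dots,\overline A_n^{(m)},D_n^{(1)},\dots,D_n^{(\ell)}$ converge jointly in $*$-distribution to $e_1,\dots,e_m,d_1',\dots,d_\ell'$. -/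

import Mathlib

open MeasureTheory ProbabilityTheory Filter Topology

universe u v w

open scoped ComplexOrder in
/-- A noncommutative (`*`-)probability space: a unital complex `*`-algebra with a positive unital
linear functional. -/
structure NCProbSpace where
  carrier : Type u
  [ring : Ring carrier]
  [starRing : StarRing carrier]
  [algebra : Algebra ℂ carrier]
  [starModule : StarModule ℂ carrier]
  φ : carrier →ₗ[ℂ] ℂ
  map_one : φ 1 = 1
  nonneg : ∀ a : carrier, 0 ≤ φ (star a * a)

namespace NCProbSpace

attribute [instance] NCProbSpace.ring NCProbSpace.starRing NCProbSpace.algebra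
  NCProbSpace.starModule

instance : CoeSort NCProbSpace.{u} (Type u) := ⟨NCProbSpace.carrier⟩

end NCProbSpace

/-- The word `a_{i₁}^{ε₁} ⋯ a_{i_k}^{ε_k}`, where the letter `(i, true)` stands for `a_i^*` and
`(i, false)` for `a_i`. -/
def starWord {ι A : Type*} [Monoid A] [Star A] (a : ι → A) (w : List (ι × Bool)) : A :=
  (w.map fun p => if p.2 then star (a p.1) else a p.1).prod

namespace NCProbSpace

/-- Freeness of a family of subsets: `φ (x₁ ⋯ x_k) = 0` whenever `k ≥ 1`, each `x_j` lies in the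
unital `*`-subalgebra generated by `S (i j)`, each `φ (x_j) = 0`, and consecutive indices `i j` are
distinct. -/
def IsFree (𝒜 : NCProbSpace.{u}) {ι : Type*} (S : ι → Set 𝒜) : Prop :=
  ∀ (k : ℕ) (i : Fin (k + 1) → ι) (x : Fin (k + 1) → 𝒜),
    (∀ j : Fin k, i j.castSucc ≠ i j.succ) →
    (∀ j, x j ∈ StarAlgebra.adjoin ℂ (S (i j))) →
    (∀ j, 𝒜.φ (x j) = 0) →
    𝒜.φ (List.ofFn x).prod = 0

/-- A (standard) semicircular element. -/
def IsSemicircular (𝒜 : NCProbSpace.{u}) (s : 𝒜) : Prop :=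
  IsSelfAdjoint s ∧ ∀ p : ℕ,
    𝒜.φ (s ^ p) = ((1 / (2 * Real.pi) * ∫ t in (-2 : ℝ)..2, t ^ p * √(4 - t ^ 2) : ℝ) : ℂ)

/-- An elliptic element with parameter `ρ ∈ [-1, 1]`. -/
def IsElliptic (𝒜 : NCProbSpace.{u}) (ρ : ℝ) (e : 𝒜) : Prop :=
  ρ ∈ Set.Icc (-1 : ℝ) 1 ∧ ∃ s₁ s₂ : 𝒜, 𝒜.IsSemicircular s₁ ∧ 𝒜.IsSemicircular s₂ ∧
    𝒜.IsFree (fun b : Bool => if b then {s₁} else {s₂}) ∧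
    e = ((√((1 + ρ) / 2) : ℝ) : ℂ) • s₁ + (Complex.I * ((√((1 - ρ) / 2) : ℝ) : ℂ)) • s₂

/-- Two families, possibly in different spaces, have the same joint `*`-distribution. -/
def SameStarDist (𝒜 : NCProbSpace.{u}) (ℬ : NCProbSpace.{v}) {ι : Type*} (a : ι → 𝒜)
    (b : ι → ℬ) : Prop :=
  ∀ w : List (ι × Bool), 𝒜.φ (starWord a w) = ℬ.φ (starWord b w)

end NCProbSpace

/-- The functional `φ_n(X) = (1/n) E[Tr X]` on `n × n` random matrices. -/
noncomputable def meanTrace {Ω : Type*} [MeasurableSpace Ω] (μ : Measure Ω) {n : ℕ}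
    (X : Ω → Matrix (Fin n) (Fin n) ℂ) : ℂ :=
  (n : ℂ)⁻¹ * ∫ ω, (X ω).trace ∂μ

/-- Joint convergence in `*`-distribution of families `X n` of `n × n` random matrices to a family
`a` in a noncommutative probability space. -/
def StarTendsto {Ω : ℕ → Type*} [∀ n, MeasurableSpace (Ω n)] (μ : ∀ n, Measure (Ω n)) {ι : Type*}
    (X : ∀ n, ι → Ω n → Matrix (Fin n) (Fin n) ℂ) (𝒜 : NCProbSpace.{u}) (a : ι → 𝒜) : Prop :=
  ∀ w : List (ι × Bool),
    Tendsto (fun n => meanTrace (μ n) (starWord (X n) w)) atTop (𝓝 (𝒜.φ (starWord a w)))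

/-- A sequence of (real) elliptic random matrices `A n` of size `n × n` with correlation `ρ`. The
entries may depend on `n`; a single infinite array `(a_{ij})` is the special case where they do
not. -/
structure IsEllipticMatrixSeq {Ω : ℕ → Type*} [∀ n, MeasurableSpace (Ω n)]
    (μ : ∀ n, Measure (Ω n)) (A : ∀ n, Ω n → Matrix (Fin n) (Fin n) ℝ) (ρ : ℝ) : Prop where
  measurable : ∀ n i j, Measurable fun ω => A n ω i j
  /-- The diagonal entries `a_{ii}` (which appear here as `(a_{ii}, a_{ii})`) and the pairs
  `(a_{ij}, a_{ji})`, `i < j`, are jointly independent. -/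
  indep : ∀ n, iIndepFun (fun (p : {p : Fin n × Fin n // p.1 ≤ p.2}) ω =>
    (A n ω p.1.1 p.1.2, A n ω p.1.2 p.1.1)) (μ n)
  mean : ∀ n i j, ∫ ω, A n ω i j ∂μ n = 0
  variance : ∀ n i j, ∫ ω, A n ω i j ^ 2 ∂μ n = 1
  correlation : ∀ n i j, i ≠ j → ∫ ω, A n ω i j * A n ω j i ∂μ n = ρ
  moments : ∀ k : ℕ, ∃ C : ℝ, ∀ n i j,
    Integrable (fun ω => |A n ω i j| ^ k) (μ n) ∧ ∫ ω, |A n ω i j| ^ k ∂μ n ≤ C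

/-- The random matrix `n^{-1/2} A`, with complex entries. -/
noncomputable def scaledMatrix {Ω : Type*} {n : ℕ} (A : Ω → Matrix (Fin n) (Fin n) ℝ) :
    Ω → Matrix (Fin n) (Fin n) ℂ :=
  fun ω => (((√(n : ℝ))⁻¹ : ℝ) : ℂ) • (A ω).map (fun x : ℝ => (x : ℂ))

/-! Everything rests on the Schwinger–Dyson equations: for deterministic letters `u` and a Gaussian
letter `x`, `M (u x W) = ∑ c(x, y) M(U) M(u V)`, summed over the splittings `W = U y V`. They
determine a functional on words from its values on deterministic words (`sdFunctional`), and they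
serve both as the large `n` limit of Gaussian integration by parts and as an algebraic form of
freeness.

On the algebraic side, they imply freeness of letters of different colours when the covariance
between colours vanishes (`φ_centeredProd_eq_zero`, by induction on the number of Gaussian letters),
and they give a self-adjoint letter of variance one the Catalan moments, so that it is semicircular.
Conversely, free elliptic elements together with a family free from them have a joint
`*`-distribution fixed by the marginals (`sameStarDist_sumElim`). Hence convergence to one
realisation gives convergence to all.

For Gaussian entries, integration by parts (`HasGaussianLaw.integral_mul_eval`) is applied to the
expectation of a product of normalised traces. The covariance `n⁻¹ E[a_{ij} a_{kl}]` has a part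
proportional to `δ_{il} δ_{jk}`, which splits one trace into two, and two further parts, which
together with the derivatives of the other traces cost a factor `n⁻¹` times a power of operator
norms. Keeping products of traces in the induction makes a separate concentration estimate
unnecessary (`tendsto_expect_traceProd`). The moments of the norms need only be `O(√n)`, which
follows from bounded traces of powers of `X* X` (`sqrtMoments_opNorm`).

For general entries, a trace is a sum over closed walks. A walk using some independent entry pair
exactly once contributes zero; if every pair is used at most twice, only means and covariances
matter; all other walks have too few vertices and contribute `O(n^{-1/2})`. So the limit agrees with
that of a Gaussian model having the same covariances (`IsEllipticFamily.tendsto_meanTrace_sub`).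

The limit objects come from random matrices themselves: `exists_limitSpace` makes an algebra of
matrix sequences into a noncommutative probability space through the limiting trace, and
`exists_elliptic_space` applies this to symmetric Gaussian matrices, whose combinations `αS₁ + iβS₂`
are the elliptic elements. -/

/-! ### Sums over the splittings of a word, and the Schwinger–Dyson equations -/

/-- The sum `∑ g y • F U V` over all decompositions `W = U' ++ y :: V`, where `U = pre ++ U'`. -/
def splitSum {L M : Type*} [AddCommMonoid M] [SMul ℂ M] (g : L → ℂ) (F : List L → List L → M) :
    List L → List L → M
  | _, [] => 0
  | pre, y :: V => g y • F pre V + splitSum g F (pre ++ [y]) V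

section SplitSum

variable {L M N : Type*} [AddCommGroup M] [Module ℂ M] [AddCommGroup N] [Module ℂ N]

theorem splitSum_congr (g : L → ℂ) (F G : List L → List L → M) (pre W : List L)
    (h : ∀ U y V, W = U ++ y :: V → g y ≠ 0 → F (pre ++ U) V = G (pre ++ U) V) :
    splitSum g F pre W = splitSum g G pre W := by
  induction W generalizing pre with
  | nil => rfl
  | cons y V ih =>
    simp only [splitSum]
    congr 1
    · by_cases hy : g y = 0
      · simp [hy]
      · have := h [] y V rfl hy
        simp only [List.append_nil] at this
        rw [this]
    · refine ih _ fun U z V' hV hz => ?_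
      have := h (y :: U) z V' (by simp [hV]) hz
      simpa using this

theorem splitSum_prefix (g : L → ℂ) (F : List L → List L → M) (pre pre' W : List L) :
    splitSum g F (pre ++ pre') W = splitSum g (fun U V => F (pre ++ U) V) pre' W := by
  induction W generalizing pre' with
  | nil => rfl
  | cons y V ih =>
    simp only [splitSum]
    rw [List.append_assoc, ih]

theorem splitSum_append (g : L → ℂ) (F : List L → List L → M) (pre W W' : List L) :
    splitSum g F pre (W ++ W') =
      splitSum g (fun U V => F U (V ++ W')) pre W + splitSum g F (pre ++ W) W' := by
  induction W generalizing pre with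
  | nil => simp [splitSum]
  | cons y V ih =>
    simp only [List.cons_append, splitSum, ih, add_assoc]
    simp

theorem splitSum_add (g : L → ℂ) (F G : List L → List L → M) (pre W : List L) :
    splitSum g (fun U V => F U V + G U V) pre W = splitSum g F pre W + splitSum g G pre W := by
  induction W generalizing pre with
  | nil => simp [splitSum]
  | cons y V ih => simp only [splitSum, ih, smul_add]; abel

/-- Used later with `T` a trace, a matrix entry, an evaluation or an expectation, to move these
through the Leibniz expansion of a word. -/
theorem splitSum_map (T : M →ₗ[ℂ] N) (g : L → ℂ) (F : List L → List L → M) (pre W : List L) :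
    splitSum g (fun U V => T (F U V)) pre W = T (splitSum g F pre W) := by
  induction W generalizing pre with
  | nil => simp [splitSum]
  | cons y V ih => simp only [splitSum, ih, map_add, map_smul]

theorem splitSum_smul (t : ℂ) (g : L → ℂ) (F : List L → List L → M) (pre W : List L) :
    splitSum g (fun U V => t • F U V) pre W = t • splitSum g F pre W :=
  splitSum_map (t • LinearMap.id) g F pre W

theorem splitSum_eq_zero (g : L → ℂ) (F : List L → List L → M) (pre W : List L)
    (h : ∀ U y V, W = U ++ y :: V → g y ≠ 0 → F (pre ++ U) V = 0) :
    splitSum g F pre W = 0 := by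
  rw [splitSum_congr g F (fun _ _ => 0) pre W h]
  simpa using splitSum_smul 0 g F pre W

theorem splitSum_of_forall_eq_zero (g : L → ℂ) (F : List L → List L → M) (pre W : List L)
    (h : ∀ y ∈ W, g y = 0) : splitSum g F pre W = 0 :=
  splitSum_eq_zero g F pre W fun U y V hW hy => absurd (h y (by simp [hW])) hy

end SplitSum

/-- The covariance of a Gaussian letter with an arbitrary letter. -/
def covExt {X Y : Type*} (c : X → X → ℂ) (x : X) : X ⊕ Y → ℂ := Sum.elim (c x) fun _ => 0

/-- The Schwinger–Dyson equations for a functional on words in Gaussian letters `X` with covariance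
`c` and deterministic letters `Y`. -/
def SchwingerDyson {X Y : Type*} (c : X → X → ℂ) (M : List (X ⊕ Y) → ℂ) : Prop :=
  ∀ (u : List Y) (x : X) (W : List (X ⊕ Y)),
    M (u.map Sum.inr ++ Sum.inl x :: W) =
      splitSum (covExt c x) (fun U V => M U * M (u.map Sum.inr ++ V)) [] W

/-- The number of Gaussian letters of a word. -/
def gaussCount {X Y : Type*} (W : List (X ⊕ Y)) : ℕ := W.countP Sum.isLeft

theorem gaussCount_append {X Y : Type*} (U V : List (X ⊕ Y)) :
    gaussCount (U ++ V) = gaussCount U + gaussCount V := List.countP_append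

theorem gaussCount_inl {X Y : Type*} (x : X) (V : List (X ⊕ Y)) :
    gaussCount (Sum.inl x :: V) = gaussCount V + 1 := by simp [gaussCount, List.countP_cons]

theorem gaussCount_map_inr {X Y : Type*} (u : List Y) :
    gaussCount (u.map (Sum.inr : Y → X ⊕ Y)) = 0 := by
  simp [gaussCount, List.countP_eq_zero]

theorem gaussCount_cons {X Y : Type*} (y : X ⊕ Y) (V : List (X ⊕ Y)) :
    gaussCount V ≤ gaussCount (y :: V) := by
  simp only [gaussCount, List.countP_cons]; omega

/-- Either a word has no Gaussian letter or it can be split at the first one. -/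
theorem exists_first_gauss {X Y : Type*} (W : List (X ⊕ Y)) :
    (∃ u : List Y, W = u.map Sum.inr) ∨
      ∃ (u : List Y) (x : X) (V : List (X ⊕ Y)), W = u.map Sum.inr ++ Sum.inl x :: V := by
  induction W with
  | nil => exact Or.inl ⟨[], rfl⟩
  | cons y V ih =>
    rcases y with x | y
    · exact Or.inr ⟨[], x, V, rfl⟩
    · rcases ih with ⟨u, rfl⟩ | ⟨u, x, V', rfl⟩
      · exact Or.inl ⟨y :: u, rfl⟩
      · exact Or.inr ⟨y :: u, x, V', rfl⟩

/-! ### Freeness from the Schwinger–Dyson equations -/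

namespace NCProbSpace

section Centering

variable (ℬ : NCProbSpace.{u}) {L : Type*} (ev : L → ℬ)

/-- The centred evaluation of a word. -/
noncomputable def centered (W : List L) : ℬ := (W.map ev).prod - ℬ.φ (W.map ev).prod • 1

/-- The product of the centred evaluations of a list of words. -/
noncomputable def centeredProd (R : List (List L)) : ℬ := (R.map (ℬ.centered ev)).prod

theorem centeredProd_cons (W : List L) (R : List (List L)) :
    ℬ.centeredProd ev (W :: R) = ℬ.centered ev W * ℬ.centeredProd ev R := by
  simp [centeredProd]

theorem centeredProd_nil : ℬ.centeredProd ev [] = 1 := rfl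

theorem centeredProd_append (R R' : List (List L)) :
    ℬ.centeredProd ev (R ++ R') = ℬ.centeredProd ev R * ℬ.centeredProd ev R' := by
  simp [centeredProd]

theorem centeredProd_singleton (W : List L) :
    ℬ.centeredProd ev [W] = ℬ.centered ev W := by simp [centeredProd]

@[simp] theorem centered_nil : ℬ.centered ev [] = 0 := by simp [centered, ℬ.map_one]

theorem φ_centered (W : List L) : ℬ.φ (ℬ.centered ev W) = 0 := by
  simp [centered, ℬ.map_one]

theorem prod_eq_centered_add (W : List L) :
    (W.map ev).prod = ℬ.centered ev W + ℬ.φ (W.map ev).prod • 1 := by simp [centered]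

end Centering

section FreeOfSchwingerDyson

variable (ℬ : NCProbSpace.{u}) {X Y : Type*} (ev : X ⊕ Y → ℬ) (c : X → X → ℂ)

/-- The contribution to the Schwinger–Dyson equation of the contractions of `x` with the letters
of the centred blocks. -/
noncomputable def crossTerm (a : ℬ) (x : X) : ℬ → List (List (X ⊕ Y)) → ℂ
  | _, [] => 0
  | p, w :: R =>
    splitSum (covExt c x) (fun U V => ℬ.φ (p * (U.map ev).prod) *
      ℬ.φ (a * (V.map ev).prod * ℬ.centeredProd ev R)) [] w + crossTerm a x (p * ℬ.centered ev w) R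

/-- Linearity in the accumulated left factor `p` allows the mean of a block to be subtracted after
the block has been absorbed into `p`. -/
theorem crossTerm_sub_smul (a : ℬ) (x : X) (p q : ℬ) (t : ℂ) (R : List (List (X ⊕ Y))) :
    ℬ.crossTerm ev c a x (p - t • q) R =
      ℬ.crossTerm ev c a x p R - t • ℬ.crossTerm ev c a x q R := by
  induction R generalizing p q with
  | nil => simp [crossTerm]
  | cons w R ih =>
    simp only [crossTerm]
    rw [sub_mul, smul_mul_assoc, ih, smul_add, ← splitSum_smul]
    have : ∀ U V : List (X ⊕ Y), ℬ.φ ((p - t • q) * (U.map ev).prod) *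
        ℬ.φ (a * (V.map ev).prod * ℬ.centeredProd ev R) =
        ℬ.φ (p * (U.map ev).prod) * ℬ.φ (a * (V.map ev).prod * ℬ.centeredProd ev R) +
        (-1 : ℂ) • (t • (ℬ.φ (q * (U.map ev).prod) *
          ℬ.φ (a * (V.map ev).prod * ℬ.centeredProd ev R))) := by
      intro U V
      simp only [sub_mul, smul_mul_assoc, map_sub, map_smul, smul_eq_mul]
      ring
    simp only [this]
    rw [splitSum_add, splitSum_smul (-1)]
    simp only [smul_eq_mul]
    ring

/-- Expanding a centred block as word minus mean reduces to the hypothesis for plain words. In `b ++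
w` the partner of `x` lies in `b`, giving the first sum, or in `w`, giving a cross term; induction
on the number of centred blocks does the rest. -/
theorem φ_block_eq (a : ℬ) (x : X)
    (h : ∀ W : List (X ⊕ Y), ℬ.φ (a * ev (Sum.inl x) * (W.map ev).prod) =
      splitSum (covExt c x) (fun U V => ℬ.φ (U.map ev).prod * ℬ.φ (a * (V.map ev).prod)) [] W)
    (b : List (X ⊕ Y)) (R : List (List (X ⊕ Y))) :
    ℬ.φ (a * ev (Sum.inl x) * (b.map ev).prod * ℬ.centeredProd ev R) =
      splitSum (covExt c x) (fun U V => ℬ.φ (U.map ev).prod *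
        ℬ.φ (a * (V.map ev).prod * ℬ.centeredProd ev R)) [] b +
      ℬ.crossTerm ev c a x (b.map ev).prod R := by
  induction R generalizing b with
  | nil => simp [centeredProd, crossTerm, h]
  | cons w R ih =>
    have e1 : a * ev (Sum.inl x) * (b.map ev).prod * ℬ.centeredProd ev (w :: R) =
        a * ev (Sum.inl x) * ((b ++ w).map ev).prod * ℬ.centeredProd ev R -
        ℬ.φ (w.map ev).prod • (a * ev (Sum.inl x) * (b.map ev).prod * ℬ.centeredProd ev R) := by
      rw [centeredProd_cons, centered]
      simp only [List.map_append, List.prod_append, mul_sub, sub_mul, mul_assoc, one_mul,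
        mul_smul_comm, smul_mul_assoc]
    rw [e1, map_sub, map_smul, ih, ih, splitSum_append, smul_add]
    simp only [crossTerm]
    have e2 : ∀ V : List (X ⊕ Y), ℬ.φ (a * (V.map ev).prod * ℬ.centeredProd ev (w :: R)) =
        ℬ.φ (a * ((V ++ w).map ev).prod * ℬ.centeredProd ev R) -
        ℬ.φ (w.map ev).prod • ℬ.φ (a * (V.map ev).prod * ℬ.centeredProd ev R) := by
      intro V
      rw [centeredProd_cons, centered]
      simp only [List.map_append, List.prod_append, mul_sub, sub_mul, mul_assoc, one_mul,
        mul_smul_comm, smul_mul_assoc, map_sub, map_smul]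
    have e3 : (b.map ev).prod * ℬ.centered ev w =
        ((b ++ w).map ev).prod - ℬ.φ (w.map ev).prod • (b.map ev).prod := by
      simp [centered, mul_sub]
    have e4 : splitSum (covExt c x) (fun U V => ℬ.φ (U.map ev).prod *
        ℬ.φ (a * (V.map ev).prod * ℬ.centeredProd ev (w :: R))) [] b =
        splitSum (covExt c x) (fun U V => ℬ.φ (U.map ev).prod *
        ℬ.φ (a * ((V ++ w).map ev).prod * ℬ.centeredProd ev R)) [] b -
        ℬ.φ (w.map ev).prod • splitSum (covExt c x) (fun U V => ℬ.φ (U.map ev).prod *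
        ℬ.φ (a * (V.map ev).prod * ℬ.centeredProd ev R)) [] b := by
      rw [sub_eq_add_neg, ← neg_smul, ← splitSum_smul, ← splitSum_add]
      congr 1
      funext U V
      rw [e2]
      simp only [smul_eq_mul]
      ring
    have e5 : splitSum (covExt c x) (fun U V => ℬ.φ (U.map ev).prod *
        ℬ.φ (a * (V.map ev).prod * ℬ.centeredProd ev R)) ([] ++ b) w =
        splitSum (covExt c x) (fun U V => ℬ.φ ((b.map ev).prod * (U.map ev).prod) *
        ℬ.φ (a * (V.map ev).prod * ℬ.centeredProd ev R)) [] w := by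
      have := splitSum_prefix (covExt c x) (fun U V => ℬ.φ (U.map ev).prod *
        ℬ.φ (a * (V.map ev).prod * ℬ.centeredProd ev R)) b [] w
      simpa using this
    rw [e3, crossTerm_sub_smul, e4, e5]
    simp only [smul_eq_mul]
    ring

variable {ι : Type*} (color : X → ι)

/-- Every letter of the block has its colour; the deterministic letters have colour `inr ()`. -/
def IsMono (b : (ι ⊕ Unit) × List (X ⊕ Y)) : Prop :=
  ∀ y ∈ b.2, Sum.map color (fun _ => ()) y = b.1

/-- An alternating list of monochromatic blocks. -/
def IsAlternating (ws : List ((ι ⊕ Unit) × List (X ⊕ Y))) : Prop :=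
  (∀ b ∈ ws, IsMono color b) ∧ ws.IsChain fun b b' => b.1 ≠ b'.1

variable {color}

/-- A nonzero covariance forces the partner of `x` into a block of the colour of `x`. The left
factor is then the mean of `W`, some intermediate centred blocks and an initial segment `U` of that
block. Centring `W` and `U` turns this into alternating products with fewer Gaussian letters, all of
which vanish by induction. -/
theorem crossTerm_eq_zero (hc : ∀ x y, color x ≠ color y → c x y = 0) (a : ℬ) (x : X)
    (W : List (X ⊕ Y)) (R₁ R₂ : List ((ι ⊕ Unit) × List (X ⊕ Y)))
    (halt : IsAlternating color ((Sum.inl (color x), W) :: (R₁ ++ R₂)))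
    (ih : ∀ ws : List ((ι ⊕ Unit) × List (X ⊕ Y)), ws ≠ [] → IsAlternating color ws →
      gaussCount (ws.map Prod.snd).flatten <
        gaussCount W + 1 + gaussCount ((R₁ ++ R₂).map Prod.snd).flatten →
      ℬ.φ (ℬ.centeredProd ev (ws.map Prod.snd)) = 0) :
    ℬ.crossTerm ev c a x ((W.map ev).prod * ℬ.centeredProd ev (R₁.map Prod.snd))
      (R₂.map Prod.snd) = 0 := by
  induction R₂ generalizing R₁ with
  | nil => rfl
  | cons b R₂ ihR =>
    obtain ⟨i, w⟩ := b
    simp only [List.map_cons, crossTerm]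
    have h2 := ihR (R₁ ++ [(i, w)]) (by simpa using halt) (by simpa using ih)
    rw [List.map_append, centeredProd_append] at h2
    simp only [List.map_cons, List.map_nil, centeredProd_singleton] at h2
    rw [mul_assoc, h2, add_zero]
    refine splitSum_eq_zero _ _ _ _ fun U y V hw hy => ?_
    refine mul_eq_zero_of_left ?_ _
    rw [List.nil_append]
    have hi : i = Sum.inl (color x) := by
      have h1 : Sum.map color (fun _ => ()) y = i := halt.1 (i, w) (by simp) y (by simp [hw])
      rcases y with y | y
      · rw [← h1]
        by_contra hne
        exact hy (hc x y fun h => hne (by simp [h]))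
      · exact absurd rfl hy
    subst hi
    -- Adjacent blocks have different colours, so a block of the colour of `x` cannot directly
    -- follow that of `W`. This is what keeps the product over `R₁` alone from being the empty
    -- product.
    have hR₁ : R₁ ≠ [] := by
      rintro rfl
      have := halt.2
      simp at this
    have hmono : ∀ b ∈ R₁, IsMono color b := fun b hb => halt.1 b (by simp [hb])
    have hW : IsMono color (Sum.inl (color x), W) := halt.1 _ (by simp)
    have hU : IsMono color (Sum.inl (color x), U) := fun z hz =>
      halt.1 (Sum.inl (color x), w) (by simp) z (by simp [hw, hz])
    have hch : ((Sum.inl (color x), W) :: (R₁ ++ [((Sum.inl (color x) : ι ⊕ Unit), U)])).IsChain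
        fun b b' => b.1 ≠ b'.1 := by
      have h1 := halt.2
      have h3 : ((Sum.inl (color x), W) :: (R₁ ++ [((Sum.inl (color x) : ι ⊕ Unit), w)])).IsChain
          fun b b' => b.1 ≠ b'.1 := by
        rw [show (Sum.inl (color x), W) :: (R₁ ++ (Sum.inl (color x), w) :: R₂) =
          ((Sum.inl (color x), W) :: (R₁ ++ [((Sum.inl (color x) : ι ⊕ Unit), w)])) ++ R₂ by simp]
          at h1
        exact h1.left_of_append
      have h4 := (List.isChain_map (R := fun i j : ι ⊕ Unit => i ≠ j) Prod.fst).2 h3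
      refine (List.isChain_map (R := fun i j : ι ⊕ Unit => i ≠ j) Prod.fst).1 ?_
      simpa using h4
    have hcount : gaussCount U + gaussCount (R₁.map Prod.snd).flatten ≤
        gaussCount ((R₁ ++ (Sum.inl (color x), w) :: R₂).map Prod.snd).flatten := by
      simp only [List.map_append, List.map_cons, List.flatten_append, List.flatten_cons,
        gaussCount_append, hw]
      omega
    have t1 := ih ((Sum.inl (color x), W) :: (R₁ ++ [(Sum.inl (color x), U)])) (by simp)
      ⟨List.forall_mem_cons.2 ⟨hW, List.forall_mem_append.2 ⟨hmono, List.forall_mem_singleton.2 hU⟩⟩,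
        hch⟩
      (by simp only [List.map_append, List.map_cons, List.map_nil, List.flatten_append,
            List.flatten_cons, gaussCount_append, List.flatten_nil] at hcount ⊢
          simp only [show gaussCount ([] : List (X ⊕ Y)) = 0 from rfl]
          omega)
    have t2 := ih (R₁ ++ [(Sum.inl (color x), U)]) (by simp)
      ⟨List.forall_mem_append.2 ⟨hmono, List.forall_mem_singleton.2 hU⟩, hch.tail⟩
      (by simp only [List.map_append, List.map_cons, List.map_nil, List.flatten_append,
            List.flatten_cons, gaussCount_append, List.flatten_nil] at hcount ⊢
          simp only [show gaussCount ([] : List (X ⊕ Y)) = 0 from rfl]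
          omega)
    have t3 := ih ((Sum.inl (color x), W) :: R₁) (by simp)
      ⟨List.forall_mem_cons.2 ⟨hW, hmono⟩,
        (List.IsChain.left_of_append (l₁ := (Sum.inl (color x), W) :: R₁) (by simpa using hch))⟩
      (by simp only [List.map_append, List.map_cons, List.flatten_append,
            List.flatten_cons, gaussCount_append] at hcount ⊢
          omega)
    have t4 := ih R₁ hR₁
      ⟨hmono, (List.IsChain.left_of_append (l₁ := (Sum.inl (color x), W) :: R₁)
        (by simpa using hch)).tail⟩ (by omega)
    simp only [List.map_cons, List.map_append, List.map_nil, centeredProd_cons,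
      centeredProd_append, ℬ.centeredProd_nil, mul_one] at t1 t2 t3 t4
    -- The four terms keep or drop the centred `W` on the left and the centred `U` on the right;
    -- `t1` to `t4` annihilate them.
    rw [prod_eq_centered_add ℬ ev W, prod_eq_centered_add ℬ ev U]
    simp only [mul_add, add_mul, map_add, mul_smul_comm, smul_mul_assoc, one_mul, mul_one,
      map_smul, ← mul_assoc] at t1 t2 t3 t4 ⊢
    simp [t1, t2, t3, t4]

/-- The cross terms vanish, so `x` is contracted only inside its own block. There the induction
hypothesis replaces the remaining tail `V` by its mean, and the sum collapses to `φ(a r) φ(x W)`,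
exactly the quantity subtracted by centring the block `x W`. -/
theorem φ_centeredProd_cons_aux (hc : ∀ x y, color x ≠ color y → c x y = 0)
    (pa : List ((ι ⊕ Unit) × List (X ⊕ Y))) (x : X) (W : List (X ⊕ Y))
    (R : List ((ι ⊕ Unit) × List (X ⊕ Y)))
    (h : ∀ W : List (X ⊕ Y), ℬ.φ (ℬ.centeredProd ev (pa.map Prod.snd) * ev (Sum.inl x) *
        (W.map ev).prod) = splitSum (covExt c x) (fun U V => ℬ.φ (U.map ev).prod *
          ℬ.φ (ℬ.centeredProd ev (pa.map Prod.snd) * (V.map ev).prod)) [] W)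
    (h₁ : ∀ W : List (X ⊕ Y), ℬ.φ (ev (Sum.inl x) *
        (W.map ev).prod) = splitSum (covExt c x) (fun U V => ℬ.φ (U.map ev).prod *
          ℬ.φ (V.map ev).prod) [] W)
    (halt : IsAlternating color (pa ++ (Sum.inl (color x), Sum.inl x :: W) :: R))
    (ih : ∀ ws : List ((ι ⊕ Unit) × List (X ⊕ Y)), ws ≠ [] → IsAlternating color ws →
      gaussCount (ws.map Prod.snd).flatten <
        gaussCount ((pa ++ (Sum.inl (color x), Sum.inl x :: W) :: R).map Prod.snd).flatten →
      ℬ.φ (ℬ.centeredProd ev (ws.map Prod.snd)) = 0) :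
    ℬ.φ (ℬ.centeredProd ev ((pa ++ (Sum.inl (color x), Sum.inl x :: W) :: R).map Prod.snd)) =
        0 := by
  have hmono : ∀ V, (∀ z ∈ V, z ∈ W) → IsMono color (Sum.inl (color x), V) := fun V hV z hz =>
    halt.1 (Sum.inl (color x), Sum.inl x :: W) (by simp) z (by simp [hV z hz])
  have halt' : ∀ V, (∀ z ∈ V, z ∈ W) →
      IsAlternating color (pa ++ (Sum.inl (color x), V) :: R) := by
    intro V hV
    constructor
    · intro b hb
      rw [List.mem_append, List.mem_cons] at hb
      rcases hb with hb | rfl | hb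
      · exact halt.1 b (by simp [hb])
      · exact hmono V hV
      · exact halt.1 b (by simp [hb])
    · have h4 := (List.isChain_map (R := fun i j : ι ⊕ Unit => i ≠ j) Prod.fst).2 halt.2
      refine (List.isChain_map (R := fun i j : ι ⊕ Unit => i ≠ j) Prod.fst).1 ?_
      simpa using h4
  set a := ℬ.centeredProd ev (pa.map Prod.snd) with ha
  set r := ℬ.centeredProd ev (R.map Prod.snd) with hr
  have key := ℬ.φ_block_eq ev c a x h W (R.map Prod.snd)
  have hcross : ℬ.crossTerm ev c a x (W.map ev).prod (R.map Prod.snd) = 0 := by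
    have := ℬ.crossTerm_eq_zero ev c hc a x W [] R
      (by
        have h0 := halt' W fun _ hz => hz
        exact ⟨fun b hb => h0.1 b (List.mem_append_right _ hb), h0.2.right_of_append⟩)
      (fun ws h1 h2 h3 => ih ws h1 h2 (by
        simp only [List.map_append, List.map_cons, List.flatten_append, List.nil_append,
            List.flatten_cons, gaussCount_append, gaussCount_inl] at h3 ⊢
        omega))
    simpa [centeredProd] using this
  rw [hcross, add_zero, ← hr] at key
  have e1 : splitSum (covExt c x) (fun U V => ℬ.φ (U.map ev).prod *
        ℬ.φ (a * (V.map ev).prod * r)) [] W = ℬ.φ (a * r) * splitSum (covExt c x)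
        (fun U V => ℬ.φ (U.map ev).prod * ℬ.φ (V.map ev).prod) [] W := by
    rw [← smul_eq_mul (ℬ.φ (a * r)), ← splitSum_smul]
    refine splitSum_congr _ _ _ _ _ fun U y V hW hy => ?_
    -- Removing `x` lowers the Gaussian count, so the product with the centred tail `V` in place of
    -- the block vanishes: `φ(a V r) = φ(V) φ(a r)`.
    have h0 := ih _ (by simp) (halt' V fun z hz => by simp [hW, hz]) (by
        simp only [List.map_append, List.map_cons, List.flatten_append,
            List.flatten_cons, gaussCount_append, gaussCount_inl, hW]
        have := gaussCount_cons y V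
        omega)
    simp only [List.map_append, List.map_cons, centeredProd_append, centeredProd_cons, ← ha,
      ← hr, centered, sub_mul, mul_sub, map_sub, smul_mul_assoc, mul_smul_comm, one_mul,
      map_smul, smul_eq_mul] at h0
    rw [sub_eq_zero, ← mul_assoc] at h0
    simp only [smul_eq_mul, List.nil_append, h0]
    ring
  rw [e1, ← h₁] at key
  simp only [List.map_append, List.map_cons, centeredProd_append, centeredProd_cons, ← ha,
      ← hr, centered, sub_mul, mul_sub, map_sub, smul_mul_assoc, mul_smul_comm, one_mul,
      map_smul, smul_eq_mul, List.prod_cons]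
  simp only [← mul_assoc]
  rw [key]
  ring

/-- Products of alternating centred words vanish, by the Schwinger–Dyson equations. -/
theorem φ_centeredProd_eq_zero (hc : ∀ x y, color x ≠ color y → c x y = 0)
    (hSD : SchwingerDyson c fun w => ℬ.φ (w.map ev).prod)
    (ws : List ((ι ⊕ Unit) × List (X ⊕ Y))) (hne : ws ≠ []) (halt : IsAlternating color ws) :
    ℬ.φ (ℬ.centeredProd ev (ws.map Prod.snd)) = 0 := by
  induction hN : gaussCount (ws.map Prod.snd).flatten using Nat.strong_induction_on
    generalizing ws with
  | _ N ihN =>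
  subst hN
  have ih : ∀ ws' : List ((ι ⊕ Unit) × List (X ⊕ Y)), ws' ≠ [] → IsAlternating color ws' →
      gaussCount (ws'.map Prod.snd).flatten < gaussCount (ws.map Prod.snd).flatten →
      ℬ.φ (ℬ.centeredProd ev (ws'.map Prod.snd)) = 0 := fun ws' h1 h2 h3 => ihN _ h3 ws' h1 h2 rfl
  have hSD₁ : ∀ (x : X) (W : List (X ⊕ Y)), ℬ.φ (ev (Sum.inl x) *
        (W.map ev).prod) = splitSum (covExt c x) (fun U V => ℬ.φ (U.map ev).prod *
          ℬ.φ (V.map ev).prod) [] W := by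
    intro x W
    simpa using hSD [] x W
  -- a nonempty block of colour `inl i` starts with a Gaussian letter
  have hshape : ∀ (i : ι) (w : List (X ⊕ Y)), IsMono color (Sum.inl i, w) →
      w = [] ∨ ∃ x W, i = color x ∧ w = Sum.inl x :: W := by
    intro i w hw
    rcases w with _ | ⟨y, W⟩
    · exact Or.inl rfl
    · have := hw y (by simp)
      rcases y with x | y
      · exact Or.inr ⟨x, W, by simpa using this.symm, rfl⟩
      · simp at this
  rcases ws with _ | ⟨⟨i, w⟩, R⟩
  · exact absurd rfl hne
  rcases i with i | i
  · rcases hshape i w (halt.1 _ (by simp)) with rfl | ⟨x, W, rfl, rfl⟩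
    · simp [centeredProd]
    · refine ℬ.φ_centeredProd_cons_aux ev c hc [] x W R ?_ (hSD₁ x) halt ih
      intro W
      simpa [centeredProd] using hSD₁ x W
  · rcases R with _ | ⟨⟨j, w'⟩, R⟩
    · simp [centeredProd, φ_centered]
    · rcases j with j | j
      swap
      · exact absurd rfl (halt.2.rel : (Sum.inr i : ι ⊕ Unit) ≠ Sum.inr j)
      rcases hshape j w' (halt.1 _ (by simp)) with rfl | ⟨x, W, rfl, rfl⟩
      · simp [centeredProd]
      -- The equations allow only deterministic letters before `x`. By alternation at most one
      -- deterministic block precedes the first Gaussian one.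
      obtain ⟨v, rfl⟩ : ∃ v : List Y, w = v.map Sum.inr := by
        rcases exists_first_gauss w with h | ⟨v, x', V, rfl⟩
        · exact h
        · have := halt.1 _ (List.mem_cons_self) (Sum.inl x') (by simp)
          simp at this
      refine ℬ.φ_centeredProd_cons_aux ev c hc [(Sum.inr i, v.map Sum.inr)] x W R ?_ (hSD₁ x)
        halt ih
      intro W
      simp only [List.map_cons, List.map_nil, centeredProd_singleton, centered, sub_mul,
        smul_mul_assoc, one_mul, map_sub, map_smul, mul_assoc]
      -- The identity for the centred prefix is the equation with prefix `v` minus `φ(v)` times the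
      -- one with empty prefix.
      have h1 := hSD v x W
      simp only [List.map_append, List.prod_append, List.map_cons, List.prod_cons] at h1
      rw [h1, hSD₁, sub_eq_add_neg, ← neg_smul, ← splitSum_smul, ← splitSum_add]
      congr 1
      funext U V
      simp only [smul_eq_mul]
      ring

end FreeOfSchwingerDyson

end NCProbSpace

/-! ### From centred words to arbitrary centred elements -/

/-- Elements of the `*`-subalgebra generated by `S` are linear combinations of words in any
self-adjoint system of letters containing `S`. -/
theorem mem_span_words_of_mem_adjoin {A L : Type*} [Ring A] [StarRing A] [Algebra ℂ A]
    [StarModule ℂ A] (ev : L → A) (S : Set A) (P : L → Prop)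
    (h : ∀ z ∈ S, (∃ y, P y ∧ ev y = z) ∧ ∃ y, P y ∧ ev y = star z) {z : A}
    (hz : z ∈ StarAlgebra.adjoin ℂ S) :
    z ∈ Submodule.span ℂ {a | ∃ W : List L, (∀ y ∈ W, P y) ∧ (W.map ev).prod = a} := by
  have hz' : z ∈ (StarAlgebra.adjoin ℂ S).toSubalgebra := hz
  rw [StarAlgebra.adjoin_toSubalgebra, ← Subalgebra.mem_toSubmodule, Algebra.adjoin_eq_span] at hz'
  refine Submodule.span_mono ?_ hz'
  intro a ha
  obtain ⟨l, hl, rfl⟩ := Submonoid.exists_list_of_mem_closure ha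
  have key : ∀ b ∈ S ∪ star S, ∃ y, P y ∧ ev y = b := by
    rintro b (hb | hb)
    · exact (h b hb).1
    · simpa using (h _ hb).2
  clear ha
  induction l with
  | nil => exact ⟨[], by simp, rfl⟩
  | cons b l ih =>
    obtain ⟨W, hW, hW'⟩ := ih fun y hy => hl y (by simp [hy])
    obtain ⟨y, hy, rfl⟩ := key b (hl b (by simp))
    exact ⟨y :: W, by simpa [hy] using hW, by simp [hW']⟩

theorem List.exists_of_not_isChain {α : Type*} (R : α → α → Prop) (l : List α)
    (h : ¬ l.IsChain R) : ∃ l₁ a b l₂, l = l₁ ++ a :: b :: l₂ ∧ ¬ R a b := by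
  induction l with
  | nil => exact absurd List.IsChain.nil h
  | cons a l ih =>
    rcases l with _ | ⟨b, l⟩
    · exact absurd (List.IsChain.singleton a) h
    · rw [List.isChain_cons_cons, not_and_or] at h
      rcases h with h | h
      · exact ⟨[], a, b, l, rfl, h⟩
      · obtain ⟨l₁, x, y, l₂, e, hR⟩ := ih h
        exact ⟨a :: l₁, x, y, l₂, by simp [e], hR⟩

namespace NCProbSpace

section FreeOfWords

variable (ℬ : NCProbSpace.{u}) {L κ : Type*} (ev : L → ℬ) (col : L → κ)

/-- Multilinearity: the factors of `l` are replaced by centred words one at a time, from the left,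
and collected in `pre`. Only the colours enter the alternation condition, so it survives each
replacement. -/
theorem φ_centeredProd_mul_prod_eq_zero
    (h : ∀ ws : List (κ × List L), ws ≠ [] → (∀ b ∈ ws, ∀ y ∈ b.2, col y = b.1) →
      (ws.IsChain fun b b' => b.1 ≠ b'.1) → ℬ.φ (ℬ.centeredProd ev (ws.map Prod.snd)) = 0)
    (l : List (κ × ℬ)) (pre : List (κ × List L)) (hne : pre.map Prod.fst ++ l.map Prod.fst ≠ [])
    (hch : (pre.map Prod.fst ++ l.map Prod.fst).IsChain (· ≠ ·))
    (hpre : ∀ b ∈ pre, ∀ y ∈ b.2, col y = b.1)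
    (hl : ∀ b ∈ l, b.2 ∈ Submodule.span ℂ
      {a | ∃ W : List L, (∀ y ∈ W, col y = b.1) ∧ ℬ.centered ev W = a}) :
    ℬ.φ (ℬ.centeredProd ev (pre.map Prod.snd) * (l.map Prod.snd).prod) = 0 := by
  induction l generalizing pre with
  | nil =>
    simp only [List.map_nil, List.append_nil, List.prod_nil, mul_one] at *
    exact h pre (by simpa using hne) hpre ((List.isChain_map Prod.fst).1 hch)
  | cons b l ih =>
    have hb := hl b (by simp)
    obtain ⟨i, z⟩ := b
    simp only [List.map_cons, List.prod_cons] at *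
    clear hne
    refine Submodule.span_induction (p := fun z _ => ℬ.φ (ℬ.centeredProd ev (pre.map Prod.snd) *
      (z * (l.map Prod.snd).prod)) = 0) ?_ ?_ ?_ ?_ hb
    · rintro _ ⟨W, hW, rfl⟩
      have := ih (pre ++ [(i, W)]) (by simp) (by simpa using hch)
        (List.forall_mem_append.2 ⟨hpre, List.forall_mem_singleton.2 hW⟩)
        (fun b hb => hl b (by simp [hb]))
      rw [List.map_append, centeredProd_append] at this
      simpa [centeredProd_singleton, mul_assoc] using this
    · simp
    · intro x y _ _ hx hy
      simp [add_mul, mul_add, hx, hy]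
    · intro t x _ hx
      simp [hx]

/-- Freeness can be tested on alternating products of centred words. -/
theorem isFree_of_words (S : κ → Set ℬ)
    (hS : ∀ i, ∀ z ∈ S i, (∃ y, col y = i ∧ ev y = z) ∧ ∃ y, col y = i ∧ ev y = star z)
    (h : ∀ ws : List (κ × List L), ws ≠ [] → (∀ b ∈ ws, ∀ y ∈ b.2, col y = b.1) →
      (ws.IsChain fun b b' => b.1 ≠ b'.1) → ℬ.φ (ℬ.centeredProd ev (ws.map Prod.snd)) = 0) :
    ℬ.IsFree S := by
  intro k i x hi hx hφ
  have h1 := ℬ.φ_centeredProd_mul_prod_eq_zero ev col h (List.ofFn fun j => (i j, x j)) []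
    (by simp)
    (by
      rw [List.map_nil, List.nil_append, List.map_ofFn, List.isChain_ofFn]
      intro j hj
      exact hi ⟨j, by omega⟩)
    (by simp)
    (by
      intro b hb
      rw [List.mem_ofFn] at hb
      obtain ⟨j, rfl⟩ := hb
      have h2 := mem_span_words_of_mem_adjoin ev (S (i j)) (fun y => col y = i j) (hS (i j)) (hx j)
      -- Centring is a linear map that fixes centred elements and sends words to centred words, so a
      -- centred element in the span of words lies in the span of centred words.
      let T : ℬ →ₗ[ℂ] ℬ := LinearMap.id - (ℬ.φ).smulRight 1
      have h3 := Submodule.mem_map_of_mem (f := T) h2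
      rw [Submodule.map_span] at h3
      have h4 : T (x j) = x j := by simp [T, hφ j]
      rw [h4] at h3
      refine Submodule.span_mono ?_ h3
      rintro _ ⟨_, ⟨W, hW, rfl⟩, rfl⟩
      exact ⟨W, hW, by simp [T, centered]⟩)
  simpa [centeredProd, List.map_ofFn, Function.comp_def] using h1

theorem IsFree.comp_injective {ℬ : NCProbSpace.{u}} {κ' : Type*} {S : κ → Set ℬ} (h : ℬ.IsFree S)
    (f : κ' → κ) (hf : Function.Injective f) : ℬ.IsFree (fun i => S (f i)) := fun k i x hi hx hφ =>
  h k (f ∘ i) x (fun j hj => hi j (hf hj)) hx hφ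

theorem isFree_of_schwingerDyson {X Y ι : Type*} (ev : X ⊕ Y → ℬ) (c : X → X → ℂ) (color : X → ι)
    (hc : ∀ x y, color x ≠ color y → c x y = 0)
    (hSD : SchwingerDyson c fun w => ℬ.φ (w.map ev).prod) (S : ι → Set ℬ) (S' : Set ℬ)
    (hS : ∀ i, ∀ z ∈ S i, (∃ y, color y = i ∧ ev (Sum.inl y) = z) ∧
      ∃ y, color y = i ∧ ev (Sum.inl y) = star z)
    (hS' : ∀ z ∈ S', (∃ y, ev (Sum.inr y) = z) ∧ ∃ y, ev (Sum.inr y) = star z) :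
    ℬ.IsFree (Sum.elim S fun _ : Unit => S') := by
  refine ℬ.isFree_of_words ev (Sum.map color fun _ => ()) _ ?_ ?_
  · rintro (i | i) z hz
    · obtain ⟨⟨y, hy, hy'⟩, x, hx, hx'⟩ := hS i z hz
      exact ⟨⟨Sum.inl y, by simp [hy], hy'⟩, Sum.inl x, by simp [hx], hx'⟩
    · obtain ⟨⟨y, hy'⟩, x, hx'⟩ := hS' z hz
      exact ⟨⟨Sum.inr y, by simp, hy'⟩, Sum.inr x, by simp, hx'⟩
  · intro ws h1 h2 h3
    exact ℬ.φ_centeredProd_eq_zero ev c hc hSD ws h1 ⟨h2, h3⟩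

end FreeOfWords

/-! ### Uniqueness of the joint distribution of free families -/

section Uniqueness

variable (ℬ : NCProbSpace.{u}) (ℬ' : NCProbSpace.{v}) {κ : Type*}

/-- A list of pairs of elements of two spaces has the same expected product in both. -/
def Agree (l : List (ℬ × ℬ')) : Prop :=
  ℬ.φ (l.map Prod.fst).prod = ℬ'.φ (l.map Prod.snd).prod

variable {ℬ ℬ'}

theorem IsFree.φ_list_prod_eq_zero {S : κ → Set ℬ} (h : ℬ.IsFree S) (l : List (κ × ℬ))
    (hne : l ≠ []) (hch : l.IsChain fun b b' => b.1 ≠ b'.1)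
    (hmem : ∀ b ∈ l, b.2 ∈ StarAlgebra.adjoin ℂ (S b.1)) (hφ : ∀ b ∈ l, ℬ.φ b.2 = 0) :
    ℬ.φ (l.map Prod.snd).prod = 0 := by
  obtain ⟨k, hk⟩ : ∃ k, l.length = k + 1 := ⟨l.length - 1, by
    have := List.length_pos_iff.2 hne; omega⟩
  have h1 := h k (fun j => (l.get (j.cast hk.symm)).1) (fun j => (l.get (j.cast hk.symm)).2)
    (fun j => by
      rw [List.isChain_iff_getElem] at hch
      exact hch j (by omega))
    (fun j => hmem _ (List.get_mem _ _)) (fun j => hφ _ (List.get_mem _ _))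
  have h2 : List.ofFn (fun j : Fin (k + 1) => (l.get (j.cast hk.symm)).2) = l.map Prod.snd := by
    apply List.ext_getElem
    · simp [hk]
    · intro i h1 h2
      rw [List.getElem_ofFn]
      simp
  rwa [h2] at h1

/-- The centring of a pair, with respect to the expectation of the first component. -/
noncomputable def pairCenter (p : ℬ × ℬ') : ℬ × ℬ' := p - ℬ.φ p.1 • 1

/-- Entries are centred one at a time. Each replacement changes the two expectations by a scalar
multiple of a product with one factor fewer, where agreement is already known. -/
theorem agree_append_of_centered (T : κ → Subalgebra ℂ (ℬ × ℬ'))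
    (N : ℕ) (hN : ∀ l : List (κ × (ℬ × ℬ')), l.length < N → (∀ b ∈ l, b.2 ∈ T b.1) →
      Agree ℬ ℬ' (l.map Prod.snd))
    (suf pre : List (κ × (ℬ × ℬ'))) (hlen : (pre ++ suf).length ≤ N)
    (hmem : ∀ b ∈ pre ++ suf, b.2 ∈ T b.1)
    (h : Agree ℬ ℬ' ((pre ++ suf.map fun b => (b.1, pairCenter b.2)).map Prod.snd)) :
    Agree ℬ ℬ' ((pre ++ suf).map Prod.snd) := by
  induction suf generalizing pre with
  | nil => simpa using h
  | cons b s ih =>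
    have := ih (pre ++ [b]) (by simpa using hlen) (by simpa using hmem) ?_
    · simpa using this
    have h0 : Agree ℬ ℬ' ((pre ++ s.map fun b => (b.1, pairCenter b.2)).map Prod.snd) := by
      refine hN _ (by simp at hlen ⊢; omega) ?_
      intro q hq
      rw [List.mem_append, List.mem_map] at hq
      rcases hq with hq | ⟨q, hq, rfl⟩
      · exact hmem q (by simp [hq])
      · exact sub_mem (hmem q (by simp [hq])) (Subalgebra.smul_mem _ (one_mem _) _)
    simp only [Agree, List.map_append, List.map_map, Function.comp_def, List.prod_append,
      List.map_cons, List.prod_cons, List.map_nil, List.prod_nil, mul_one] at h h0 ⊢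
    simp only [pairCenter, Prod.fst_sub, Prod.snd_sub, Prod.smul_fst, Prod.smul_snd, Prod.fst_one,
      Prod.snd_one, sub_mul, mul_sub, smul_mul_assoc, mul_smul_comm, one_mul, map_sub,
      map_smul] at h h0 ⊢
    rw [h0] at h
    have := sub_left_inj.1 h
    simpa [mul_assoc] using this

/-- Induction on the length. Neighbours from the same subalgebra are multiplied together; if there
are none, the list is alternating, and after centring both expectations vanish by freeness. Centring
by the mean of the first component also centres the second, because the marginals agree. -/
theorem φ_eq_of_mem_T_aux (T : κ → Subalgebra ℂ (ℬ × ℬ')) (S : κ → Set ℬ) (S' : κ → Set ℬ')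
    (hS : ℬ.IsFree S) (hS' : ℬ'.IsFree S')
    (hT : ∀ i, ∀ p ∈ T i, p.1 ∈ StarAlgebra.adjoin ℂ (S i) ∧ p.2 ∈ StarAlgebra.adjoin ℂ (S' i) ∧
      ℬ.φ p.1 = ℬ'.φ p.2) (l : List (κ × (ℬ × ℬ'))) (hl : ∀ b ∈ l, b.2 ∈ T b.1) :
    Agree ℬ ℬ' (l.map Prod.snd) := by
  induction hN : l.length using Nat.strong_induction_on generalizing l with
  | _ N ih =>
  subst hN
  have ih' : ∀ l' : List (κ × (ℬ × ℬ')), l'.length < l.length → (∀ b ∈ l', b.2 ∈ T b.1) →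
      Agree ℬ ℬ' (l'.map Prod.snd) := fun l' h1 h2 => ih _ h1 l' h2 rfl
  rcases eq_or_ne l [] with rfl | hne
  · simp [Agree, ℬ.map_one, ℬ'.map_one]
  by_cases hch : l.IsChain fun b b' => b.1 ≠ b'.1
  · refine agree_append_of_centered T l.length ih' l [] (by simp) (by simpa using hl) ?_
    have hcen : ∀ b ∈ l, pairCenter b.2 ∈ T b.1 := fun b hb =>
      sub_mem (hl b hb) (Subalgebra.smul_mem _ (one_mem _) _)
    have h1 := hS.φ_list_prod_eq_zero (l.map fun b => (b.1, (pairCenter b.2).1))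
        (by simpa using hne)
      (by rw [List.isChain_map]; exact hch)
      (by
        intro b hb
        obtain ⟨b, hb', rfl⟩ := List.mem_map.1 hb
        exact (hT _ _ (hcen b hb')).1)
      (by
        intro b hb
        obtain ⟨b, hb, rfl⟩ := List.mem_map.1 hb
        simp [pairCenter, ℬ.map_one])
    have h2 := hS'.φ_list_prod_eq_zero (l.map fun b => (b.1, (pairCenter b.2).2))
        (by simpa using hne)
      (by rw [List.isChain_map]; exact hch)
      (by
        intro b hb
        obtain ⟨b, hb', rfl⟩ := List.mem_map.1 hb
        exact (hT _ _ (hcen b hb')).2.1)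
      (by
        intro b hb
        obtain ⟨b, hb', rfl⟩ := List.mem_map.1 hb
        simp [pairCenter, ℬ'.map_one, (hT _ _ (hl b hb')).2.2])
    simp only [List.map_map, Function.comp_def] at h1 h2
    simp [Agree, Function.comp_def, h1, h2]
  · obtain ⟨l₁, a, b, l₂, e, hab⟩ := List.exists_of_not_isChain _ _ hch
    rw [not_not] at hab
    have h1 := ih' (l₁ ++ (a.1, a.2 * b.2) :: l₂) (by simp [e]) (by
      intro q hq
      rw [List.mem_append, List.mem_cons] at hq
      rcases hq with hq | rfl | hq
      · exact hl q (by simp [e, hq])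
      · exact mul_mem (hl a (by simp [e])) (hab ▸ hl b (by simp [e]))
      · exact hl q (by simp [e, hq]))
    rw [e]
    simpa [Agree, mul_assoc] using h1

/-- Working inside the product algebra `ℬ × ℬ'` makes equality of the two functionals a linear
condition, to be checked on products of generators. -/
theorem φ_eq_of_mem_algebraAdjoin (G : Set (ℬ × ℬ'))
    (h : ∀ l : List (ℬ × ℬ'), (∀ p ∈ l, p ∈ G) → Agree ℬ ℬ' l) {p : ℬ × ℬ'}
    (hp : p ∈ Algebra.adjoin ℂ G) : ℬ.φ p.1 = ℬ'.φ p.2 := by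
  rw [← Subalgebra.mem_toSubmodule, Algebra.adjoin_eq_span] at hp
  refine Submodule.span_induction (p := fun p _ => ℬ.φ p.1 = ℬ'.φ p.2) ?_ ?_ ?_ ?_ hp
  · intro q hq
    obtain ⟨l, hl, rfl⟩ := Submonoid.exists_list_of_mem_closure hq
    have := h l hl
    rw [Agree] at this
    have e1 : ∀ l : List (ℬ × ℬ'), l.prod.1 = (l.map Prod.fst).prod ∧
        l.prod.2 = (l.map Prod.snd).prod := fun l => by
      induction l with
      | nil => simp
      | cons a l ih => simp [ih.1, ih.2]
    rw [(e1 l).1, (e1 l).2, this]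
  · simp
  · intro x y _ _ hx hy
    simp [hx, hy]
  · intro t x _ hx
    simp [hx]

/-- Joint moments of pairs generating free families are determined by the marginals. -/
theorem agree_of_isFree (G : κ → Set (ℬ × ℬ')) (S : κ → Set ℬ) (S' : κ → Set ℬ')
    (hS : ℬ.IsFree S) (hS' : ℬ'.IsFree S')
    (hG : ∀ i, ∀ p ∈ G i, p.1 ∈ StarAlgebra.adjoin ℂ (S i) ∧ p.2 ∈ StarAlgebra.adjoin ℂ (S' i))
    (hmarg : ∀ i, ∀ l : List (ℬ × ℬ'), (∀ p ∈ l, p ∈ G i) → Agree ℬ ℬ' l)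
    (l : List (ℬ × ℬ')) (hl : ∀ p ∈ l, ∃ i, p ∈ G i) : Agree ℬ ℬ' l := by
  have h1 := φ_eq_of_mem_T_aux (fun i => Algebra.adjoin ℂ (G i)) S S' hS hS' (by
    intro i p hp
    have hle1 : Algebra.adjoin ℂ (G i) ≤
        (StarAlgebra.adjoin ℂ (S i)).toSubalgebra.comap (AlgHom.fst ℂ ℬ ℬ') :=
      Algebra.adjoin_le fun q hq => (hG i q hq).1
    have hle2 : Algebra.adjoin ℂ (G i) ≤
        (StarAlgebra.adjoin ℂ (S' i)).toSubalgebra.comap (AlgHom.snd ℂ ℬ ℬ') :=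
      Algebra.adjoin_le fun q hq => (hG i q hq).2
    exact ⟨hle1 hp, hle2 hp, φ_eq_of_mem_algebraAdjoin (G i) (hmarg i) hp⟩)
  have h2 : ∃ l' : List (κ × (ℬ × ℬ')), l = l'.map Prod.snd ∧ ∀ b ∈ l', b.2 ∈ G b.1 := by
    clear h1
    induction l with
    | nil => exact ⟨[], by simp⟩
    | cons p l ih =>
      obtain ⟨l', e, h'⟩ := ih fun q hq => hl q (by simp [hq])
      obtain ⟨i, hi⟩ := hl p (by simp)
      exact ⟨(i, p) :: l', by simp [e], by simpa [hi] using h'⟩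
  obtain ⟨l', rfl, h'⟩ := h2
  exact h1 l' fun b hb => Algebra.subset_adjoin (h' b hb)

/-- An elliptic element and its adjoint are linear combinations of two free semicirculars, and the
coefficients depend only on `ρ`. All moments therefore reduce to moments in the pairs of
semicirculars, whose marginals are the semicircle moments. -/
theorem agree_of_isElliptic {ρ : ℝ} {e : ℬ} {e' : ℬ'} (h : ℬ.IsElliptic ρ e)
    (h' : ℬ'.IsElliptic ρ e') (l : List (ℬ × ℬ'))
    (hl : ∀ p ∈ l, p = (e, e') ∨ p = (star e, star e')) : Agree ℬ ℬ' l := by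
  obtain ⟨-, s₁, s₂, hs₁, hs₂, hfree, he⟩ := h
  obtain ⟨-, t₁, t₂, ht₁, ht₂, hfree', he'⟩ := h'
  have hpow : ∀ {s : ℬ} {t : ℬ'}, ℬ.IsSemicircular s → ℬ'.IsSemicircular t →
      ∀ l : List (ℬ × ℬ'), (∀ p ∈ l, p ∈ ({(s, t)} : Set (ℬ × ℬ'))) → Agree ℬ ℬ' l := by
    intro s t hs ht l hl
    rw [List.eq_replicate_of_mem (fun p hp => Set.mem_singleton_iff.1 (hl p hp))]
    simp only [Agree, List.map_replicate, List.prod_replicate]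
    rw [hs.2, ht.2]
  have key := agree_of_isFree (κ := Bool)
    (fun b => if b then {(s₁, t₁)} else {(s₂, t₂)}) _ _ hfree hfree'
    (by
      rintro (_ | _) p hp
      · obtain rfl : p = (s₂, t₂) := by simpa using hp
        exact ⟨StarAlgebra.subset_adjoin ℂ _ (by simp), StarAlgebra.subset_adjoin ℂ _ (by simp)⟩
      · obtain rfl : p = (s₁, t₁) := by simpa using hp
        exact ⟨StarAlgebra.subset_adjoin ℂ _ (by simp), StarAlgebra.subset_adjoin ℂ _ (by simp)⟩)
    (by
      rintro (_ | _) l hl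
      · exact hpow hs₂ ht₂ l (by simpa using hl)
      · exact hpow hs₁ ht₁ l (by simpa using hl))
  let G : Set (ℬ × ℬ') := {(s₁, t₁), (s₂, t₂)}
  have hG : ∀ p ∈ Algebra.adjoin ℂ G, ℬ.φ p.1 = ℬ'.φ p.2 := by
    intro p hp
    refine φ_eq_of_mem_algebraAdjoin G (fun l hl => key l fun q hq => ?_) hp
    rcases hl q hq with h | h
    · exact ⟨true, by simp [h]⟩
    · exact ⟨false, by simpa using h⟩
  have m₁ : (s₁, t₁) ∈ Algebra.adjoin ℂ G := Algebra.subset_adjoin (by simp [G])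
  have m₂ : (s₂, t₂) ∈ Algebra.adjoin ℂ G := Algebra.subset_adjoin (by simp [G])
  have me : (e, e') ∈ Algebra.adjoin ℂ G := by
    have := add_mem (Subalgebra.smul_mem _ m₁ ((√((1 + ρ) / 2) : ℝ) : ℂ))
      (Subalgebra.smul_mem _ m₂ (Complex.I * ((√((1 - ρ) / 2) : ℝ) : ℂ)))
    rw [he, he']
    exact this
  have me' : (star e, star e') ∈ Algebra.adjoin ℂ G := by
    have := add_mem (Subalgebra.smul_mem _ m₁ (star ((√((1 + ρ) / 2) : ℝ) : ℂ)))
      (Subalgebra.smul_mem _ m₂ (star (Complex.I * ((√((1 - ρ) / 2) : ℝ) : ℂ))))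
    rw [he, he']
    simp only [star_add, star_smul, hs₁.1.star_eq, hs₂.1.star_eq, ht₁.1.star_eq, ht₂.1.star_eq]
    exact this
  have hprod : l.prod ∈ Algebra.adjoin ℂ G := by
    refine list_prod_mem fun p hp => ?_
    rcases hl p hp with rfl | rfl
    · exact me
    · exact me'
  have e1 : ∀ l : List (ℬ × ℬ'), l.prod.1 = (l.map Prod.fst).prod ∧
      l.prod.2 = (l.map Prod.snd).prod := fun l => by
    induction l with
    | nil => simp
    | cons a l ih => simp [ih.1, ih.2]
  have := hG _ hprod
  rwa [(e1 l).1, (e1 l).2] at this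

/-- The joint `*`-distribution of free elliptic elements and a further family free from them is
determined by the parameters and the `*`-distribution of that family. -/
theorem sameStarDist_sumElim {ι κ' : Type*} {ρ : ι → ℝ} {e : ι → ℬ} {e' : ι → ℬ'}
    {d : κ' → ℬ} {d' : κ' → ℬ'}
    (h : ∀ i, ℬ.IsElliptic (ρ i) (e i)) (h' : ∀ i, ℬ'.IsElliptic (ρ i) (e' i))
    (hd : SameStarDist ℬ ℬ' d d')
    (hfree : ℬ.IsFree (Sum.elim (fun i => {e i}) fun _ : Unit => Set.range d))
    (hfree' : ℬ'.IsFree (Sum.elim (fun i => {e' i}) fun _ : Unit => Set.range d')) :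
    SameStarDist ℬ ℬ' (Sum.elim e d) (Sum.elim e' d') := by
  have key := agree_of_isFree (κ := ι ⊕ Unit)
    (Sum.elim (fun i => {(e i, e' i), (star (e i), star (e' i))})
      fun _ => {p | ∃ q : κ' × Bool, p = if q.2 then (star (d q.1), star (d' q.1)) else
        (d q.1, d' q.1)}) _ _ hfree hfree'
    (by
      rintro (i | i) p hp
      · rcases hp with rfl | hp
        · exact ⟨StarAlgebra.subset_adjoin ℂ _ (by simp), StarAlgebra.subset_adjoin ℂ _ (by simp)⟩
        · rw [Set.mem_singleton_iff.1 hp]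
          exact ⟨star_mem (StarAlgebra.subset_adjoin ℂ _ (by simp)),
            star_mem (StarAlgebra.subset_adjoin ℂ _ (by simp))⟩
      · obtain ⟨⟨j, b⟩, rfl⟩ := hp
        have h1 : d j ∈ StarAlgebra.adjoin ℂ (Set.range d) :=
          StarAlgebra.subset_adjoin ℂ _ (by simp)
        have h2 : d' j ∈ StarAlgebra.adjoin ℂ (Set.range d') :=
          StarAlgebra.subset_adjoin ℂ _ (by simp)
        rcases b
        · exact ⟨h1, h2⟩
        · exact ⟨star_mem h1, star_mem h2⟩)
    (by
      rintro (i | i) l hl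
      · exact agree_of_isElliptic (h i) (h' i) l (by simpa using hl)
      · have h2 : ∃ w : List (κ' × Bool), l = w.map fun q =>
            if q.2 then (star (d q.1), star (d' q.1)) else (d q.1, d' q.1) := by
          induction l with
          | nil => exact ⟨[], rfl⟩
          | cons p l ih =>
            obtain ⟨w, rfl⟩ := ih fun q hq => hl q (by simp [hq])
            obtain ⟨q, rfl⟩ := hl p (by simp)
            exact ⟨q :: w, rfl⟩
        obtain ⟨w, rfl⟩ := h2
        have := hd w
        simp only [starWord] at this
        simp only [Agree, List.map_map, Function.comp_def, apply_ite Prod.fst, apply_ite Prod.snd]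
        exact this)
  intro w
  have := key (w.map fun q => if q.2 then (star (Sum.elim e d q.1), star (Sum.elim e' d' q.1)) else
    (Sum.elim e d q.1, Sum.elim e' d' q.1)) (by
      intro p hp
      obtain ⟨⟨q, b⟩, -, rfl⟩ := List.mem_map.1 hp
      rcases q with i | j
      · refine ⟨Sum.inl i, ?_⟩
        rcases b <;> simp
      · refine ⟨Sum.inr (), (j, b), ?_⟩
        rcases b <;> simp)
  simpa only [Agree, List.map_map, Function.comp_def, apply_ite Prod.fst, apply_ite Prod.snd,
    starWord] using this

end Uniqueness

end NCProbSpace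

/-! ### Semicircle moments and Catalan numbers -/

section SemicircleMoments

/-- Integrate the derivative of `t^(p+1) (4 - t²)^(3/2)`, which vanishes at both endpoints. -/
theorem integral_pow_mul_sqrt_add_two (p : ℕ) :
    ((p : ℝ) + 4) * ∫ t in (-2 : ℝ)..2, t ^ (p + 2) * √(4 - t ^ 2) =
      4 * ((p : ℝ) + 1) * ∫ t in (-2 : ℝ)..2, t ^ p * √(4 - t ^ 2) := by
  have hcont : ∀ q : ℕ, Continuous fun t : ℝ => t ^ q * √(4 - t ^ 2) := fun q => by fun_prop
  have hint : ∀ q : ℕ, IntervalIntegrable (fun t : ℝ => t ^ q * √(4 - t ^ 2)) volume (-2) 2 :=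
    fun q => (hcont q).intervalIntegrable _ _
  have key := intervalIntegral.integral_eq_sub_of_hasDerivAt_of_le (a := -2) (b := 2)
    (f := fun t : ℝ => t ^ (p + 1) * ((4 - t ^ 2) * √(4 - t ^ 2)))
    (f' := fun t : ℝ => 4 * ((p : ℝ) + 1) * (t ^ p * √(4 - t ^ 2)) -
      ((p : ℝ) + 4) * (t ^ (p + 2) * √(4 - t ^ 2))) (by norm_num)
    (by fun_prop)
    (by
      intro t ht
      have hpos : 0 < 4 - t ^ 2 := by nlinarith [ht.1, ht.2]
      have h1 : HasDerivAt (fun t : ℝ => 4 - t ^ 2) (-(2 * t)) t := by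
        simpa using (hasDerivAt_pow 2 t).const_sub 4
      have h2 := h1.sqrt hpos.ne'
      have h3 := (hasDerivAt_pow (p + 1) t).mul (h1.mul h2)
      have hs : √(4 - t ^ 2) ≠ 0 := (Real.sqrt_pos.2 hpos).ne'
      have hs2 : √(4 - t ^ 2) * √(4 - t ^ 2) = 4 - t ^ 2 := Real.mul_self_sqrt hpos.le
      have e : (4 - t ^ 2) * (-(2 * t) / (2 * √(4 - t ^ 2))) = -t * √(4 - t ^ 2) := by
        rw [mul_div_assoc', div_eq_iff (by positivity)]
        linear_combination (2 * t) * hs2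
      refine h3.congr_deriv ?_
      rw [e]
      simp only [Pi.mul_apply, Nat.cast_add, Nat.cast_one, Nat.add_sub_cancel]
      ring)
    ((((hint p).const_mul _).sub ((hint (p + 2)).const_mul _)))
  rw [intervalIntegral.integral_sub ((hint p).const_mul _) ((hint (p + 2)).const_mul _),
    intervalIntegral.integral_const_mul, intervalIntegral.integral_const_mul] at key
  norm_num at key
  linarith

/-- The moments of the semicircle distribution. -/
noncomputable def semicircleMoment (p : ℕ) : ℝ :=
  1 / (2 * Real.pi) * ∫ t in (-2 : ℝ)..2, t ^ p * √(4 - t ^ 2)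

theorem semicircleMoment_add_two (p : ℕ) :
    ((p : ℝ) + 4) * semicircleMoment (p + 2) = 4 * ((p : ℝ) + 1) * semicircleMoment p := by
  have := integral_pow_mul_sqrt_add_two p
  simp only [semicircleMoment]
  linear_combination 1 / (2 * Real.pi) * this

theorem semicircleMoment_zero : semicircleMoment 0 = 1 := by
  -- The substitution `t = 2x` reduces the integral to the area of half a unit disc.
  have h := intervalIntegral.mul_integral_comp_mul_left (a := -1) (b := 1)
    (f := fun t : ℝ => √(4 - t ^ 2)) 2
  have h2 : ∀ x : ℝ, √(4 - (2 * x) ^ 2) = 2 * √(1 - x ^ 2) := fun x => by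
    rw [show (4 : ℝ) - (2 * x) ^ 2 = 2 ^ 2 * (1 - x ^ 2) by ring, Real.sqrt_mul (by norm_num),
      Real.sqrt_sq (by norm_num)]
  simp only [h2] at h
  rw [intervalIntegral.integral_const_mul, integral_sqrt_one_sub_sq] at h
  norm_num at h
  simp only [semicircleMoment, pow_zero, one_mul, ← h]
  have := Real.pi_ne_zero
  field_simp

theorem semicircleMoment_one : semicircleMoment 1 = 0 := by
  have h := intervalIntegral.integral_comp_neg (a := -2) (b := 2)
    (f := fun t : ℝ => t ^ 1 * √(4 - t ^ 2))
  simp only [pow_one, even_two, Even.neg_pow, neg_mul, intervalIntegral.integral_neg, neg_neg] at h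
  simp only [semicircleMoment, pow_one]
  rw [show (∫ t in (-2 : ℝ)..2, t * √(4 - t ^ 2)) = 0 by linarith, mul_zero]

/-- The two-step recursion for the moments is the recursion of the Catalan numbers coming from
central binomial coefficients; in odd degree it starts from zero. -/
theorem semicircleMoment_eq (k : ℕ) :
    semicircleMoment (2 * k) = catalan k ∧ semicircleMoment (2 * k + 1) = 0 := by
  induction k with
  | zero => simp [semicircleMoment_zero, semicircleMoment_one]
  | succ k ih =>
    have h1 := semicircleMoment_add_two (2 * k)
    have h2 := semicircleMoment_add_two (2 * k + 1)
    rw [ih.1] at h1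
    rw [ih.2, mul_zero] at h2
    refine ⟨?_, ?_⟩
    · have h3 : ((k : ℝ) + 2) * catalan (k + 1) = 2 * (2 * k + 1) * catalan k := by
        have e1 := succ_mul_catalan_eq_centralBinom (k + 1)
        have e2 := succ_mul_catalan_eq_centralBinom k
        have e3 := Nat.succ_mul_centralBinom_succ k
        rw [← e1, ← e2] at e3
        have e4 : (k + 1) * ((k + 1 + 1) * catalan (k + 1)) =
          (k + 1) * (2 * (2 * k + 1) * catalan k) := by linarith
        have e5 := Nat.eq_of_mul_eq_mul_left (by omega) e4
        have e6 : (((k + 1 + 1) * catalan (k + 1) : ℕ) : ℝ) =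
            ((2 * (2 * k + 1) * catalan k : ℕ) : ℝ) := by
          rw [e5]
        push_cast at e6
        linarith
      push_cast at h1
      have h4 : (2 * (k : ℝ) + 4) * semicircleMoment (2 * (k + 1)) =
          (2 * (k : ℝ) + 4) * catalan (k + 1) := by
        rw [show 2 * (k + 1) = 2 * k + 2 by ring, h1]
        linear_combination -2 * h3
      exact mul_left_cancel₀ (by positivity) h4
    · rcases mul_eq_zero.1 h2 with h | h
      · push_cast at h
        have : (0 : ℝ) < 2 * k + 1 + 4 := by positivity
        linarith
      · exact h

/-- The convolution recursion of the Catalan numbers determines the semicircle moments. -/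
theorem eq_semicircleMoment_of_rec (a : ℕ → ℂ) (h0 : a 0 = 1) (h1 : a 1 = 0)
    (h : ∀ p, a (p + 2) = ∑ i ∈ Finset.range (p + 1), a i * a (p - i)) (p : ℕ) :
    a p = semicircleMoment p := by
  have hb : ∀ k, a (2 * k) = catalan k ∧ a (2 * k + 1) = 0 := by
    intro k
    induction k using Nat.strong_induction_on with
    | _ k ih =>
    rcases k with _ | k
    · simp [h0, h1]
    constructor
    · rw [show 2 * (k + 1) = 2 * k + 2 by ring, h, catalan_succ', Nat.cast_sum]
      rw [← Finset.Nat.sum_antidiagonal_eq_sum_range_succ_mk (fun ij : ℕ × ℕ => a ij.1 * a ij.2)]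
      symm
      -- Doubling embeds the Catalan convolution into the present one; the pairs outside the image
      -- have odd entries and contribute zero by induction.
      refine Finset.sum_of_injOn (fun ij => (2 * ij.1, 2 * ij.2)) ?_ ?_ ?_ ?_
      · rintro ⟨i, j⟩ _ ⟨i', j'⟩ _ h
        simpa using h
      · rintro ⟨i, j⟩ hij
        simp only [Finset.mem_coe, Finset.HasAntidiagonal.mem_antidiagonal] at hij ⊢
        omega
      · rintro ⟨i, j⟩ hij hni
        simp only [Finset.HasAntidiagonal.mem_antidiagonal] at hij
        rcases Nat.even_or_odd' i with ⟨i', rfl | rfl⟩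
        · exact absurd ⟨(i', k - i'), by simp; omega, by ext <;> simp; omega⟩ hni
        · rw [(ih i' (by omega)).2, zero_mul]
      · rintro ⟨i, j⟩ hij
        simp only [Finset.HasAntidiagonal.mem_antidiagonal] at hij
        rw [(ih i (by omega)).1, (ih j (by omega)).1]
        push_cast
        rfl
    · rw [show 2 * (k + 1) + 1 = (2 * k + 1) + 2 by ring, h]
      refine Finset.sum_eq_zero fun i hi => ?_
      have hi' := Finset.mem_range.1 hi
      rcases Nat.even_or_odd' i with ⟨i', rfl | rfl⟩
      · rw [show 2 * k + 1 - 2 * i' = 2 * (k - i') + 1 by omega, (ih (k - i') (by omega)).2, mul_zero]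
      · rw [(ih i' (by omega)).2, zero_mul]
  rcases Nat.even_or_odd' p with ⟨k, rfl | rfl⟩
  · rw [(hb k).1, (semicircleMoment_eq k).1]
    simp
  · rw [(hb k).2, (semicircleMoment_eq k).2]
    simp

end SemicircleMoments

theorem splitSum_replicate {L : Type*} (g : L → ℂ) (F : List L → List L → ℂ) (y : L) (a b : ℕ) :
    splitSum g F (List.replicate a y) (List.replicate b y) =
      ∑ i ∈ Finset.range b, g y * F (List.replicate (a + i) y) (List.replicate (b - 1 - i) y) := by
  induction b generalizing a with
  | zero => rfl
  | succ b ih =>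
    rw [List.replicate_succ, splitSum, ← List.replicate_succ', ih, Finset.sum_range_succ', add_comm]
    congr 1
    refine Finset.sum_congr rfl fun i _ => ?_
    rw [show a + 1 + i = a + (i + 1) by ring, show b - 1 - i = b + 1 - 1 - (i + 1) by omega]

/-- On powers of a single letter of variance one the equations become the Catalan convolution
recursion. -/
theorem NCProbSpace.isSemicircular_of_schwingerDyson (ℬ : NCProbSpace.{u}) {X Y : Type*}
    (ev : X ⊕ Y → ℬ) (c : X → X → ℂ) (hSD : SchwingerDyson c fun w => ℬ.φ (w.map ev).prod)
    (x : X) (hx : c x x = 1) (hsa : IsSelfAdjoint (ev (Sum.inl x))) :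
    ℬ.IsSemicircular (ev (Sum.inl x)) := by
  refine ⟨hsa, fun p => ?_⟩
  have hrec : ∀ p, ℬ.φ (ev (Sum.inl x) ^ (p + 1)) = ∑ i ∈ Finset.range p,
      ℬ.φ (ev (Sum.inl x) ^ i) * ℬ.φ (ev (Sum.inl x) ^ (p - 1 - i)) := by
    intro p
    have := hSD [] x (List.replicate p (Sum.inl x))
    rw [show ([] : List (X ⊕ Y)) = List.replicate 0 (Sum.inl x) from rfl, splitSum_replicate] at this
    simpa [covExt, hx, pow_succ'] using this
  refine eq_semicircleMoment_of_rec (fun p => ℬ.φ (ev (Sum.inl x) ^ p)) ?_ ?_ ?_ p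
  · simp [ℬ.map_one]
  · simpa using hrec 0
  · intro p
    rw [hrec (p + 1)]
    rfl

/-! ### Solving the Schwinger–Dyson equations by recursion -/

section Recursion

variable {X Y : Type*} (c : X → X → ℂ) (f : List Y → ℂ)

/-- The functional on words determined by the Schwinger–Dyson equations, with a bound `k` on the
length of the word; `u` is the initial segment of deterministic letters already read. -/
noncomputable def sdAux : ℕ → List Y → List (X ⊕ Y) → ℂ
  | _, u, [] => f u
  -- Junk value: never reached when the bound is at least the length of the word. The bound is
  -- needed because `U` and `V` arise inside `splitSum` and are not structural subterms.
  | 0, _, _ :: _ => 0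
  | k + 1, u, Sum.inr y :: W => sdAux k (u ++ [y]) W
  | k + 1, u, Sum.inl x :: W =>
    splitSum (covExt c x) (fun U V => sdAux k [] U * sdAux k u V) [] W

theorem sdAux_eq (k k' : ℕ) (u : List Y) (W : List (X ⊕ Y)) (hk : W.length ≤ k)
    (hk' : W.length ≤ k') : sdAux c f k u W = sdAux c f k' u W := by
  induction k generalizing k' u W with
  | zero =>
    obtain rfl : W = [] := by simpa using hk
    simp [sdAux]
  | succ k ih =>
    rcases W with _ | ⟨x | y, W⟩
    · simp [sdAux]
    · obtain ⟨k', rfl⟩ : ∃ j, k' = j + 1 := ⟨k' - 1, by simp at hk'; omega⟩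
      simp only [sdAux]
      refine splitSum_congr _ _ _ _ _ fun U y V hW _ => ?_
      subst hW
      simp only [List.length_cons, List.length_append] at hk hk'
      rw [ih k' [] ([] ++ U) (by simp; omega) (by simp; omega), ih k' u V (by omega) (by omega)]
    · obtain ⟨k', rfl⟩ : ∃ j, k' = j + 1 := ⟨k' - 1, by simp at hk'; omega⟩
      simp only [sdAux]
      simp only [List.length_cons] at hk hk'
      exact ih k' _ W (by omega) (by omega)

/-- The functional on words determined by the Schwinger–Dyson equations and its values on words in
deterministic letters. -/
noncomputable def sdFunctional (W : List (X ⊕ Y)) : ℂ := sdAux c f W.length [] W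

theorem sdFunctional_map_inr_append (u : List Y) (W : List (X ⊕ Y)) :
    sdFunctional c f (u.map Sum.inr ++ W) = sdAux c f W.length u W := by
  have : ∀ (v u : List Y), sdAux c f (u.map Sum.inr ++ W).length v (u.map Sum.inr ++ W) =
      sdAux c f W.length (v ++ u) W := by
    intro v u
    induction u generalizing v with
    | nil => simp
    | cons y u ih =>
      rw [List.map_cons, List.cons_append, List.length_cons, sdAux, ih]
      simp
  simpa [sdFunctional] using this [] u

theorem sdFunctional_map_inr (u : List Y) :
    sdFunctional c f (u.map Sum.inr) = f u := by
  simpa [sdAux] using sdFunctional_map_inr_append c f u []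

theorem schwingerDyson_sdFunctional : SchwingerDyson c (sdFunctional c f) := by
  intro u x W
  rw [sdFunctional_map_inr_append, List.length_cons, sdAux]
  refine splitSum_congr _ _ _ _ _ fun U y V hW _ => ?_
  subst hW
  rw [sdFunctional_map_inr_append, sdFunctional]
  simp only [List.length_append, List.length_cons, List.nil_append]
  rw [sdAux_eq c f (U.length + (V.length + 1)) U.length [] U (by omega) le_rfl,
    sdAux_eq c f (U.length + (V.length + 1)) V.length u V (by omega) le_rfl]

end Recursion

/-! ### A noncommutative probability space of random matrix sequences -/

section LimitSpace

variable {Ω : ℕ → Type u} [∀ n, MeasurableSpace (Ω n)] (μ : ∀ n, Measure (Ω n))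

/-- Sequences of random matrices. -/
abbrev MatrixSeq (Ω : ℕ → Type u) : Type u := ∀ n, Ω n → Matrix (Fin n) (Fin n) ℂ

/-- The sequences of random matrices whose mean normalised trace converges. -/
def convergentSeq : Submodule ℂ (MatrixSeq Ω) where
  carrier := {X | (∀ n, Integrable (fun ω => (X n ω).trace) (μ n)) ∧
    ∃ L, Tendsto (fun n => meanTrace (μ n) (X n)) atTop (𝓝 L)}
  zero_mem' := ⟨fun n => by simp, 0, by simp [meanTrace]⟩
  add_mem' := by
    rintro X Y ⟨hX, L, hL⟩ ⟨hY, L', hL'⟩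
    refine ⟨fun n => by
      simp only [Pi.add_apply, Matrix.trace_add]
      exact (hX n).add (hY n), L + L', ?_⟩
    refine (hL.add hL').congr fun n => ?_
    simp only [meanTrace, Pi.add_apply, Matrix.trace_add]
    rw [integral_add (hX n) (hY n), mul_add]
  smul_mem' := by
    rintro t X ⟨hX, L, hL⟩
    refine ⟨fun n => by simpa [Matrix.trace_smul] using (hX n).const_mul t, t * L, ?_⟩
    refine (hL.const_mul t).congr fun n => ?_
    simp only [meanTrace, Pi.smul_apply, Matrix.trace_smul, smul_eq_mul]
    rw [integral_const_mul]
    ring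

/-- The limit of the mean normalised trace, as a linear functional. -/
noncomputable def limitFunctional : convergentSeq μ →ₗ[ℂ] ℂ where
  toFun X := X.2.2.choose
  map_add' X Y := by
    refine tendsto_nhds_unique (X + Y).2.2.choose_spec ?_
    refine (X.2.2.choose_spec.add Y.2.2.choose_spec).congr fun n => ?_
    simp only [meanTrace, Submodule.coe_add, Pi.add_apply, Matrix.trace_add]
    rw [integral_add (X.2.1 n) (Y.2.1 n), mul_add]
  map_smul' t X := by
    refine tendsto_nhds_unique (t • X).2.2.choose_spec ?_
    refine (X.2.2.choose_spec.const_mul t).congr fun n => ?_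
    simp only [meanTrace, Submodule.coe_smul, Pi.smul_apply, Matrix.trace_smul, smul_eq_mul]
    rw [integral_const_mul]
    ring

theorem tendsto_limitFunctional (X : convergentSeq μ) :
    Tendsto (fun n => meanTrace (μ n) (X.1 n)) atTop (𝓝 (limitFunctional μ X)) :=
  X.2.2.choose_spec

open scoped ComplexOrder in
theorem meanTrace_star_mul_self_nonneg {Ω : Type*} [MeasurableSpace Ω] (μ : Measure Ω) {n : ℕ}
    (X : Ω → Matrix (Fin n) (Fin n) ℂ) : 0 ≤ meanTrace μ (star X * X) := by
  have h : ∀ ω, ((star X * X) ω).trace = ((∑ i, ∑ j, ‖X ω j i‖ ^ 2 : ℝ) : ℂ) := by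
    intro ω
    simp only [Pi.mul_apply, Pi.star_apply, Matrix.trace, Matrix.diag, Matrix.mul_apply,
      Matrix.star_apply]
    push_cast
    refine Finset.sum_congr rfl fun i _ => Finset.sum_congr rfl fun j _ => ?_
    rw [← Complex.conj_mul']
    rfl
  have h' : ∫ ω, ((star X * X) ω).trace ∂μ = ((∫ ω, ∑ i, ∑ j, ‖X ω j i‖ ^ 2 ∂μ : ℝ) : ℂ) := by
    rw [← integral_complex_ofReal]
    exact integral_congr_ae (Eventually.of_forall h)
  rw [meanTrace, h', ← Complex.ofReal_natCast, ← Complex.ofReal_inv, ← Complex.ofReal_mul]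
  refine Complex.zero_le_real.2 (mul_nonneg (by positivity) (integral_nonneg fun ω => ?_))
  positivity

open scoped ComplexOrder in
/-- The limit of a jointly convergent family of random matrices, closed under adjoints, lives in a
noncommutative probability space of sequences of random matrices. -/
theorem exists_limitSpace [∀ n, IsProbabilityMeasure (μ n)] {Λ : Type*} (g : Λ → MatrixSeq Ω)
    (hstar : ∀ x, ∃ y, g y = star (g x))
    (hconv : ∀ W : List Λ, (W.map g).prod ∈ convergentSeq μ) :
    ∃ (ℬ : NCProbSpace.{u}) (ev : Λ → ℬ) (val : ℬ →⋆ₐ[ℂ] MatrixSeq Ω),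
      Function.Injective val ∧ (∀ x, val (ev x) = g x) ∧
      ∀ W : List Λ, Tendsto (fun n => meanTrace (μ n) ((W.map g).prod n)) atTop
        (𝓝 (ℬ.φ (W.map ev).prod)) := by
  -- The generators are closed under adjoints, so this algebra is spanned by words in them and
  -- consists of sequences whose mean trace converges.
  let B := StarAlgebra.adjoin ℂ (Set.range g)
  have hB : ∀ X : B, (X : MatrixSeq Ω) ∈ convergentSeq μ := by
    intro X
    have h := mem_span_words_of_mem_adjoin g (Set.range g) (fun _ => True) (by
      rintro _ ⟨x, rfl⟩
      obtain ⟨y, hy⟩ := hstar x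
      exact ⟨⟨x, trivial, rfl⟩, y, trivial, hy⟩) X.2
    refine Submodule.span_le.2 ?_ h
    rintro _ ⟨W, -, rfl⟩
    exact hconv W
  let φ : B →ₗ[ℂ] ℂ := limitFunctional μ ∘ₗ
    LinearMap.codRestrict (convergentSeq μ) B.subtype.toLinearMap hB
  have hφ : ∀ X : B, Tendsto (fun n => meanTrace (μ n) ((X : MatrixSeq Ω) n)) atTop (𝓝 (φ X)) :=
    fun X => tendsto_limitFunctional μ ⟨X, hB X⟩
  refine ⟨⟨B, φ, ?_, ?_⟩, fun x => ⟨g x, StarAlgebra.subset_adjoin ℂ _ ⟨x, rfl⟩⟩, B.subtype,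
    Subtype.val_injective, fun x => rfl, ?_⟩
  -- The normalised trace of the identity is `0` at `n = 0`, so it equals `1` only eventually.
  · refine tendsto_nhds_unique (hφ 1) (tendsto_const_nhds.congr' ?_)
    filter_upwards [eventually_ne_atTop 0] with n hn
    simp [meanTrace, hn]
  · intro X
    refine ge_of_tendsto' (hφ (star X * X)) fun n => ?_
    exact meanTrace_star_mul_self_nonneg (μ n) ((X : MatrixSeq Ω) n)
  · intro W
    have := hφ (W.map fun x => (⟨g x, StarAlgebra.subset_adjoin ℂ _ ⟨x, rfl⟩⟩ : B)).prod
    have e : (((W.map fun x => (⟨g x, StarAlgebra.subset_adjoin ℂ _ ⟨x, rfl⟩⟩ : B)).prod : B) :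
        MatrixSeq Ω) = (W.map g).prod := by
      rw [← StarSubalgebra.coe_subtype, map_list_prod, List.map_map]
      rfl
    rwa [e] at this

end LimitSpace

/-! ### Random variables with all moments -/

section Moments

variable {Ω : Type*} [MeasurableSpace Ω] {μ : Measure Ω}

/-- A random variable with finite moments of all orders. -/
def HasAllMoments {𝕜 : Type*} [NormedAddCommGroup 𝕜] (f : Ω → 𝕜) (μ : Measure Ω) : Prop :=
  ∀ k : ℕ, MemLp f k μ

namespace HasAllMoments

variable {𝕜 : Type*} [NormedField 𝕜] {f g : Ω → 𝕜}

theorem mul (hf : HasAllMoments f μ) (hg : HasAllMoments g μ) :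
    HasAllMoments (fun ω => f ω * g ω) μ := by
  intro k
  -- Hölder with exponents `2k, 2k, k`: products stay in the class at the cost of doubling the
  -- exponent.
  have : ENNReal.HolderTriple ((2 * k : ℕ) : ENNReal) ((2 * k : ℕ) : ENNReal) k := ⟨by
    rw [Nat.cast_mul, ENNReal.mul_inv (by simp) (by simp), ← add_mul]
    simp [ENNReal.inv_two_add_inv_two]⟩
  exact (hg (2 * k)).mul' (hf (2 * k))

theorem add {E : Type*} [NormedAddCommGroup E] {f g : Ω → E} (hf : HasAllMoments f μ)
    (hg : HasAllMoments g μ) : HasAllMoments (fun ω => f ω + g ω) μ := fun k => (hf k).add (hg k)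

theorem const {E : Type*} [NormedAddCommGroup E] [IsFiniteMeasure μ] (a : E) :
    HasAllMoments (fun _ : Ω => a) μ := fun _ => memLp_const a

theorem sum {E ι : Type*} [NormedAddCommGroup E] {f : ι → Ω → E} (s : Finset ι)
    (h : ∀ i ∈ s, HasAllMoments (f i) μ) : HasAllMoments (fun ω => ∑ i ∈ s, f i ω) μ :=
  fun k => memLp_finsetSum s fun i hi => h i hi k

theorem pow [IsFiniteMeasure μ] (hf : HasAllMoments f μ) (m : ℕ) :
    HasAllMoments (fun ω => f ω ^ m) μ := by
  induction m with
  | zero => simpa using const (1 : 𝕜)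
  | succ m ih => simpa only [pow_succ] using ih.mul hf

theorem integrable {E : Type*} [NormedAddCommGroup E] {f : Ω → E} (hf : HasAllMoments f μ) :
    Integrable f μ := memLp_one_iff_integrable.1 (by simpa using hf 1)

theorem ofReal {f : Ω → ℝ} (hf : HasAllMoments f μ) : HasAllMoments (fun ω => (f ω : ℂ)) μ :=
  fun k => (hf k).ofReal

theorem mvPolynomial_eval [IsFiniteMeasure μ] {E : Type*} {x : E → Ω → 𝕜}
    (hx : ∀ e, HasAllMoments (x e) μ) (p : MvPolynomial E 𝕜) :
    HasAllMoments (fun ω => MvPolynomial.eval (fun e => x e ω) p) μ := by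
  induction p using MvPolynomial.induction_on with
  | C a => simpa using const a
  | add p q hp hq => simpa using hp.add hq
  | mul_X p e hp => simpa using hp.mul (hx e)

theorem of_integrable_abs_pow {f : Ω → ℝ} (hm : AEStronglyMeasurable f μ)
    (h : ∀ k : ℕ, Integrable (fun ω => |f ω| ^ k) μ) : HasAllMoments f μ := by
  intro k
  rcases Nat.eq_zero_or_pos k with rfl | hk
  · simpa using hm
  · rw [← memLp_norm_iff hm] 
    refine (integrable_norm_rpow_iff hm.norm (by simpa using hk.ne') (by simp)).1 ?_
    simpa using h k

end HasAllMoments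

end Moments

/-! ### Gaussian integration by parts for polynomials -/

section Stein

open Polynomial

theorem hasAllMoments_id_gaussianReal : HasAllMoments (fun t : ℝ => t) (gaussianReal 0 1) :=
  fun k => memLp_id_gaussianReal' k (by simp)

theorem hasAllMoments_eval_gaussianReal (q : ℂ[X]) :
    HasAllMoments (fun t : ℝ => q.eval (t : ℂ)) (gaussianReal 0 1) := by
  induction q using Polynomial.induction_on' with
  | add p q hp hq => simpa using hp.add hq
  | monomial k a =>
    simpa using (HasAllMoments.const a).mul (hasAllMoments_id_gaussianReal.ofReal.pow k)

theorem hasDerivAt_gaussianPDFReal (t : ℝ) :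
    HasDerivAt (gaussianPDFReal 0 1) (-t * gaussianPDFReal 0 1 t) t := by
  have h1 : HasDerivAt (fun x : ℝ => -x ^ 2 / 2) (-t) t := by
    have := ((hasDerivAt_pow 2 t).neg).div_const 2
    refine this.congr_deriv ?_
    norm_num
    ring
  have h2 := (h1.exp).const_mul (√(2 * Real.pi))⁻¹
  have h3 : (fun x : ℝ => (√(2 * Real.pi))⁻¹ * Real.exp (-x ^ 2 / 2)) = gaussianPDFReal 0 1 := by
    funext x
    simp [gaussianPDFReal]
  rw [h3] at h2
  refine h2.congr_deriv ?_
  simp only [gaussianPDFReal, NNReal.coe_one, mul_one, sub_zero]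
  ring

/-- Gaussian integration by parts for polynomials in one variable. -/
theorem integral_id_mul_eval_gaussianReal (q : ℂ[X]) :
    ∫ t, (t : ℂ) * q.eval (t : ℂ) ∂gaussianReal 0 1 =
      ∫ t, q.derivative.eval (t : ℂ) ∂gaussianReal 0 1 := by
  have hint : ∀ r : ℂ[X], Integrable (fun t : ℝ => r.eval (t : ℂ) * (gaussianPDFReal 0 1 t : ℂ)) := by
    intro r
    have h := (hasAllMoments_eval_gaussianReal r).integrable
    rw [gaussianReal_of_var_ne_zero 0 one_ne_zero,
      integrable_withDensity_iff_integrable_smul₀' (measurable_gaussianPDF 0 1).aemeasurable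
        (ae_of_all _ fun _ => gaussianPDF_lt_top)] at h
    refine h.congr (ae_of_all _ fun t => ?_)
    simp [toReal_gaussianPDF, mul_comm]
  have key := integral_mul_deriv_eq_deriv_mul_of_integrable
    (u := fun t : ℝ => q.eval (t : ℂ)) (v := fun t : ℝ => (gaussianPDFReal 0 1 t : ℂ))
    (u' := fun t : ℝ => q.derivative.eval (t : ℂ))
    (v' := fun t : ℝ => ((-t * gaussianPDFReal 0 1 t : ℝ) : ℂ))
    (fun t _ => (q.hasDerivAt (t : ℂ)).comp_ofReal)
    (fun t _ => (hasDerivAt_gaussianPDFReal t).ofReal_comp)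
    (by
      refine ((hint (X * q)).neg).congr (ae_of_all _ fun t => ?_)
      simp
      ring)
    (hint _) (hint _)
  rw [integral_gaussianReal_eq_integral_smul one_ne_zero,
    integral_gaussianReal_eq_integral_smul one_ne_zero, ← neg_inj]
  calc _ = ∫ t : ℝ, q.eval (t : ℂ) * ((-t * gaussianPDFReal 0 1 t : ℝ) : ℂ) := by
        rw [← integral_neg]
        refine integral_congr_ae (ae_of_all _ fun t => ?_)
        simp
        ring
    _ = _ := by
        rw [key]
        congr 1
        refine integral_congr_ae (ae_of_all _ fun t => ?_)
        simp [mul_comm]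

/-- The chain rule along a line `t ↦ c t + y`, in algebraic form. -/
theorem derivative_aeval_affine {E : Type*} [Fintype E] (c y : E → ℂ) (p : MvPolynomial E ℂ) :
    derivative (MvPolynomial.aeval (fun f => C (c f) * X + C (y f)) p) =
      ∑ f, C (c f) * MvPolynomial.aeval (fun f => C (c f) * X + C (y f))
        (MvPolynomial.pderiv f p) := by
  classical
  induction p using MvPolynomial.induction_on with
  | C a => simp
  | add p q hp hq => simp [hp, hq, mul_add, Finset.sum_add_distrib]
  | mul_X p e hp =>
    have h1 : ∀ f, MvPolynomial.aeval (fun f => C (c f) * X + C (y f))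
        (MvPolynomial.pderiv f (p * MvPolynomial.X e)) =
        (if f = e then MvPolynomial.aeval (fun f => C (c f) * X + C (y f)) p else 0) +
        (C (c e) * X + C (y e)) * MvPolynomial.aeval (fun f => C (c f) * X + C (y f))
          (MvPolynomial.pderiv f p) := by
      intro f
      rw [Derivation.leibniz, MvPolynomial.pderiv_X]
      by_cases hf : f = e
      · subst hf
        simp
      · simp [hf]
    simp only [h1, mul_add, Finset.sum_add_distrib, mul_ite, mul_zero, Finset.sum_ite_eq',
      Finset.mem_univ, if_true]
    rw [map_mul, MvPolynomial.aeval_X, derivative_mul, hp, Finset.sum_mul, add_comm]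
    congr 1
    · simp only [derivative_add, derivative_mul, derivative_C, derivative_X]
      ring
    · refine Finset.sum_congr rfl fun f _ => ?_
      ring

/-- Gaussian integration by parts for polynomials in a centred Gaussian vector. -/
theorem HasGaussianLaw.integral_mul_eval {Ω E : Type*} [MeasurableSpace Ω] [Fintype E]
    {μ : Measure Ω} [IsProbabilityMeasure μ] (x : E → Ω → ℝ)
    (hG : HasGaussianLaw (fun ω e => x e ω) μ) (hmean : ∀ e, ∫ ω, x e ω ∂μ = 0)
    (e : E) (hvar : ∫ ω, x e ω ^ 2 ∂μ = 1) (p : MvPolynomial E ℂ) :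
    ∫ ω, (x e ω : ℂ) * MvPolynomial.eval (fun f => (x f ω : ℂ)) p ∂μ =
      ∑ f, ((∫ ω, x e ω * x f ω ∂μ : ℝ) : ℂ) *
        ∫ ω, MvPolynomial.eval (fun f => (x f ω : ℂ)) (MvPolynomial.pderiv f p) ∂μ := by
  set c : E → ℝ := fun f => ∫ ω, x e ω * x f ω ∂μ with hc
  have hmom : ∀ f, HasAllMoments (x f) μ := fun f k => (hG.eval f).memLp (by simp)
  have hmeas : ∀ f, AEMeasurable (x f) μ := fun f => (hG.eval f).aemeasurable
  -- Regress the vector on the coordinate `x e`. As `x e` has variance one, the residuals `x f - c f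
  -- * x e` are uncorrelated with it, hence independent of it by joint Gaussianity. The `Unit` index
  -- presents `x e` as a vector.
  have hindep : IndepFun (fun ω (_ : Unit) => x e ω) (fun ω f => x f ω - c f * x e ω) μ := by
    refine HasGaussianLaw.indepFun_of_covariance_eval (X := fun _ => x e)
      (Y := fun f ω => x f ω - c f * x e ω) ?_ ?_
    · let L : (E → ℝ) →L[ℝ] ((Unit → ℝ) × (E → ℝ)) :=
        (ContinuousLinearMap.pi fun _ => ContinuousLinearMap.proj e).prod
          (ContinuousLinearMap.pi fun f => ContinuousLinearMap.proj f - c f • ContinuousLinearMap.proj e)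
      exact hG.map_fun L
    · intro _ f
      have h2 : Integrable (fun ω => x e ω * x f ω) μ := ((hmom e).mul (hmom f)).integrable
      have h3 : Integrable (fun ω => x e ω * (c f * x e ω)) μ :=
        ((hmom e).mul ((HasAllMoments.const (c f)).mul (hmom e))).integrable
      rw [covariance, hmean]
      have h4 : ∫ ω, (x f ω - c f * x e ω) ∂μ = 0 := by
        rw [integral_sub (hmom f).integrable ((hmom e).integrable.const_mul _), integral_const_mul,
          hmean, hmean]
        simp
      rw [h4]
      simp only [sub_zero]
      simp only [mul_sub]
      rw [integral_sub h2 h3]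
      have : ∀ ω, x e ω * (c f * x e ω) = c f * x e ω ^ 2 := fun ω => by ring
      simp only [this]
      rw [integral_const_mul, hvar, hc]
      simp
  have hindep' : IndepFun (x e) (fun ω f => x f ω - c f * x e ω) μ :=
    hindep.comp (measurable_pi_apply ()) measurable_id
  have hlaw : μ.map (x e) = gaussianReal 0 1 := by
    rw [(hG.eval e).map_eq_gaussianReal, hmean, variance_eq_integral (hmeas e), hmean]
    simp [hvar]
  have hmeasY : AEMeasurable (fun ω f => x f ω - c f * x e ω) μ :=
    aemeasurable_pi_lambda _ fun f => (hmeas f).sub ((hmeas e).const_mul _)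
  set ν := μ.map (fun ω f => x f ω - c f * x e ω) with hν
  have : IsProbabilityMeasure ν := Measure.isProbabilityMeasure_map hmeasY
  have hjoint : μ.map (fun ω => (x e ω, fun f => x f ω - c f * x e ω)) =
      (gaussianReal 0 1).prod ν := by
    rw [(indepFun_iff_map_prod_eq_prod_map_map (hmeas e) hmeasY).1 hindep', hlaw]
  have hcontE : ∀ q : MvPolynomial E ℂ, Continuous fun z : ℝ × (E → ℝ) =>
      MvPolynomial.eval (fun f => ((c f * z.1 + z.2 f : ℝ) : ℂ)) q := by
    intro q
    refine (MvPolynomial.continuous_eval q).comp ?_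
    fun_prop
  have hrec : ∀ ω f, c f * x e ω + (x f ω - c f * x e ω) = x f ω := fun ω f => by ring
  have hpair : AEMeasurable (fun ω => (x e ω, fun f => x f ω - c f * x e ω)) μ :=
    (hmeas e).prodMk hmeasY
  have transfer : ∀ F : ℝ × (E → ℝ) → ℂ, Continuous F →
      Integrable (fun ω => F (x e ω, fun f => x f ω - c f * x e ω)) μ →
      Integrable F ((gaussianReal 0 1).prod ν) ∧
      ∫ ω, F (x e ω, fun f => x f ω - c f * x e ω) ∂μ =
        ∫ y, ∫ t, F (t, y) ∂gaussianReal 0 1 ∂ν := by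
    intro F hF hFi
    have h1 : Integrable F ((gaussianReal 0 1).prod ν) := by
      rw [← hjoint, integrable_map_measure hF.aestronglyMeasurable hpair]
      exact hFi
    refine ⟨h1, ?_⟩
    rw [← integral_prod_symm F h1, ← hjoint, integral_map hpair hF.aestronglyMeasurable]
  have hpoly : ∀ (q : MvPolynomial E ℂ) (t : ℝ) (y : E → ℝ),
      MvPolynomial.eval (fun f => ((c f * t + y f : ℝ) : ℂ)) q =
      Polynomial.eval (t : ℂ)
        (MvPolynomial.aeval (fun f => C ((c f : ℂ)) * X + C ((y f : ℂ))) q) := by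
    intro q t y
    induction q using MvPolynomial.induction_on with
    | C a => simp
    | add p q hp hq => simp only [map_add, hp, hq, Polynomial.eval_add]
    | mul_X p e hp => 
      rw [map_mul, map_mul, hp, Polynomial.eval_mul]
      simp
  have hmomC := fun q => HasAllMoments.mvPolynomial_eval (fun f => (hmom f).ofReal) q
  obtain ⟨-, h1⟩ := transfer (fun z => (z.1 : ℂ) *
      MvPolynomial.eval (fun f => ((c f * z.1 + z.2 f : ℝ) : ℂ)) p)
    ((by fun_prop : Continuous fun z : ℝ × (E → ℝ) => (z.1 : ℂ)).mul (hcontE p))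
    (by
      simp only [hrec]
      exact ((hmom e).ofReal.mul (hmomC p)).integrable)
  simp only [hrec] at h1
  rw [h1]
  have h2 : ∀ f, Integrable (fun z : ℝ × (E → ℝ) =>
      MvPolynomial.eval (fun f => ((c f * z.1 + z.2 f : ℝ) : ℂ)) (MvPolynomial.pderiv f p))
      ((gaussianReal 0 1).prod ν) ∧
      ∫ ω, MvPolynomial.eval (fun f => (x f ω : ℂ)) (MvPolynomial.pderiv f p) ∂μ =
      ∫ y, ∫ t, MvPolynomial.eval (fun f => ((c f * t + y f : ℝ) : ℂ)) (MvPolynomial.pderiv f p)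
        ∂gaussianReal 0 1 ∂ν := by
    intro f
    have := transfer (fun z => MvPolynomial.eval (fun f => ((c f * z.1 + z.2 f : ℝ) : ℂ))
      (MvPolynomial.pderiv f p)) (hcontE _) (by
        simp only [hrec]
        exact (hmomC _).integrable)
    simpa only [hrec] using this
  have hcf : ∀ f, ∫ ω, x e ω * x f ω ∂μ = c f := fun f => rfl
  simp only [(h2 _).2, hcf]
  have h3 : ∑ f, (c f : ℂ) * ∫ y, ∫ t, MvPolynomial.eval (fun f => ((c f * t + y f : ℝ) : ℂ))
      (MvPolynomial.pderiv f p) ∂gaussianReal 0 1 ∂ν =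
      ∫ y, ∑ f, (c f : ℂ) * ∫ t, MvPolynomial.eval (fun f => ((c f * t + y f : ℝ) : ℂ))
      (MvPolynomial.pderiv f p) ∂gaussianReal 0 1 ∂ν := by
    rw [integral_finsetSum _ fun f _ => ((h2 f).1.integral_prod_right).const_mul _]
    simp only [integral_const_mul]
  rw [h3]
  refine integral_congr_ae (ae_of_all _ fun y => ?_)
  simp only [hpoly]
  -- With the residual `y` frozen, the claim is one-dimensional integration by parts along the line
  -- `t ↦ c t + y`.
  rw [integral_id_mul_eval_gaussianReal, derivative_aeval_affine]
  simp only [Polynomial.eval_finsetSum, Polynomial.eval_mul, Polynomial.eval_C]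
  rw [integral_finsetSum _ fun f _ => (hasAllMoments_eval_gaussianReal _).integrable.const_mul _]
  simp only [integral_const_mul]

end Stein

/-! ### Operator norm, Hilbert–Schmidt norm and trace -/

section MatrixNorm

open scoped Matrix.Norms.L2Operator

variable {n : ℕ}

theorem Matrix.sum_norm_sq_le_opNorm (M : Matrix (Fin n) (Fin n) ℂ) :
    ∑ i, ∑ j, ‖M i j‖ ^ 2 ≤ n * ‖M‖ ^ 2 := by
  rw [Finset.sum_comm]
  have h : ∀ j, ∑ i, ‖M i j‖ ^ 2 ≤ ‖M‖ ^ 2 := by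
    intro j
    -- Each column is the image of a unit vector, so its length is at most the operator norm.
    have h1 := Matrix.l2_opNorm_mulVec M (EuclideanSpace.single j (1 : ℂ))
    have h2 := pow_le_pow_left₀ (norm_nonneg _) h1 2
    rw [EuclideanSpace.norm_sq_eq] at h2
    simpa using h2
  calc _ ≤ ∑ _j : Fin n, ‖M‖ ^ 2 := Finset.sum_le_sum fun j _ => h j
    _ = _ := by simp

theorem Matrix.opNorm_sq_le_sum (M : Matrix (Fin n) (Fin n) ℂ) :
    ‖M‖ ^ 2 ≤ ∑ i, ∑ j, ‖M i j‖ ^ 2 := by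
  have h0 : 0 ≤ ∑ i, ∑ j, ‖M i j‖ ^ 2 := by positivity
  have h : ‖M‖ ≤ √(∑ i, ∑ j, ‖M i j‖ ^ 2) := by
    rw [Matrix.cstar_norm_def]
    refine ContinuousLinearMap.opNorm_le_bound _ (Real.sqrt_nonneg _) fun v => ?_
    rw [EuclideanSpace.norm_eq, EuclideanSpace.norm_eq v, ← Real.sqrt_mul h0]
    refine Real.sqrt_le_sqrt ?_
    rw [Finset.sum_mul]
    refine Finset.sum_le_sum fun i _ => ?_
    have h1 : ‖(Matrix.toEuclideanCLM (n := Fin n) (𝕜 := ℂ) M v) i‖ ≤ ∑ j, ‖M i j‖ * ‖v j‖ := by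
      rw [Matrix.ofLp_toEuclideanCLM, Matrix.mulVec, dotProduct]
      refine (norm_sum_le _ _).trans (le_of_eq ?_)
      simp
    calc _ ≤ (∑ j, ‖M i j‖ * ‖v j‖) ^ 2 := pow_le_pow_left₀ (norm_nonneg _) h1 2
      _ ≤ _ := Finset.sum_mul_sq_le_sq_mul_sq _ _ _
  calc ‖M‖ ^ 2 ≤ √(∑ i, ∑ j, ‖M i j‖ ^ 2) ^ 2 := pow_le_pow_left₀ (norm_nonneg _) h 2
    _ = _ := Real.sq_sqrt h0

/-- Cauchy–Schwarz for the Hilbert–Schmidt inner product: the bound is `n`, whereas a product of two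
traces may be as large as `n²`. This is the gain in the transposed covariance part. -/
theorem Matrix.sum_norm_mul_norm_le (P Q : Matrix (Fin n) (Fin n) ℂ) :
    ∑ i, ∑ j, ‖P i j‖ * ‖Q i j‖ ≤ n * (‖P‖ * ‖Q‖) := by
  have h := Finset.sum_mul_sq_le_sq_mul_sq (Finset.univ : Finset (Fin n × Fin n))
    (fun q => ‖P q.1 q.2‖) (fun q => ‖Q q.1 q.2‖)
  simp only [Fintype.sum_prod_type] at h
  refine abs_le_of_sq_le_sq' ?_ (by positivity) |>.2
  refine h.trans ((mul_le_mul (sum_norm_sq_le_opNorm P) (sum_norm_sq_le_opNorm Q) (by positivity)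
    (by positivity)).trans (le_of_eq (by ring)))

theorem Matrix.norm_sum_mul_le (P Q : Matrix (Fin n) (Fin n) ℂ) :
    ‖∑ i, ∑ j, P j i * Q j i‖ ≤ n * (‖P‖ * ‖Q‖) := by
  rw [Finset.sum_comm]
  refine le_trans ?_ (Matrix.sum_norm_mul_norm_le P Q)
  refine (norm_sum_le _ _).trans (Finset.sum_le_sum fun i _ => (norm_sum_le _ _).trans (le_of_eq ?_))
  simp

theorem Matrix.norm_entry_le_opNorm (M : Matrix (Fin n) (Fin n) ℂ) (i j : Fin n) :
    ‖M i j‖ ≤ ‖M‖ := by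
  have h1 := Matrix.l2_opNorm_mulVec M (EuclideanSpace.single j (1 : ℂ))
  have h2 := PiLp.norm_apply_le (WithLp.toLp 2 (M.mulVec (EuclideanSpace.single j (1 : ℂ)))) i
  simpa using h2.trans h1

theorem Matrix.norm_trace_le_opNorm (M : Matrix (Fin n) (Fin n) ℂ) : ‖M.trace‖ ≤ n * ‖M‖ := by
  calc _ ≤ ∑ _i : Fin n, ‖M‖ :=
        (norm_sum_le _ _).trans (Finset.sum_le_sum fun i _ => norm_entry_le_opNorm M i i)
    _ = _ := by simp

theorem Matrix.norm_sum_diag_mul_le (P Q : Matrix (Fin n) (Fin n) ℂ) :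
    ‖∑ i, P i i * Q i i‖ ≤ n * (‖P‖ * ‖Q‖) := by
  calc _ ≤ ∑ _i : Fin n, ‖P‖ * ‖Q‖ := by
        refine (norm_sum_le _ _).trans (Finset.sum_le_sum fun i _ => ?_)
        rw [norm_mul]
        exact mul_le_mul (norm_entry_le_opNorm P i i) (norm_entry_le_opNorm Q i i)
          (norm_nonneg _) (norm_nonneg _)
    _ = _ := by simp

/-- For `H = M* M` the C*-identity gives `‖H^(2^q)‖ = ‖M‖^(2·2^q)`, and the squared operator norm of
`H^(2^q)` is at most its squared Hilbert–Schmidt norm, a trace. Powers of two allow the C*-identity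
to be iterated. -/
theorem Matrix.opNorm_pow_le_trace (M : Matrix (Fin n) (Fin n) ℂ) (q : ℕ) :
    ‖M‖ ^ (4 * 2 ^ q) ≤ (((star M * M) ^ (2 * 2 ^ q)).trace).re := by
  set H := star M * M with hH
  have hsa : IsSelfAdjoint H := IsSelfAdjoint.star_mul_self M
  have h1 : ‖H ^ 2 ^ q‖ = ‖H‖ ^ 2 ^ q := by
    have := hsa.nnnorm_pow_two_pow q
    exact congrArg NNReal.toReal this
  have h2 : ‖H‖ = ‖M‖ ^ 2 := by rw [hH, CStarRing.norm_star_mul_self, sq]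
  have h3 : ‖M‖ ^ (4 * 2 ^ q) = ‖H ^ 2 ^ q‖ ^ 2 := by
    rw [h1, h2, ← pow_mul, ← pow_mul]
    congr 1
    ring
  rw [h3]
  refine (Matrix.opNorm_sq_le_sum _).trans (le_of_eq ?_)
  have h4 : H ^ (2 * 2 ^ q) = star (H ^ 2 ^ q) * H ^ 2 ^ q := by
    rw [star_pow, hsa.star_eq, ← pow_add, two_mul]
  rw [h4, Finset.sum_comm]
  simp only [Matrix.trace, Matrix.diag, Matrix.mul_apply, Matrix.star_apply, Complex.re_sum]
  refine Finset.sum_congr rfl fun i _ => Finset.sum_congr rfl fun j _ => ?_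
  have := Complex.conj_mul' ((H ^ 2 ^ q) j i)
  rw [show star ((H ^ 2 ^ q) j i) = (starRingEnd ℂ) ((H ^ 2 ^ q) j i) from rfl, this]
  norm_cast

end MatrixNorm

/-! ### Bounds and limits of splitting sums -/

section SplitSumAnalysis

theorem norm_splitSum_le {L : Type*} (g : L → ℂ) (F : List L → List L → ℂ) (B b : ℝ)
    (hg : ∀ y, ‖g y‖ ≤ B) (pre W : List L)
    (hF : ∀ U y V, W = U ++ y :: V → ‖F (pre ++ U) V‖ ≤ b) :
    ‖splitSum g F pre W‖ ≤ W.length * (B * b) := by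
  induction W generalizing pre with
  | nil => simp [splitSum]
  | cons y V ih =>
    have hB : 0 ≤ B := (norm_nonneg _).trans (hg y)
    have h1 := ih (pre ++ [y]) fun U z V' hV => by
      have := hF (y :: U) z V' (by simp [hV])
      simpa using this
    have h2 : ‖F pre V‖ ≤ b := by simpa using hF [] y V rfl
    simp only [splitSum, smul_eq_mul, List.length_cons]
    calc _ ≤ ‖g y * F pre V‖ + _ := norm_add_le _ _
      _ ≤ B * b + V.length * (B * b) := by
        rw [norm_mul]
        exact add_le_add (mul_le_mul (hg y) h2 (norm_nonneg _) hB) h1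
      _ = _ := by push_cast; ring

theorem tendsto_splitSum {L : Type*} (g : L → ℂ) (F : ℕ → List L → List L → ℂ)
    (G : List L → List L → ℂ) (pre W : List L)
    (h : ∀ U y V, W = U ++ y :: V → Tendsto (fun n => F n (pre ++ U) V) atTop
      (𝓝 (G (pre ++ U) V)) ∨ g y = 0) :
    Tendsto (fun n => splitSum g (F n) pre W) atTop (𝓝 (splitSum g G pre W)) := by
  induction W generalizing pre with
  | nil => simp [splitSum]
  | cons y V ih =>
    simp only [splitSum, smul_eq_mul]
    refine Tendsto.add ?_ (ih _ fun U z V' hV => ?_)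
    · rcases h [] y V rfl with h | h
      · simpa using h.const_mul (g y)
      · simp [h]
    · have := h (y :: U) z V' (by simp [hV])
      simpa using this

theorem splitSum_finset_sum {L M ι : Type*} [AddCommGroup M] [Module ℂ M] (s : Finset ι) (g : L → ℂ)
    (F : ι → List L → List L → M) (pre W : List L) :
    splitSum g (fun U V => ∑ i ∈ s, F i U V) pre W = ∑ i ∈ s, splitSum g (F i) pre W := by
  induction W generalizing pre with
  | nil => simp [splitSum]
  | cons y V ih => simp only [splitSum, ih, Finset.smul_sum, Finset.sum_add_distrib]

end SplitSumAnalysis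

/-! ### Random matrices obeying an integration by parts formula -/

section WickSystem

variable {Ω E X Y : Type*} [MeasurableSpace Ω] {n : ℕ}

/-- The coefficient matrices of the three parts of the covariance. -/
noncomputable def covMatrix (R : Type*) [CommRing R] [Algebra ℂ R] {n : ℕ} (i j : Fin n)
    (r : Fin 3) :
    Matrix (Fin n) (Fin n) R :=
  (algebraMap ℂ R (n : ℂ)⁻¹) • ![Matrix.single j i 1, Matrix.single i j 1,
    if i = j then Matrix.single i i 1 else 0] r

/-- A family of random matrices with polynomial entries which satisfies the Gaussian integration by
parts formula with covariance
`n⁻¹ (c 0 δ_{il} δ_{jk} + c 1 δ_{ik} δ_{jl} + c 2 δ_{ijkl})`. -/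
structure IsWickSystem (μ : Measure Ω) (x : E → Ω → ℂ) (c : Fin 3 → X → X → ℂ)
    (Z : X ⊕ Y → Matrix (Fin n) (Fin n) (MvPolynomial E ℂ))
    (der : X → Fin n → Fin n → Derivation ℂ (MvPolynomial E ℂ) (MvPolynomial E ℂ)) : Prop where
  integrable : ∀ p : MvPolynomial E ℂ,
    Integrable (fun ω => MvPolynomial.eval (fun e => x e ω) p) μ
  ibp : ∀ a i j p, ∫ ω, MvPolynomial.eval (fun e => x e ω) (Z (Sum.inl a) i j * p) ∂μ =
    ∫ ω, MvPolynomial.eval (fun e => x e ω) (der a i j p) ∂μ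
  cov : ∀ a i j y, (Z y).map (der a i j) =
    ∑ r, covExt (c r) a y • covMatrix (MvPolynomial E ℂ) i j r

/-- The word in the matrices `Z`. -/
noncomputable def matWord {R : Type*} [CommRing R] {L : Type*} (Z : L → Matrix (Fin n) (Fin n) R)
    (W : List L) :
    Matrix (Fin n) (Fin n) R := (W.map Z).prod

/-- The normalised trace. -/
noncomputable def normTrace {R : Type*} [CommRing R] [Algebra ℂ R]
    (P : Matrix (Fin n) (Fin n) R) : R :=
  (n : ℂ)⁻¹ • P.trace

theorem matWord_append {R : Type*} [CommRing R] {L : Type*} (Z : L → Matrix (Fin n) (Fin n) R)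
    (U V : List L) : matWord Z (U ++ V) = matWord Z U * matWord Z V := by simp [matWord]

theorem normTrace_append_comm {R : Type*} [CommRing R] [Algebra ℂ R] {L : Type*}
    (Z : L → Matrix (Fin n) (Fin n) R) (U V : List L) :
    normTrace (matWord Z (U ++ V)) = normTrace (matWord Z (V ++ U)) := by
  rw [matWord_append, matWord_append, normTrace, normTrace, Matrix.trace_mul_comm]

namespace IsWickSystem

variable {μ : Measure Ω} {x : E → Ω → ℂ} {c : Fin 3 → X → X → ℂ}
  {Z : X ⊕ Y → Matrix (Fin n) (Fin n) (MvPolynomial E ℂ)}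
  {der : X → Fin n → Fin n → Derivation ℂ (MvPolynomial E ℂ) (MvPolynomial E ℂ)}

theorem _root_.Matrix.map_derivation_mul {R : Type*} [CommRing R] [Algebra ℂ R]
    (δ : Derivation ℂ R R) (P Q : Matrix (Fin n) (Fin n) R) :
    (P * Q).map δ = P.map δ * Q + P * Q.map δ := by
  ext i j
  simp only [Matrix.map_apply, Matrix.mul_apply, Matrix.add_apply, map_sum, Derivation.leibniz,
    smul_eq_mul, ← Finset.sum_add_distrib]
  refine Finset.sum_congr rfl fun k _ => ?_
  ring

/-- The Leibniz rule: each Gaussian letter is in turn replaced by its covariance matrices. -/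
theorem derivation_matWord (h : IsWickSystem μ x c Z der) (a : X) (i j : Fin n)
    (W : List (X ⊕ Y)) :
    (matWord Z W).map (der a i j) = ∑ r, splitSum (covExt (c r) a)
      (fun U V => matWord Z U * covMatrix (MvPolynomial E ℂ) i j r * matWord Z V) [] W := by
  -- The letters already passed must be carried along in `pre`, since they stand to the left of the
  -- differentiated letter.
  have key : ∀ pre, matWord Z pre * (matWord Z W).map (der a i j) =
      ∑ r, splitSum (covExt (c r) a)
      (fun U V => matWord Z U * covMatrix (MvPolynomial E ℂ) i j r * matWord Z V) pre W := by
    induction W with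
    | nil =>
      intro pre
      have : (matWord Z []).map (der a i j) = 0 := by
        ext k l
        simp only [matWord, List.map_nil, List.prod_nil, Matrix.map_apply, Matrix.zero_apply,
          Matrix.one_apply]
        split_ifs <;> simp
      simp [this, splitSum]
    | cons y V ih =>
      intro pre
      have h1 : matWord Z (y :: V) = Z y * matWord Z V := by simp [matWord]
      have h2 : matWord Z pre * Z y = matWord Z (pre ++ [y]) := by simp [matWord]
      simp only [splitSum, Finset.sum_add_distrib]
      rw [h1, Matrix.map_derivation_mul, mul_add, ← mul_assoc, ← mul_assoc, h2, ih, h.cov,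
        Finset.mul_sum, Finset.sum_mul]
      simp
  simpa [matWord] using key []

end IsWickSystem

end WickSystem

/-! ### Size of the covariance contractions -/

section WickEstimate

open scoped Matrix.Norms.L2Operator

variable {Ω E X Y : Type*} {n : ℕ}

/-- Only the part `r = 0` yields a product of two traces and hence survives the normalisation; the
other two are of lower order. -/
theorem sum_mul_covMatrix_mul {R : Type*} [CommRing R] [Algebra ℂ R]
    (U V : Matrix (Fin n) (Fin n) R) (r : Fin 3) :
    ∑ i, ∑ j, (U * covMatrix R i j r * V : Matrix (Fin n) (Fin n) R) j i =
      (n : ℂ)⁻¹ • ![U.trace * V.trace, ∑ i, ∑ j, U j i * V j i, ∑ i, U i i * V i i] r := by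
  have h : ∀ i j k l : Fin n, (U * Matrix.single i j (1 : R) * V) k l = U k i * V j l := by
    intro i j k l
    simp [Matrix.mul_apply, Matrix.single_apply, ite_and, Finset.sum_ite_eq]
  simp only [covMatrix, Matrix.mul_smul, Matrix.smul_mul, Matrix.smul_apply]
  simp only [smul_eq_mul, ← Algebra.smul_def, ← Finset.smul_sum]
  congr 1
  fin_cases r
  · simp only [Fin.zero_eta, Matrix.cons_val_zero, h, Matrix.trace, Matrix.diag, Finset.sum_mul_sum]
    rw [Finset.sum_comm]
  · simp [h]
  · simp only [Fin.reduceFinMk, Matrix.cons_val]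
    refine Finset.sum_congr rfl fun i _ => ?_
    rw [Finset.sum_eq_single i]
    · simp [h]
    · intro j _ hj
      simp [hj.symm]
    · simp

/-- In all three parts the contraction is a single sum of trace type, of size `n ‖M‖ ‖P‖`; the
factor `n⁻¹` of the covariance compensates. -/
theorem norm_sum_mul_trace_covMatrix_le (M P : Matrix (Fin n) (Fin n) ℂ) (r : Fin 3) :
    ‖∑ i, ∑ j, M j i * (covMatrix ℂ i j r * P).trace‖ ≤ ‖M‖ * ‖P‖ := by
  rcases Nat.eq_zero_or_pos n with rfl | hn
  · simp
    positivity
  have hn' : (0 : ℝ) < n := by exact_mod_cast hn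
  have h : ∀ i j : Fin n, (Matrix.single i j (1 : ℂ) * P).trace = P j i := by
    intro i j
    simp [Matrix.trace, Matrix.mul_apply, Matrix.single_apply, ite_and, Finset.sum_ite_eq]
  simp only [covMatrix, Matrix.smul_mul, Matrix.trace_smul, smul_eq_mul, mul_left_comm (M _ _),
    ← Finset.mul_sum, norm_mul, Algebra.algebraMap_self, RingHom.id_apply, norm_inv,
    Complex.norm_natCast]
  rw [inv_mul_le_iff₀ hn']
  fin_cases r
  · simp only [Fin.zero_eta, Matrix.cons_val_zero, h]
    have : ∑ i, ∑ j, M j i * P i j = (M * P).trace := by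
      simp only [Matrix.trace, Matrix.diag, Matrix.mul_apply]
      rw [Finset.sum_comm]
    rw [this]
    exact (Matrix.norm_trace_le_opNorm _).trans (by gcongr; exact norm_mul_le _ _)
  · simp only [Fin.mk_one, Matrix.cons_val_one, Matrix.cons_val_zero, h]
    exact Matrix.norm_sum_mul_le M P
  · simp only [Fin.reduceFinMk, Matrix.cons_val]
    have : ∀ i, ∑ j, M j i * ((if i = j then Matrix.single i i (1 : ℂ) else 0) * P).trace =
        M i i * P i i := by
      intro i
      rw [Finset.sum_eq_single i]
      · simp [h]
      · intro j _ hj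
        simp [hj.symm]
      · simp
    simp only [this]
    exact Matrix.norm_sum_diag_mul_le M P

theorem Matrix.opNorm_one_le : ‖(1 : Matrix (Fin n) (Fin n) ℂ)‖ ≤ 1 := by
  rcases Nat.eq_zero_or_pos n with rfl | hn
  · rw [Subsingleton.elim (1 : Matrix (Fin 0) (Fin 0) ℂ) 0, norm_zero]
    exact zero_le_one
  · have : Nonempty (Fin n) := ⟨⟨0, hn⟩⟩
    exact (norm_one).le

theorem norm_matWord_le {L : Type*} (Z : L → Matrix (Fin n) (Fin n) ℂ) (K : ℝ)
    (hZ : ∀ y, ‖Z y‖ ≤ K) (W : List L) : ‖matWord Z W‖ ≤ K ^ W.length := by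
  induction W with
  | nil => simpa [matWord] using Matrix.opNorm_one_le
  | cons y V ih =>
    have : matWord Z (y :: V) = Z y * matWord Z V := by simp [matWord]
    rw [this, List.length_cons, pow_succ']
    exact (norm_mul_le _ _).trans (mul_le_mul (hZ y) ih (norm_nonneg _)
      ((norm_nonneg _).trans (hZ y)))

theorem matWord_map {R S L : Type*} [CommRing R] [CommRing S] (f : R →+* S)
    (Z : L → Matrix (Fin n) (Fin n) R) (W : List L) :
    (matWord Z W).map f = matWord (fun y => (Z y).map f) W := by
  have := map_list_prod (f.mapMatrix (m := Fin n)) (W.map Z)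
  simpa [matWord, Function.comp_def] using this

theorem trace_map {R S : Type*} [CommRing R] [CommRing S] (f : R →+* S)
    (P : Matrix (Fin n) (Fin n) R) : f P.trace = (P.map f).trace := by
  simp [Matrix.trace]

/-- Evaluation of polynomials as a linear map. -/
noncomputable def evalLinear {E : Type*} (x : E → ℂ) : MvPolynomial E ℂ →ₗ[ℂ] ℂ where
  toFun := MvPolynomial.eval x
  map_add' := map_add _
  map_smul' t p := by simp [MvPolynomial.smul_eval]

theorem covMatrix_map {E : Type*} (x : E → ℂ) (i j : Fin n) (r : Fin 3) :
    (covMatrix (MvPolynomial E ℂ) i j r).map (MvPolynomial.eval x) = covMatrix ℂ i j r := by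
  ext k l
  fin_cases r
  · simp [covMatrix, Matrix.single_apply, apply_ite (MvPolynomial.eval x)]
  · simp [covMatrix, Matrix.single_apply, apply_ite (MvPolynomial.eval x)]
  · by_cases h : i = j
    · simp [covMatrix, h, Matrix.single_apply, apply_ite (MvPolynomial.eval x)]
    · simp [covMatrix, h]

namespace IsWickSystem

variable {x : E → Ω → ℂ}
  {der : X → Fin n → Fin n → Derivation ℂ (MvPolynomial E ℂ) (MvPolynomial E ℂ)}

/-- A polynomial which is bounded, together with its derivatives, by a power of `K`. -/
structure IsTest (x : E → Ω → ℂ) (K : Ω → ℝ)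
    (der : X → Fin n → Fin n → Derivation ℂ (MvPolynomial E ℂ) (MvPolynomial E ℂ)) (C : ℝ) (k : ℕ)
    (Q : MvPolynomial E ℂ) : Prop where
  bound : ∀ ω, ‖MvPolynomial.eval (fun e => x e ω) Q‖ ≤ C * K ω ^ k
  deriv_bound : ∀ ω a (M : Matrix (Fin n) (Fin n) ℂ),
    ‖∑ i, ∑ j, M j i * MvPolynomial.eval (fun e => x e ω) (der a i j Q)‖ ≤
      C * ((n : ℝ)⁻¹ * (‖M‖ * K ω ^ k))

theorem IsTest.one (K : Ω → ℝ) : IsTest x K der 1 0 1 := by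
  refine ⟨fun ω => by simp, fun ω a M => ?_⟩
  simp
  positivity

/-- The Leibniz rule has two terms, whence the factor `2`. -/
theorem IsTest.mul {K : Ω → ℝ} (hK : ∀ ω, 1 ≤ K ω) {C C' : ℝ} {k k' : ℕ} {Q Q' : MvPolynomial E ℂ}
    (hQ : IsTest x K der C k Q) (hQ' : IsTest x K der C' k' Q') :
    IsTest x K der (2 * (C * C')) (k + k') (Q * Q') := by
  have hpos : ∀ ω k, 0 < K ω ^ k := fun ω k => pow_pos (zero_lt_one.trans_le (hK ω)) k
  rcases isEmpty_or_nonempty Ω with hΩ | ⟨⟨ω₀⟩⟩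
  · exact ⟨fun ω => isEmptyElim ω, fun ω => isEmptyElim ω⟩
  have hC : 0 ≤ C := nonneg_of_mul_nonneg_left ((norm_nonneg _).trans (hQ.bound ω₀)) (hpos ω₀ k)
  have hC' : 0 ≤ C' :=
    nonneg_of_mul_nonneg_left ((norm_nonneg _).trans (hQ'.bound ω₀)) (hpos ω₀ k')
  refine ⟨fun ω => ?_, fun ω a M => ?_⟩
  · rw [map_mul, norm_mul]
    have h1 := mul_le_mul (hQ.bound ω) (hQ'.bound ω) (norm_nonneg _) (by have := hpos ω k; positivity)
    refine h1.trans ?_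
    rw [pow_add]
    have := mul_nonneg hC hC'
    have h2 := mul_pos (hpos ω k) (hpos ω k')
    nlinarith [mul_nonneg this h2.le]
  · set ev := MvPolynomial.eval (fun e => x e ω) with hev
    have e1 : ∑ i, ∑ j, M j i * ev (der a i j (Q * Q')) =
        ev Q * (∑ i, ∑ j, M j i * ev (der a i j Q')) +
        ev Q' * ∑ i, ∑ j, M j i * ev (der a i j Q) := by
      simp only [Derivation.leibniz, smul_eq_mul, map_add, map_mul, Finset.mul_sum,
        ← Finset.sum_add_distrib]
      refine Finset.sum_congr rfl fun i _ => Finset.sum_congr rfl fun j _ => ?_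
      ring
    rw [e1]
    refine (norm_add_le _ _).trans ?_
    rw [norm_mul, norm_mul]
    have h1 := mul_le_mul (hQ.bound ω) (hQ'.deriv_bound ω a M) (norm_nonneg _)
      (by have := hpos ω k; positivity)
    have h2 := mul_le_mul (hQ'.bound ω) (hQ.deriv_bound ω a M) (norm_nonneg _)
      (by have := hpos ω k'; positivity)
    refine (add_le_add h1 h2).trans (le_of_eq ?_)
    rw [pow_add]
    ring

variable [MeasurableSpace Ω] {μ : Measure Ω} {c : Fin 3 → X → X → ℂ}
  {Z : X ⊕ Y → Matrix (Fin n) (Fin n) (MvPolynomial E ℂ)}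

/-- Differentiating `n⁻¹ Tr W` opens the trace at one letter and leaves a cyclic word `V U`. Its
contraction with `M` costs only `‖M‖ ‖V U‖`, so the prefactor `n⁻¹` remains. The `3` counts the
parts of the covariance, the `1` serves the bound on the trace itself. -/
theorem isTest_normTrace (h : IsWickSystem μ x c Z der) {K : Ω → ℝ} (hK : ∀ ω, 1 ≤ K ω)
    (hZ : ∀ ω y, ‖(Z y).map (MvPolynomial.eval fun e => x e ω)‖ ≤ K ω) {B : ℝ} (hB0 : 0 ≤ B)
    (hB : ∀ r a y, ‖covExt (c r) a (y : X ⊕ Y)‖ ≤ B) (W : List (X ⊕ Y)) :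
    IsTest x K der (1 + 3 * B * W.length) W.length (normTrace (matWord Z W)) := by
  have hpos : ∀ ω k, 0 < K ω ^ k := fun ω k => pow_pos (zero_lt_one.trans_le (hK ω)) k
  refine ⟨fun ω => ?_, fun ω a M => ?_⟩
  · have h1 : ‖(matWord Z W).map (MvPolynomial.eval fun e => x e ω)‖ ≤ K ω ^ W.length := by
      rw [matWord_map]
      exact norm_matWord_le _ _ (hZ ω) W
    rw [normTrace, MvPolynomial.smul_eval, trace_map, norm_mul, norm_inv, Complex.norm_natCast]
    rcases Nat.eq_zero_or_pos n with rfl | hn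
    · have := hpos ω W.length
      simp
      positivity
    have h2 : (n : ℝ)⁻¹ * ‖((matWord Z W).map (MvPolynomial.eval fun e => x e ω)).trace‖ ≤
        K ω ^ W.length := by
      rw [inv_mul_le_iff₀ (by exact_mod_cast hn)]
      exact (Matrix.norm_trace_le_opNorm _).trans (by gcongr)
    refine h2.trans (le_mul_of_one_le_left (hpos ω _).le ?_)
    have : 0 ≤ 3 * B * W.length := by positivity
    linarith
  · set ev := MvPolynomial.eval (fun e => x e ω) with hev
    have e0 : ∀ i j, ev (der a i j (normTrace (matWord Z W))) =
        (n : ℂ)⁻¹ * ∑ r, splitSum (covExt (c r) a) (fun U V =>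
          (covMatrix ℂ i j r * ((matWord Z V).map ev * (matWord Z U).map ev)).trace) [] W := by
      intro i j
      rw [normTrace, Derivation.map_smul, MvPolynomial.smul_eval]
      congr 1
      have e1 : der a i j (matWord Z W).trace = ((matWord Z W).map (der a i j)).trace := by
        simp [Matrix.trace]
      rw [e1, h.derivation_matWord, Matrix.trace_sum, map_sum]
      refine Finset.sum_congr rfl fun r _ => ?_
      have e2 : splitSum (covExt (c r) a) (fun U V =>
          ev (matWord Z U * covMatrix (MvPolynomial E ℂ) i j r * matWord Z V).trace) [] W =
          ev (splitSum (covExt (c r) a) (fun U V =>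
            matWord Z U * covMatrix (MvPolynomial E ℂ) i j r * matWord Z V) [] W).trace :=
        splitSum_map (evalLinear (fun e => x e ω) ∘ₗ
          Matrix.traceLinearMap (Fin n) ℂ (MvPolynomial E ℂ)) _ _ _ _
      rw [← e2]
      refine splitSum_congr _ _ _ _ _ fun U y V _ _ => ?_
      rw [trace_map ev, Matrix.map_mul, Matrix.map_mul, hev, covMatrix_map, ← hev, Matrix.trace_mul_comm,
        ← mul_assoc, Matrix.trace_mul_comm]
    simp only [e0]
    have e3 : ∑ i, ∑ j, M j i * ((n : ℂ)⁻¹ * ∑ r, splitSum (covExt (c r) a) (fun U V =>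
          (covMatrix ℂ i j r * ((matWord Z V).map ev * (matWord Z U).map ev)).trace) [] W) =
        (n : ℂ)⁻¹ * ∑ r, splitSum (covExt (c r) a) (fun U V => ∑ i, ∑ j, M j i *
          (covMatrix ℂ i j r * ((matWord Z V).map ev * (matWord Z U).map ev)).trace) [] W := by
      have : ∀ r i j, splitSum (covExt (c r) a) (fun U V => M j i *
          (covMatrix ℂ i j r * ((matWord Z V).map ev * (matWord Z U).map ev)).trace) [] W = M j i *
          splitSum (covExt (c r) a) (fun U V =>
          (covMatrix ℂ i j r * ((matWord Z V).map ev * (matWord Z U).map ev)).trace) [] W :=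
        fun r i j => splitSum_smul (M j i) _ _ _ _
      simp only [splitSum_finset_sum, this, mul_left_comm (M _ _), ← Finset.mul_sum]
      congr 1
      simp only [Finset.mul_sum]
      conv_rhs => rw [Finset.sum_comm]
      refine Finset.sum_congr rfl fun i _ => ?_
      rw [Finset.sum_comm]
    rw [e3, norm_mul, norm_inv, Complex.norm_natCast]
    have e4 : ∀ r, ‖splitSum (covExt (c r) a) (fun U V => ∑ i, ∑ j, M j i *
          (covMatrix ℂ i j r * ((matWord Z V).map ev * (matWord Z U).map ev)).trace) [] W‖ ≤
        W.length * (B * (‖M‖ * K ω ^ W.length)) := by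
      intro r
      refine norm_splitSum_le _ _ _ _ (hB r a) _ _ fun U y V hW => ?_
      refine (norm_sum_mul_trace_covMatrix_le _ _ _).trans ?_
      gcongr
      refine (norm_mul_le _ _).trans ?_
      rw [matWord_map, matWord_map, hW, List.nil_append]
      calc _ ≤ K ω ^ V.length * K ω ^ U.length :=
            mul_le_mul (norm_matWord_le _ _ (hZ ω) V) (norm_matWord_le _ _ (hZ ω) U)
              (norm_nonneg _) (hpos ω _).le
        _ ≤ _ := by
            rw [← pow_add]
            exact pow_le_pow_right₀ (hK ω) (by simp; omega)
    have e5 := norm_sum_le_of_le Finset.univ (fun r _ => e4 r)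
    calc _ ≤ (n : ℝ)⁻¹ * (3 * (W.length * (B * (‖M‖ * K ω ^ W.length)))) := by
          gcongr
          simpa using e5
      _ = (3 * B * W.length) * ((n : ℝ)⁻¹ * (‖M‖ * K ω ^ W.length)) := by ring
      _ ≤ _ := by
          have := hpos ω W.length
          gcongr
          linarith

end IsWickSystem

end WickEstimate

/-! ### The Schwinger–Dyson equations in the large `n` limit -/

section WickLimit

open scoped Matrix.Norms.L2Operator

namespace IsWickSystem

section Estimate

variable {Ω E X Y : Type*} {n : ℕ} [MeasurableSpace Ω] {μ : Measure Ω} {x : E → Ω → ℂ}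
  {c : Fin 3 → X → X → ℂ}
  {der : X → Fin n → Fin n → Derivation ℂ (MvPolynomial E ℂ) (MvPolynomial E ℂ)}
  {Z : X ⊕ Y → Matrix (Fin n) (Fin n) (MvPolynomial E ℂ)}

/-- The expectation of a polynomial in the variables `x`. -/
noncomputable def expect (h : IsWickSystem μ x c Z der) : MvPolynomial E ℂ →ₗ[ℂ] ℂ where
  toFun p := ∫ ω, MvPolynomial.eval (fun e => x e ω) p ∂μ
  map_add' p q := by
    simp only [map_add]
    exact integral_add (h.integrable p) (h.integrable q)
  map_smul' t p := by
    simp only [MvPolynomial.smul_eval, RingHom.id_apply, smul_eq_mul]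
    exact integral_const_mul _ _

theorem expect_apply (h : IsWickSystem μ x c Z der) (p : MvPolynomial E ℂ) :
    h.expect p = ∫ ω, MvPolynomial.eval (fun e => x e ω) p ∂μ := rfl

theorem norm_expect_le (h : IsWickSystem μ x c Z der) (p : MvPolynomial E ℂ) (f : Ω → ℝ)
    (hf : Integrable f μ) (hp : ∀ ω, ‖MvPolynomial.eval (fun e => x e ω) p‖ ≤ f ω) :
    ‖h.expect p‖ ≤ ∫ ω, f ω ∂μ :=
  norm_integral_le_of_norm_le hf (ae_of_all _ hp)

/-- Integration by parts with respect to the entries of the first letter: the derivative falls on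
`Q`, or on the rest `W` of the word. -/
theorem expect_normTrace_mul (h : IsWickSystem μ x c Z der) (a : X) (W : List (X ⊕ Y))
    (Q : MvPolynomial E ℂ) :
    h.expect (normTrace (matWord Z (Sum.inl a :: W)) * Q) =
      h.expect ((n : ℂ)⁻¹ • ∑ i, ∑ j, matWord Z W j i * der a i j Q) +
      ∑ r, h.expect ((n : ℂ)⁻¹ • (Q * splitSum (covExt (c r) a) (fun U V => (n : ℂ)⁻¹ •
        ![(matWord Z U).trace * (matWord Z V).trace, ∑ i, ∑ j, matWord Z U j i * matWord Z V j i,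
          ∑ i, matWord Z U i i * matWord Z V i i] r) [] W)) := by
  have e1 : normTrace (matWord Z (Sum.inl a :: W)) * Q =
      (n : ℂ)⁻¹ • ∑ i, ∑ j, Z (Sum.inl a) i j * (matWord Z W j i * Q) := by
    have : matWord Z (Sum.inl a :: W) = Z (Sum.inl a) * matWord Z W := by simp [matWord]
    rw [this, normTrace, smul_mul_assoc]
    simp only [Matrix.trace, Matrix.diag, Matrix.mul_apply, Finset.sum_mul, mul_assoc]
  have e2 : ∀ i j, h.expect (Z (Sum.inl a) i j * (matWord Z W j i * Q)) =
      h.expect (der a i j (matWord Z W j i * Q)) := fun i j => h.ibp a i j _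
  have e3 : ∑ i, ∑ j, der a i j (matWord Z W j i * Q) =
      ∑ i, ∑ j, matWord Z W j i * der a i j Q + Q * ∑ r, splitSum (covExt (c r) a) (fun U V =>
        (n : ℂ)⁻¹ • ![(matWord Z U).trace * (matWord Z V).trace,
          ∑ i, ∑ j, matWord Z U j i * matWord Z V j i,
          ∑ i, matWord Z U i i * matWord Z V i i] r) [] W := by
    simp only [Derivation.leibniz, smul_eq_mul, Finset.sum_add_distrib]
    congr 1
    simp only [← Finset.mul_sum]
    congr 1
    have e4 : ∀ i j, der a i j (matWord Z W j i) = ∑ r, splitSum (covExt (c r) a) (fun U V =>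
        (matWord Z U * covMatrix (MvPolynomial E ℂ) i j r * matWord Z V :
          Matrix (Fin n) (Fin n) (MvPolynomial E ℂ)) j i) [] W := by
      intro i j
      have := congrFun (congrFun (h.derivation_matWord a i j W) j) i
      rw [Matrix.map_apply, Matrix.sum_apply] at this
      rw [this]
      refine Finset.sum_congr rfl fun r _ => ?_
      exact (splitSum_map (Matrix.entryLinearMap ℂ (MvPolynomial E ℂ) j i) _ _ _ _).symm
    simp only [e4, ← sum_mul_covMatrix_mul, splitSum_finset_sum]
    conv_rhs => rw [Finset.sum_comm]
    refine Finset.sum_congr rfl fun i _ => ?_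
    rw [Finset.sum_comm]
  have e5 : h.expect (∑ i, ∑ j, Z (Sum.inl a) i j * (matWord Z W j i * Q)) =
      h.expect (∑ i, ∑ j, der a i j (matWord Z W j i * Q)) := by
    simp only [map_sum, e2]
  rw [e1, map_smul, e5, e3, map_add, smul_add, ← map_smul, ← map_smul]
  congr 1
  rw [Finset.mul_sum, Finset.smul_sum, map_sum]

/-- The subtracted sum is the part `r = 0`. In the constant, `1` comes from the derivative falling
on `Q` and `2` from the parts `r = 1, 2`. -/
theorem norm_expect_normTrace_sub_le (h : IsWickSystem μ x c Z der) (hn : n ≠ 0) {K : Ω → ℝ}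
    (hK : ∀ ω, 1 ≤ K ω) (hKint : ∀ k : ℕ, Integrable (fun ω => K ω ^ k) μ)
    (hZ : ∀ ω y, ‖(Z y).map (MvPolynomial.eval fun e => x e ω)‖ ≤ K ω) {B : ℝ}
    (hB : ∀ r a y, ‖covExt (c r) a (y : X ⊕ Y)‖ ≤ B) (a : X) (W : List (X ⊕ Y)) {C : ℝ} (hC : 0 ≤ C)
    {k : ℕ} {Q : MvPolynomial E ℂ} (hQ : IsTest x K der C k Q) :
    ‖h.expect (normTrace (matWord Z (Sum.inl a :: W)) * Q) - splitSum (covExt (c 0) a)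
      (fun U V => h.expect (normTrace (matWord Z U) * normTrace (matWord Z V) * Q)) [] W‖ ≤
      (1 + 2 * (W.length * B)) * C * ((n : ℝ)⁻¹ * ∫ ω, K ω ^ (W.length + k) ∂μ) := by
  have hpos : ∀ ω k, 0 < K ω ^ k := fun ω k => pow_pos (zero_lt_one.trans_le (hK ω)) k
  have hn' : (0 : ℝ) < n := by exact_mod_cast Nat.pos_of_ne_zero hn
  have e0 : h.expect ((n : ℂ)⁻¹ • (Q * splitSum (covExt (c 0) a) (fun U V => (n : ℂ)⁻¹ •
        ![(matWord Z U).trace * (matWord Z V).trace, ∑ i, ∑ j, matWord Z U j i * matWord Z V j i,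
          ∑ i, matWord Z U i i * matWord Z V i i] 0) [] W)) = splitSum (covExt (c 0) a)
      (fun U V => h.expect (normTrace (matWord Z U) * normTrace (matWord Z V) * Q)) [] W := by
    rw [splitSum_map]
    congr 1
    have := splitSum_map ((n : ℂ)⁻¹ • LinearMap.mulLeft ℂ Q) (covExt (c 0) a)
      (fun U V => (n : ℂ)⁻¹ •
        ![(matWord Z U).trace * (matWord Z V).trace, ∑ i, ∑ j, matWord Z U j i * matWord Z V j i,
          ∑ i, matWord Z U i i * matWord Z V i i] 0) [] W
    simp only [LinearMap.smul_apply, LinearMap.mulLeft_apply] at this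
    rw [← this]
    refine splitSum_congr _ _ _ _ _ fun U y V _ _ => ?_
    simp only [normTrace, Matrix.cons_val_zero, smul_mul_assoc, mul_smul_comm]
    congr 2
    ring
  have hw : ∀ ω W, ‖(matWord Z W).map (MvPolynomial.eval fun e => x e ω)‖ ≤ K ω ^ W.length := by
    intro ω W
    rw [matWord_map]
    exact norm_matWord_le _ _ (hZ ω) W
  have e1 : ‖h.expect ((n : ℂ)⁻¹ • ∑ i, ∑ j, matWord Z W j i * der a i j Q)‖ ≤
      ∫ ω, C * (n : ℝ)⁻¹ * K ω ^ (W.length + k) ∂μ := by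
    refine h.norm_expect_le _ _ ((hKint _).const_mul _) fun ω => ?_
    have h1 := hQ.deriv_bound ω a ((matWord Z W).map (MvPolynomial.eval fun e => x e ω))
    rw [MvPolynomial.smul_eval, norm_mul, norm_inv, Complex.norm_natCast, map_sum]
    simp only [map_sum, map_mul]
    -- This term is in fact of order `n⁻²`; the derivative bound already supplies one `n⁻¹`, and the
    -- explicit one is discarded.
    have hle : (n : ℝ)⁻¹ ≤ 1 := inv_le_one_of_one_le₀ (by exact_mod_cast Nat.pos_of_ne_zero hn)
    calc _ ≤ 1 * _ := mul_le_mul_of_nonneg_right hle (norm_nonneg _)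
      _ ≤ _ := by
        rw [one_mul]
        refine h1.trans ?_
        rw [pow_add]
        have := hw ω W
        have := hpos ω k
        rw [mul_assoc C]
        gcongr
  have e2 : ∀ r : Fin 3, r ≠ 0 → ‖h.expect ((n : ℂ)⁻¹ • (Q * splitSum (covExt (c r) a)
      (fun U V => (n : ℂ)⁻¹ •
        ![(matWord Z U).trace * (matWord Z V).trace, ∑ i, ∑ j, matWord Z U j i * matWord Z V j i,
          ∑ i, matWord Z U i i * matWord Z V i i] r) [] W))‖ ≤
      ∫ ω, (W.length * B) * C * (n : ℝ)⁻¹ * K ω ^ (W.length + k) ∂μ := by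
    intro r hr
    refine h.norm_expect_le _ _ ((hKint _).const_mul _) fun ω => ?_
    rw [MvPolynomial.smul_eval, norm_mul, norm_inv, Complex.norm_natCast, map_mul, norm_mul]
    have e3 := splitSum_map (evalLinear fun e => x e ω) (covExt (c r) a) (fun U V => (n : ℂ)⁻¹ •
        ![(matWord Z U).trace * (matWord Z V).trace, ∑ i, ∑ j, matWord Z U j i * matWord Z V j i,
          ∑ i, matWord Z U i i * matWord Z V i i] r) [] W
    change _ = MvPolynomial.eval (fun e => x e ω) _ at e3
    rw [← e3]
    have e4 : ‖splitSum (covExt (c r) a) (fun U V => evalLinear (fun e => x e ω) ((n : ℂ)⁻¹ •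
        ![(matWord Z U).trace * (matWord Z V).trace, ∑ i, ∑ j, matWord Z U j i * matWord Z V j i,
          ∑ i, matWord Z U i i * matWord Z V i i] r)) [] W‖ ≤
        W.length * (B * K ω ^ W.length) := by
      refine norm_splitSum_le _ _ _ _ (hB r a) _ _ fun U y V hW => ?_
      change ‖MvPolynomial.eval (fun e => x e ω) _‖ ≤ _
      rw [MvPolynomial.smul_eval, norm_mul, norm_inv, Complex.norm_natCast, inv_mul_le_iff₀ hn',
        List.nil_append]
      have h5 : ‖(matWord Z U).map (MvPolynomial.eval fun e => x e ω)‖ *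
          ‖(matWord Z V).map (MvPolynomial.eval fun e => x e ω)‖ ≤ K ω ^ W.length := by
        calc _ ≤ K ω ^ U.length * K ω ^ V.length :=
              mul_le_mul (hw ω U) (hw ω V) (norm_nonneg _) (hpos ω _).le
          _ ≤ _ := by
            rw [← pow_add]
            exact pow_le_pow_right₀ (hK ω) (by simp [hW])
      refine le_trans ?_ (mul_le_mul_of_nonneg_left h5 hn'.le)
      fin_cases r
      · exact absurd rfl hr
      · simp only [Fin.mk_one, Matrix.cons_val_one, Matrix.cons_val_zero, map_sum, map_mul]
        exact Matrix.norm_sum_mul_le ((matWord Z U).map (MvPolynomial.eval fun e => x e ω))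
          ((matWord Z V).map (MvPolynomial.eval fun e => x e ω))
      · simp only [Fin.reduceFinMk, Matrix.cons_val, map_sum, map_mul]
        exact Matrix.norm_sum_diag_mul_le ((matWord Z U).map (MvPolynomial.eval fun e => x e ω))
          ((matWord Z V).map (MvPolynomial.eval fun e => x e ω))
    have h6 := mul_le_mul (hQ.bound ω) e4 (norm_nonneg _) (by have := hpos ω k; positivity)
    calc _ ≤ (n : ℝ)⁻¹ * (C * K ω ^ k * (W.length * (B * K ω ^ W.length))) := by gcongr
      _ = _ := by rw [pow_add]; ring
  rw [h.expect_normTrace_mul, Fin.sum_univ_three, e0]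
  have h1 := e2 1 (by decide)
  have h2 := e2 2 (by decide)
  rw [integral_const_mul] at e1 h1 h2
  have h3 : ∀ p q r s : ℂ, ‖p + (q + r + s) - q‖ ≤ ‖p‖ + ‖r‖ + ‖s‖ := fun p q r s => by
    rw [show p + (q + r + s) - q = p + r + s by ring]
    exact norm_add₃_le
  refine (h3 _ _ _ _).trans ((add_le_add (add_le_add e1 h1) h2).trans (le_of_eq ?_))
  ring

/-- The product of the normalised traces of a list of words. -/
noncomputable def traceProd (Z : X ⊕ Y → Matrix (Fin n) (Fin n) (MvPolynomial E ℂ))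
    (ws : List (List (X ⊕ Y))) : MvPolynomial E ℂ :=
  (ws.map fun W => normTrace (matWord Z W)).prod

/-- The constant in the bound for `traceProd`. -/
noncomputable def traceProdConst {X Y : Type*} (B : ℝ) : List (List (X ⊕ Y)) → ℝ
  | [] => 1
  | W :: ws => 2 * ((1 + 3 * B * W.length) * traceProdConst B ws)

theorem traceProdConst_nonneg {X Y : Type*} {B : ℝ} (hB0 : 0 ≤ B) (ws : List (List (X ⊕ Y))) :
    0 ≤ traceProdConst B ws := by
  induction ws with
  | nil => exact zero_le_one
  | cons W ws ih =>
    simp only [traceProdConst]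
    positivity

theorem isTest_traceProd (h : IsWickSystem μ x c Z der) {K : Ω → ℝ} (hK : ∀ ω, 1 ≤ K ω)
    (hZ : ∀ ω y, ‖(Z y).map (MvPolynomial.eval fun e => x e ω)‖ ≤ K ω) {B : ℝ} (hB0 : 0 ≤ B)
    (hB : ∀ r a y, ‖covExt (c r) a (y : X ⊕ Y)‖ ≤ B) (ws : List (List (X ⊕ Y))) :
    IsTest x K der (traceProdConst B ws) (ws.map List.length).sum (traceProd Z ws) := by
  induction ws with
  | nil => simpa [traceProd, traceProdConst] using IsTest.one K
  | cons W ws ih =>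
    simpa [traceProd, traceProdConst] using (h.isTest_normTrace hK hZ hB0 hB W).mul hK ih

end Estimate

section Limit

variable {Ω E : ℕ → Type*} [∀ n, MeasurableSpace (Ω n)] {μ : ∀ n, Measure (Ω n)}
  {x : ∀ n, E n → Ω n → ℂ} {X Y : Type*} {c : Fin 3 → X → X → ℂ}
  {Z : ∀ n, X ⊕ Y → Matrix (Fin n) (Fin n) (MvPolynomial (E n) ℂ)}
  {der : ∀ n, X → Fin n → Fin n → Derivation ℂ (MvPolynomial (E n) ℂ) (MvPolynomial (E n) ℂ)}

/-- The error is `n⁻¹` times a moment of `K`, and such moments are `O(√n)`, so it is `O(n^{-1/2})`.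
-/
theorem tendsto_expect_sub (h : ∀ n, IsWickSystem (μ n) (x n) c (Z n) (der n)) {K : ∀ n, Ω n → ℝ}
    (hK : ∀ n ω, 1 ≤ K n ω) (hKint : ∀ n (k : ℕ), Integrable (fun ω => K n ω ^ k) (μ n))
    (hKbd : ∀ k : ℕ, ∃ C : ℝ, ∀ n ≠ 0, ∫ ω, K n ω ^ k ∂μ n ≤ C * √n)
    (hZ : ∀ n ω y, ‖(Z n y).map (MvPolynomial.eval fun e => x n e ω)‖ ≤ K n ω) {B : ℝ}
    (hB0 : 0 ≤ B) (hB : ∀ r a y, ‖covExt (c r) a (y : X ⊕ Y)‖ ≤ B) (a : X) (W : List (X ⊕ Y))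
    (ws : List (List (X ⊕ Y))) :
    Tendsto (fun n => (h n).expect (normTrace (matWord (Z n) (Sum.inl a :: W)) * traceProd (Z n) ws) -
      splitSum (covExt (c 0) a) (fun U V => (h n).expect (normTrace (matWord (Z n) U) *
        normTrace (matWord (Z n) V) * traceProd (Z n) ws)) [] W) atTop (𝓝 0) := by
  obtain ⟨C, hC⟩ := hKbd (W.length + (ws.map List.length).sum)
  set D := (1 + 2 * (W.length * B)) * traceProdConst B ws with hD
  have hD0 : 0 ≤ D := mul_nonneg (by positivity) (traceProdConst_nonneg hB0 ws)
  refine squeeze_zero_norm' (a := fun n : ℕ => D * C * (√n)⁻¹) ?_ ?_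
  · filter_upwards [eventually_ne_atTop 0] with n hn
    refine ((h n).norm_expect_normTrace_sub_le hn (hK n) (hKint n) (hZ n) hB a W
      (traceProdConst_nonneg hB0 ws) ((h n).isTest_traceProd (hK n) (hZ n) hB0 hB ws)).trans ?_
    rw [← hD]
    have hn' : (0 : ℝ) < √n := Real.sqrt_pos.2 (by exact_mod_cast Nat.pos_of_ne_zero hn)
    have e : (n : ℝ)⁻¹ = (√n)⁻¹ * (√n)⁻¹ := by
      rw [← mul_inv, Real.mul_self_sqrt (Nat.cast_nonneg n)]
    rw [mul_assoc D]
    refine mul_le_mul_of_nonneg_left ?_ hD0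
    calc _ ≤ (n : ℝ)⁻¹ * (C * √n) := by
          have := hC n hn
          gcongr
      _ = C * (√n)⁻¹ := by
          rw [e]
          field_simp
  · have h1 : Tendsto (fun n : ℕ => (√(n : ℝ))⁻¹) atTop (𝓝 0) :=
      tendsto_inv_atTop_zero.comp (Real.tendsto_sqrt_atTop.comp tendsto_natCast_atTop_atTop)
    simpa using h1.const_mul (D * C)

/-- Induction on the total number of Gaussian letters. Integrating one of them out splits a trace
into two, so the statement must be about products of traces from the start; the factorisation of the
limit then comes from the induction itself. -/
theorem tendsto_expect_traceProd [∀ n, IsProbabilityMeasure (μ n)]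
    (h : ∀ n, IsWickSystem (μ n) (x n) c (Z n) (der n))
    {K : ∀ n, Ω n → ℝ}
    (hK : ∀ n ω, 1 ≤ K n ω) (hKint : ∀ n (k : ℕ), Integrable (fun ω => K n ω ^ k) (μ n))
    (hKbd : ∀ k : ℕ, ∃ C : ℝ, ∀ n ≠ 0, ∫ ω, K n ω ^ k ∂μ n ≤ C * √n)
    (hZ : ∀ n ω y, ‖(Z n y).map (MvPolynomial.eval fun e => x n e ω)‖ ≤ K n ω) {B : ℝ}
    (hB0 : 0 ≤ B) (hB : ∀ r a y, ‖covExt (c r) a (y : X ⊕ Y)‖ ≤ B)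
    (M : List (X ⊕ Y) → ℂ) (hM : SchwingerDyson (c 0) M) (t : ℕ → List Y → ℂ)
    (ht : ∀ n u ω, MvPolynomial.eval (fun e => x n e ω)
      (normTrace (matWord (Z n) (u.map Sum.inr))) = t n u)
    (htM : ∀ u, Tendsto (fun n => t n u) atTop (𝓝 (M (u.map Sum.inr))))
    (ws : List (List (X ⊕ Y))) :
    Tendsto (fun n => (h n).expect (traceProd (Z n) ws)) atTop (𝓝 (ws.map M).prod) := by
  induction hN : gaussCount ws.flatten using Nat.strong_induction_on generalizing ws with
  | _ N ih =>
  subst hN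
  by_cases hws : ∃ W ∈ ws, ∃ (u : List Y) (a : X) (V : List (X ⊕ Y)),
      W = u.map Sum.inr ++ Sum.inl a :: V
  · obtain ⟨W, hW, u, a, V, rfl⟩ := hws
    obtain ⟨ws', hperm⟩ : ∃ ws', ws.Perm ((u.map Sum.inr ++ Sum.inl a :: V) :: ws') := by
      obtain ⟨l₁, l₂, rfl⟩ := List.append_of_mem hW
      exact ⟨_, List.perm_middle⟩
    have hp1 : ∀ n, traceProd (Z n) ws = normTrace (matWord (Z n) (Sum.inl a ::
        (V ++ u.map Sum.inr))) * traceProd (Z n) ws' := by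
      intro n
      -- By cyclicity of the trace the deterministic prefix `u` moves to the end of the word. There
      -- it has zero covariance with `a`, and it is rotated back once the trace has been split.
      rw [traceProd, (hperm.map _).prod_eq, List.map_cons, List.prod_cons, normTrace_append_comm]
      rfl
    have hcount : gaussCount ws.flatten = gaussCount V + 1 + gaussCount ws'.flatten := by
      rw [gaussCount, hperm.flatten.countP_eq]
      change gaussCount _ = _
      rw [List.flatten_cons, gaussCount_append, gaussCount_append, gaussCount_map_inr,
        gaussCount_inl]
      omega
    have hp2 : (ws.map M).prod = splitSum (covExt (c 0) a)
        (fun U V => M U * M (u.map Sum.inr ++ V) * (ws'.map M).prod) [] V := by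
      rw [(hperm.map M).prod_eq, List.map_cons, List.prod_cons, hM, mul_comm, ← smul_eq_mul,
        ← splitSum_smul]
      refine splitSum_congr _ _ _ _ _ fun U y V' _ _ => ?_
      rw [smul_eq_mul, mul_comm]
    have h1 := tendsto_expect_sub h hK hKint hKbd hZ hB0 hB a (V ++ u.map Sum.inr) ws'
    have h2 : Tendsto (fun n => splitSum (covExt (c 0) a)
        (fun U V => (h n).expect (normTrace (matWord (Z n) U) *
        normTrace (matWord (Z n) V) * traceProd (Z n) ws')) [] (V ++ u.map Sum.inr)) atTop
        (𝓝 (ws.map M).prod) := by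
      have e1 : ∀ n, splitSum (covExt (c 0) a)
        (fun U V => (h n).expect (normTrace (matWord (Z n) U) *
        normTrace (matWord (Z n) V) * traceProd (Z n) ws')) [] (V ++ u.map Sum.inr) =
          splitSum (covExt (c 0) a) (fun U V => (h n).expect (traceProd (Z n)
            (U :: (u.map Sum.inr ++ V) :: ws'))) [] V := by
        intro n
        rw [splitSum_append, splitSum_of_forall_eq_zero (W := u.map Sum.inr), add_zero]
        · refine splitSum_congr _ _ _ _ _ fun U y V _ _ => ?_
          rw [normTrace_append_comm (Z n) V]
          simp [traceProd, mul_assoc]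
        · intro y hy
          obtain ⟨y, -, rfl⟩ := List.mem_map.1 hy
          rfl
      simp only [e1]
      rw [hp2]
      refine tendsto_splitSum _ _ _ _ _ fun U y V' hV => ?_
      by_cases hy : covExt (c 0) a y = 0
      · exact Or.inr hy
      refine Or.inl ?_
      have := ih _ ?_ (([] ++ U) :: (u.map Sum.inr ++ V') :: ws') rfl
      · simpa [mul_assoc] using this
      · rw [hcount, hV]
        have := gaussCount_cons y V'
        simp only [List.flatten_cons, gaussCount_append, gaussCount_map_inr, List.nil_append]
        omega
    have h3 := h1.add h2
    simp only [sub_add_cancel, zero_add] at h3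
    simpa only [hp1] using h3
  · have hdet : ∃ us : List (List Y), ws = us.map fun u => u.map Sum.inr := by
      clear ih
      induction ws with
      | nil => exact ⟨[], rfl⟩
      | cons W ws ihw =>
        obtain ⟨us, rfl⟩ := ihw fun ⟨W, hW, h⟩ => hws ⟨W, by simp [hW], h⟩
        rcases exists_first_gauss W with ⟨u, rfl⟩ | ⟨u, a, V, rfl⟩
        · exact ⟨u :: us, rfl⟩
        · exact absurd ⟨_, by simp, u, a, V, rfl⟩ hws
    obtain ⟨us, rfl⟩ := hdet
    have e1 : ∀ n, (h n).expect (traceProd (Z n) (us.map fun u => u.map Sum.inr)) =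
        (us.map (t n)).prod := by
      intro n
      rw [expect_apply]
      simp only [traceProd, map_list_prod, List.map_map, Function.comp_def, ht]
      simp
    simp only [e1, List.map_map, Function.comp_def]
    exact tendsto_list_prod us fun u _ => htM u

end Limit

end IsWickSystem

end WickLimit

/-! ### Moments of operator norms from moments of traces -/

section NormMoments

open scoped Matrix.Norms.L2Operator

theorem HasAllMoments.norm {Ω E : Type*} [MeasurableSpace Ω] {μ : Measure Ω}
    [NormedAddCommGroup E] {f : Ω → E} (hf : HasAllMoments f μ) :
    HasAllMoments (fun ω => ‖f ω‖) μ := fun k => (hf k).norm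

theorem HasAllMoments.matrix {Ω : Type*} [MeasurableSpace Ω] {μ : Measure Ω} {n : ℕ}
    {X : Ω → Matrix (Fin n) (Fin n) ℂ} (hX : ∀ i j, HasAllMoments (fun ω => X ω i j) μ) :
    HasAllMoments X μ := by
  have h : X = fun ω => ∑ i, ∑ j, X ω i j • Matrix.single i j (1 : ℂ) := by
    funext ω
    conv_lhs => rw [Matrix.matrix_eq_sum_single (X ω)]
    simp [Matrix.smul_single]
  rw [h]
  refine HasAllMoments.sum _ fun i _ => HasAllMoments.sum _ fun j _ => fun k => ?_
  exact (ContinuousLinearMap.toSpanSingleton ℂ (Matrix.single i j (1 : ℂ))).comp_memLp' (hX i j k)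

/-- A sequence of real random variables whose moments are `O(√n)`. -/
def SqrtMoments {Ω : ℕ → Type*} [∀ n, MeasurableSpace (Ω n)] (μ : ∀ n, Measure (Ω n))
    (f : ∀ n, Ω n → ℝ) : Prop :=
  (∀ n, HasAllMoments (f n) (μ n)) ∧
    ∀ k : ℕ, ∃ C : ℝ, ∀ n ≠ 0, ∫ ω, |f n ω| ^ k ∂μ n ≤ C * √n

variable {Ω : ℕ → Type*} [∀ n, MeasurableSpace (Ω n)] {μ : ∀ n, Measure (Ω n)}
  [∀ n, IsProbabilityMeasure (μ n)]

namespace SqrtMoments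

variable {f g : ∀ n, Ω n → ℝ}

theorem integrable_abs_pow (hf : SqrtMoments μ f) (n k : ℕ) :
    Integrable (fun ω => |f n ω| ^ k) (μ n) := ((hf.1 n).norm.pow k).integrable

theorem add (hf : SqrtMoments μ f) (hg : SqrtMoments μ g) :
    SqrtMoments μ (fun n ω => f n ω + g n ω) := by
  refine ⟨fun n => (hf.1 n).add (hg.1 n), fun k => ?_⟩
  obtain ⟨C, hC⟩ := hf.2 k
  obtain ⟨C', hC'⟩ := hg.2 k
  refine ⟨2 ^ (k - 1) * (C + C'), fun n hn => ?_⟩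
  have hi := hf.integrable_abs_pow n k
  have hi' := hg.integrable_abs_pow n k
  calc _ ≤ ∫ ω, 2 ^ (k - 1) * (|f n ω| ^ k + |g n ω| ^ k) ∂μ n := by
        refine integral_mono (((hf.1 n).add (hg.1 n)).norm.pow k).integrable
          ((hi.add hi').const_mul _) fun ω => ?_
        exact (pow_le_pow_left₀ (abs_nonneg _) (abs_add_le _ _) k).trans
          (add_pow_le (abs_nonneg _) (abs_nonneg _) k)
    _ = 2 ^ (k - 1) * (∫ ω, |f n ω| ^ k ∂μ n + ∫ ω, |g n ω| ^ k ∂μ n) := by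
        rw [integral_const_mul, integral_add hi hi']
    _ ≤ 2 ^ (k - 1) * (C * √n + C' * √n) := by
        have := hC n hn
        have := hC' n hn
        gcongr
    _ = _ := by ring

theorem const_mul (hf : SqrtMoments μ f) (a : ℝ) : SqrtMoments μ (fun n ω => a * f n ω) := by
  refine ⟨fun n => (HasAllMoments.const a).mul (hf.1 n), fun k => ?_⟩
  obtain ⟨C, hC⟩ := hf.2 k
  refine ⟨|a| ^ k * C, fun n hn => ?_⟩
  simp only [abs_mul, mul_pow]
  rw [integral_const_mul, mul_assoc]
  have := hC n hn
  gcongr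

theorem const (a : ℝ) : SqrtMoments μ (fun _ _ => a) := by
  refine ⟨fun n => HasAllMoments.const a, fun k => ⟨|a| ^ k, fun n hn => ?_⟩⟩
  have : (1 : ℝ) ≤ √n := Real.one_le_sqrt.2 (by exact_mod_cast Nat.pos_of_ne_zero hn)
  simpa using le_mul_of_one_le_right (by positivity) this

theorem sum {ι : Type*} (s : Finset ι) {f : ι → ∀ n, Ω n → ℝ}
    (hf : ∀ i ∈ s, SqrtMoments μ (f i)) : SqrtMoments μ (fun n ω => ∑ i ∈ s, f i n ω) := by
  classical
  induction s using Finset.induction_on with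
  | empty => simpa using const 0
  | insert i s hi ih =>
    simp only [Finset.sum_insert hi]
    exact (hf i (by simp)).add (ih fun j hj => hf j (by simp [hj]))

end SqrtMoments

/-- If `t^k > s`, then `t^k s³ ≤ t^(4k) ≤ t^N`. -/
theorem pow_le_add_pow_div {t s : ℝ} {k N : ℕ} (hs : 1 ≤ s) (ht : 0 ≤ t) (hN : 4 * k ≤ N) :
    t ^ k ≤ s + t ^ N / s ^ 3 := by
  have hs' : 0 < s := by linarith
  by_cases h : t ^ k ≤ s
  · have : 0 ≤ t ^ N / s ^ 3 := by positivity
    linarith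
  · push Not at h
    have ht1 : 1 ≤ t := by
      by_contra hlt
      push Not at hlt
      have := pow_le_one₀ (n := k) ht hlt.le
      linarith
    have h1 : t ^ k * s ^ 3 ≤ t ^ N := by
      calc t ^ k * s ^ 3 ≤ t ^ k * (t ^ k) ^ 3 := by gcongr
        _ = t ^ (4 * k) := by ring
        _ ≤ t ^ N := pow_le_pow_right₀ ht1 hN
    have : t ^ k ≤ t ^ N / s ^ 3 := by rwa [le_div_iff₀ (by positivity)]
    linarith

/-- Bounded normalised traces of the powers of `X* X` control the moments of the operator norm. -/
theorem sqrtMoments_opNorm (X : ∀ n, Ω n → Matrix (Fin n) (Fin n) ℂ)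
    (hX : ∀ n i j, HasAllMoments (fun ω => X n ω i j) (μ n))
    (hbd : ∀ p : ℕ, ∃ C : ℝ, ∀ n,
      ‖meanTrace (μ n) (fun ω => (star (X n ω) * X n ω) ^ p)‖ ≤ C) :
    SqrtMoments μ (fun n ω => ‖X n ω‖) := by
  have hmat : ∀ n, HasAllMoments (X n) (μ n) := fun n => HasAllMoments.matrix (hX n)
  refine ⟨fun n => (hmat n).norm, fun k => ?_⟩
  -- This power of `X* X` controls `‖X‖^(4·2^k)`, and `4·2^k ≥ 4k` as required by
  -- `pow_le_add_pow_div`.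
  obtain ⟨C, hC⟩ := hbd (2 * 2 ^ k)
  refine ⟨1 + C, fun n hn => ?_⟩
  have hn0 : (0 : ℝ) < n := by exact_mod_cast Nat.pos_of_ne_zero hn
  have hs : (1 : ℝ) ≤ √n := Real.one_le_sqrt.2 (by exact_mod_cast Nat.pos_of_ne_zero hn)
  have hs0 : 0 < √(n : ℝ) := by linarith
  set T : Ω n → ℂ := fun ω => ((star (X n ω) * X n ω) ^ (2 * 2 ^ k)).trace with hT
  have hpow : ∀ p : ℕ, Integrable (fun ω => ‖X n ω‖ ^ p) (μ n) :=
    fun p => ((hmat n).norm.pow p).integrable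
  have hTint : Integrable T (μ n) := by
    refine ((hpow (4 * 2 ^ k)).const_mul n).mono' ?_ (ae_of_all _ fun ω => ?_)
    · have hc : Continuous fun M : Matrix (Fin n) (Fin n) ℂ =>
          ((star M * M) ^ (2 * 2 ^ k)).trace := by
        have h1 : Continuous fun M : Matrix (Fin n) (Fin n) ℂ => (star M * M) ^ (2 * 2 ^ k) := by
          fun_prop
        exact (LinearMap.continuous_of_finiteDimensional
          (Matrix.traceLinearMap (Fin n) ℂ ℂ)).comp h1
      exact hc.comp_aestronglyMeasurable (hmat n).integrable.aestronglyMeasurable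
    · refine (Matrix.norm_trace_le_opNorm _).trans ?_
      gcongr
      refine (norm_pow_le' _ (by positivity)).trans (le_of_eq ?_)
      rw [CStarRing.norm_star_mul_self, ← sq, ← pow_mul]
      congr 1
      ring
  have h1 : ∫ ω, ‖X n ω‖ ^ (4 * 2 ^ k) ∂μ n ≤ n * C := by
    calc _ ≤ ∫ ω, (T ω).re ∂μ n :=
          integral_mono (hpow _) hTint.re fun ω => Matrix.opNorm_pow_le_trace _ _
      _ = (∫ ω, T ω ∂μ n).re := integral_re hTint
      _ ≤ ‖∫ ω, T ω ∂μ n‖ := Complex.re_le_norm _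
      _ ≤ n * C := by
        have := hC n
        rw [meanTrace, norm_mul, norm_inv, Complex.norm_natCast, inv_mul_le_iff₀ hn0] at this
        exact this
  have hN : 4 * k ≤ 4 * 2 ^ k := Nat.mul_le_mul_left 4 Nat.lt_two_pow_self.le
  simp only [abs_norm]
  -- Taking `s = √n`, the high moment, at most `n C`, is divided by `n^(3/2)`, so only the leading
  -- `√n` matters.
  calc _ ≤ ∫ ω, √n + ‖X n ω‖ ^ (4 * 2 ^ k) / √n ^ 3 ∂μ n :=
        integral_mono (hpow k) ((integrable_const _).add ((hpow _).div_const _)) fun ω =>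
          pow_le_add_pow_div hs (norm_nonneg _) hN
    _ = √n + (∫ ω, ‖X n ω‖ ^ (4 * 2 ^ k) ∂μ n) / √n ^ 3 := by
        rw [integral_add (integrable_const _) ((hpow _).div_const _), integral_div]
        simp
    _ ≤ √n + (n * C) / √n ^ 3 := by gcongr
    _ = √n + C * (√n)⁻¹ := by
        congr 1
        have : (n : ℝ) = √n ^ 2 := (Real.sq_sqrt hn0.le).symm
        rw [div_eq_iff (by positivity)]
        field_simp
        rw [← this, mul_comm]
    _ ≤ √n + C * √n := by
        have hC0 : 0 ≤ C := (norm_nonneg _).trans (hC n)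
        have : (√(n : ℝ))⁻¹ ≤ √n := (inv_le_one_of_one_le₀ hs).trans hs
        gcongr
    _ = _ := by ring

end NormMoments

/-! ### Gaussian elliptic matrices as a Wick system -/

section GaussianWick

open MvPolynomial in
theorem MvPolynomial.derivation_eq_sum_pderiv {E : Type*} [Fintype E]
    (D : Derivation ℂ (MvPolynomial E ℂ) (MvPolynomial E ℂ)) (p : MvPolynomial E ℂ) :
    D p = ∑ f, D (X f) * pderiv f p := by
  classical
  induction p using MvPolynomial.induction_on with
  | C a => simp [derivation_C]
  | add p q hp hq => simp only [map_add, hp, hq, mul_add, Finset.sum_add_distrib]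
  | mul_X p e hp =>
    simp only [Derivation.leibniz, hp, smul_eq_mul, mul_add, Finset.sum_add_distrib,
      Finset.mul_sum]
    congr 1
    · simp [pderiv_X, Pi.single_apply, mul_comm]
    · refine Finset.sum_congr rfl fun f _ => ?_
      ring

variable {κ : Type*} [DecidableEq κ] {n : ℕ}

/-- The covariance of the entries of independent elliptic random matrices. -/
noncomputable def entryCov (ρ : κ → ℝ) (e f : κ × Fin n × Fin n) : ℝ :=
  if e.1 = f.1 then
    (if e.2 = f.2 then 1 else 0) + (if e.2 = f.2.swap then ρ e.1 else 0) -
      (if e.2 = f.2 ∧ e.2 = f.2.swap then ρ e.1 else 0)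
  else 0

/-- The joint law of the entries of independent Gaussian elliptic random matrices. -/
structure IsEllipticGaussian {Ω : Type*} [MeasurableSpace Ω] (μ : Measure Ω)
    (x : κ × Fin n × Fin n → Ω → ℝ) (ρ : κ → ℝ) : Prop where
  gaussian : HasGaussianLaw (fun ω e => x e ω) μ
  mean : ∀ e, ∫ ω, x e ω ∂μ = 0
  cov : ∀ e f, ∫ ω, x e ω * x f ω ∂μ = entryCov ρ e f

/-- The variable in position `(i, j)` of the matrix `τ`, transposed if `ε = true`. -/
def entryPos (b : κ × Bool) (i j : Fin n) : κ × Fin n × Fin n :=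
  (b.1, if b.2 then (j, i) else (i, j))

/-- The covariance of the scaled matrices and their transposes. -/
noncomputable def transposeCov (ρ : κ → ℝ) (r : Fin 3) (b b' : κ × Bool) : ℝ :=
  if b.1 = b'.1 then
    ![if b.2 = b'.2 then ρ b.1 else 1, if b.2 = b'.2 then 1 else ρ b.1, -ρ b.1] r
  else 0

theorem covMatrix_apply (R : Type*) [CommRing R] [Algebra ℂ R] (r : Fin 3) (i j k l : Fin n) :
    covMatrix R i j r k l = algebraMap ℂ R ((n : ℂ)⁻¹ * ![if i = l ∧ j = k then 1 else 0,
      if i = k ∧ j = l then 1 else 0, if (i = k ∧ j = l) ∧ i = l ∧ j = k then 1 else 0] r) := by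
  rw [covMatrix, Matrix.smul_apply, smul_eq_mul, map_mul]
  congr 1
  fin_cases r
  · change Matrix.single j i (1 : R) k l = algebraMap ℂ R (if i = l ∧ j = k then 1 else 0)
    rw [Matrix.single_apply, apply_ite (algebraMap ℂ R), map_one, map_zero]
    exact if_congr and_comm rfl rfl
  · change Matrix.single i j (1 : R) k l = algebraMap ℂ R (if i = k ∧ j = l then 1 else 0)
    rw [Matrix.single_apply, apply_ite (algebraMap ℂ R), map_one, map_zero]
  · change (if i = j then Matrix.single i i (1 : R) else 0) k l =
      algebraMap ℂ R (if (i = k ∧ j = l) ∧ i = l ∧ j = k then 1 else 0)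
    rw [apply_ite (algebraMap ℂ R), map_one, map_zero]
    by_cases h : i = j
    · rw [if_pos h, Matrix.single_apply]
      refine if_congr ?_ rfl rfl
      grind
    · have : ¬((i = k ∧ j = l) ∧ i = l ∧ j = k) := fun h' => h (h'.1.1.trans h'.2.2.symm)
      rw [if_neg h, if_neg this, Matrix.zero_apply]

/-- On the diagonal both the direct and the transposed pairing occur; the last term removes the
excess `ρ`, keeping the variance equal to one. -/
theorem entryCov_entryPos (ρ : κ → ℝ) (τ : κ) (ε ε' : Bool) (i j k l : Fin n) :
    entryCov ρ (entryPos (τ, ε) i j) (entryPos (τ, ε') k l) =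
      (if ε = ε' then 1 else ρ τ) * (if i = k ∧ j = l then 1 else 0) +
      (if ε = ε' then ρ τ else 1) * (if i = l ∧ j = k then 1 else 0) -
      ρ τ * (if (i = k ∧ j = l) ∧ i = l ∧ j = k then 1 else 0) := by
  have h : ∀ p q : Fin n × Fin n, entryCov ρ (τ, p) (τ, q) =
      (if p.1 = q.1 ∧ p.2 = q.2 then 1 else 0) +
      (if p.1 = q.2 ∧ p.2 = q.1 then ρ τ else 0) -
      (if (p.1 = q.1 ∧ p.2 = q.2) ∧ p.1 = q.2 ∧ p.2 = q.1 then ρ τ else 0) := by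
    intro p q
    simp only [entryCov, if_true, Prod.ext_iff, Prod.fst_swap, Prod.snd_swap]
  simp only [entryPos, h]
  cases ε <;> cases ε' <;> grind

theorem inv_mul_entryCov (ρ : κ → ℝ) (b b' : κ × Bool) (i j k l : Fin n) :
    ((n : ℂ)⁻¹ * (entryCov ρ (entryPos b i j) (entryPos b' k l) : ℝ)) =
      ∑ r, (transposeCov ρ r b b' : ℂ) * covMatrix ℂ i j r k l := by
  obtain ⟨τ, ε⟩ := b
  obtain ⟨τ', ε'⟩ := b'
  by_cases hτ : τ = τ'
  · subst hτ
    rw [entryCov_entryPos]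
    simp only [covMatrix_apply, Fin.sum_univ_three, transposeCov, if_true, Matrix.cons_val_zero,
      Matrix.cons_val_one, Matrix.cons_val, Algebra.algebraMap_self, RingHom.id_apply]
    push_cast
    simp only [apply_ite Complex.ofReal, Complex.ofReal_one, Complex.ofReal_zero]
    ring
  · simp [entryCov, entryPos, transposeCov, hτ]

variable [Fintype κ]

/-- The covariance of linear combinations of the scaled matrices and their transposes. -/
noncomputable def letterCov {X : Type*} (ρ : κ → ℝ) (v : X → κ × Bool → ℂ) (r : Fin 3) (a a' : X) :
    ℂ :=
  ∑ b, ∑ b', v a b * v a' b' * transposeCov ρ r b b'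

/-- Linear combinations of the generic scaled matrices and their transposes, together with constant
matrices. -/
noncomputable def letterMatrix {X Y : Type*} (v : X → κ × Bool → ℂ)
    (D : Y → Matrix (Fin n) (Fin n) ℂ) :
    X ⊕ Y → Matrix (Fin n) (Fin n) (MvPolynomial (κ × Fin n × Fin n) ℂ) :=
  Sum.elim (fun a => Matrix.of fun i j =>
    ∑ b, MvPolynomial.C (v a b * ((√(n : ℝ))⁻¹ : ℝ)) * MvPolynomial.X (entryPos b i j))
    fun y => (D y).map MvPolynomial.C

/-- The derivation occurring in the integration by parts formula for `letterMatrix`. -/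
noncomputable def letterDer {X : Type*} (ρ : κ → ℝ) (v : X → κ × Bool → ℂ) (a : X) (i j : Fin n) :
    Derivation ℂ (MvPolynomial (κ × Fin n × Fin n) ℂ) (MvPolynomial (κ × Fin n × Fin n) ℂ) :=
  MvPolynomial.mkDerivation ℂ fun f =>
    MvPolynomial.C (∑ b, v a b * ((√(n : ℝ))⁻¹ : ℝ) * (entryCov ρ (entryPos b i j) f : ℝ))

theorem letterDer_letterMatrix {X Y : Type*} (ρ : κ → ℝ) (v : X → κ × Bool → ℂ)
    (D : Y → Matrix (Fin n) (Fin n) ℂ) (a : X) (i j : Fin n) (y : X ⊕ Y) :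
    (letterMatrix v D y).map (letterDer ρ v a i j) =
      ∑ r, covExt (letterCov ρ v r) a y • covMatrix (MvPolynomial (κ × Fin n × Fin n) ℂ) i j r := by
  -- The two factors `n^{-1/2}`, from the letter differentiated and from the direction of
  -- differentiation, make up the `n⁻¹` in the covariance.
  have hs : (((√(n : ℝ))⁻¹ : ℝ) : ℂ) * (((√(n : ℝ))⁻¹ : ℝ) : ℂ) = (n : ℂ)⁻¹ := by
    rw [← Complex.ofReal_mul, ← mul_inv, Real.mul_self_sqrt (Nat.cast_nonneg n)]
    simp
  ext1 k l
  rcases y with a' | y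
  · have h0 : ∀ (t : ℂ) f, letterDer ρ v a i j (MvPolynomial.C t * MvPolynomial.X f) =
        MvPolynomial.C (t * ∑ b, v a b * ((√(n : ℝ))⁻¹ : ℝ) * (entryCov ρ (entryPos b i j) f : ℝ)) := by
      intro t f
      rw [← MvPolynomial.smul_eq_C_mul, Derivation.map_smul, letterDer,
        MvPolynomial.mkDerivation_X, MvPolynomial.smul_eq_C_mul, ← map_mul]
    simp only [letterMatrix, Sum.elim_inl, Matrix.map_apply, Matrix.of_apply]
    rw [map_sum]
    simp only [h0, covExt, Sum.elim_inl, Matrix.sum_apply, Matrix.smul_apply,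
      covMatrix_apply (MvPolynomial _ _)]
    simp only [MvPolynomial.smul_eq_C_mul, MvPolynomial.algebraMap_eq,
      ← map_mul, ← map_sum]
    congr 1
    have h1 : ∀ b b', v a' b' * (((√(n : ℝ))⁻¹ : ℝ) : ℂ) * (v a b * (((√(n : ℝ))⁻¹ : ℝ) : ℂ) *
        (entryCov ρ (entryPos b i j) (entryPos b' k l) : ℝ)) =
        ∑ r, v a b * v a' b' * transposeCov ρ r b b' * covMatrix ℂ i j r k l := by
      intro b b'
      simp only [mul_assoc, ← Finset.mul_sum]
      rw [← inv_mul_entryCov, ← hs]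
      ring
    have h2 : ∀ r, ((n : ℂ)⁻¹ * ![if i = l ∧ j = k then 1 else 0,
      if i = k ∧ j = l then 1 else 0, if (i = k ∧ j = l) ∧ i = l ∧ j = k then 1 else 0] r) =
        covMatrix ℂ i j r k l := fun r => (covMatrix_apply ℂ r i j k l).symm
    simp only [h2]
    simp only [Finset.mul_sum, h1, letterCov, Finset.sum_mul]
    rw [Finset.sum_comm]
    conv_rhs => rw [Finset.sum_comm]
    refine Finset.sum_congr rfl fun b _ => ?_
    rw [Finset.sum_comm]
  · simp [letterMatrix, covExt, MvPolynomial.derivation_C]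

theorem IsEllipticGaussian.isWickSystem {Ω X Y : Type*} [MeasurableSpace Ω] {μ : Measure Ω}
    [IsProbabilityMeasure μ] {x : κ × Fin n × Fin n → Ω → ℝ} {ρ : κ → ℝ}
    (h : IsEllipticGaussian μ x ρ) (v : X → κ × Bool → ℂ) (D : Y → Matrix (Fin n) (Fin n) ℂ) :
    IsWickSystem μ (fun e ω => (x e ω : ℂ)) (letterCov ρ v) (letterMatrix v D) (letterDer ρ v) := by
  have hint : ∀ p : MvPolynomial (κ × Fin n × Fin n) ℂ,
      Integrable (fun ω => MvPolynomial.eval (fun e => (x e ω : ℂ)) p) μ := fun p =>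
    (HasAllMoments.mvPolynomial_eval (fun e =>
      HasAllMoments.ofReal fun k => (h.gaussian.eval e).memLp (by simp)) p).integrable
  refine ⟨hint, fun a i j p => ?_, letterDer_letterMatrix ρ v D⟩
  have hvar : ∀ e, ∫ ω, x e ω ^ 2 ∂μ = 1 := by
    intro e
    simp only [sq]
    rw [h.cov, entryCov, if_pos rfl, if_pos rfl]
    by_cases he : e.2 = e.2.swap
    · rw [if_pos he, if_pos ⟨rfl, he⟩]
      ring
    · rw [if_neg he, if_neg fun h => he h.2]
      ring
  have hibp : ∀ e, ∫ ω, MvPolynomial.eval (fun e => (x e ω : ℂ)) (MvPolynomial.X e * p) ∂μ =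
      ∑ f, (entryCov ρ e f : ℂ) *
        ∫ ω, MvPolynomial.eval (fun e => (x e ω : ℂ)) (MvPolynomial.pderiv f p) ∂μ := by
    intro e
    have := HasGaussianLaw.integral_mul_eval x h.gaussian h.mean e (hvar e) p
    simp only [map_mul, MvPolynomial.eval_X]
    rw [this]
    simp only [h.cov]
  have e1 : ∀ ω, MvPolynomial.eval (fun e => (x e ω : ℂ)) (letterMatrix v D (Sum.inl a) i j * p) =
      ∑ b, v a b * ((√(n : ℝ))⁻¹ : ℝ) *
        MvPolynomial.eval (fun e => (x e ω : ℂ)) (MvPolynomial.X (entryPos b i j) * p) := by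
    intro ω
    simp [letterMatrix, Finset.sum_mul, mul_assoc]
  have e2 : ∀ ω, MvPolynomial.eval (fun e => (x e ω : ℂ)) (letterDer ρ v a i j p) =
      ∑ f, (∑ b, v a b * ((√(n : ℝ))⁻¹ : ℝ) * (entryCov ρ (entryPos b i j) f : ℝ)) *
        MvPolynomial.eval (fun e => (x e ω : ℂ)) (MvPolynomial.pderiv f p) := by
    intro ω
    rw [MvPolynomial.derivation_eq_sum_pderiv]
    simp [letterDer, MvPolynomial.mkDerivation_X]
  simp only [e1, e2]
  rw [integral_finsetSum _ fun b _ => (hint _).const_mul _,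
    integral_finsetSum _ fun f _ => (hint _).const_mul _]
  simp only [integral_const_mul, hibp]
  simp only [Finset.mul_sum, Finset.sum_mul]
  rw [Finset.sum_comm]
  simp only [mul_assoc]

end GaussianWick

/-! ### Entries of independent elliptic matrices -/

section EllipticFamily

variable {κ : Type*}

/-- The position of an entry up to transposition. -/
def entryClass {n : ℕ} (e : κ × Fin n × Fin n) : κ × {p : Fin n × Fin n // p.1 ≤ p.2} :=
  (e.1, if h : e.2.1 ≤ e.2.2 then ⟨e.2, h⟩ else ⟨e.2.swap, (not_le.1 h).le⟩)

theorem entryClass_of_le {n : ℕ} {e : κ × Fin n × Fin n} (h : e.2.1 ≤ e.2.2) :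
    entryClass e = (e.1, ⟨e.2, h⟩) := by simp [entryClass, h]

theorem entryClass_of_not_le {n : ℕ} {e : κ × Fin n × Fin n} (h : ¬ e.2.1 ≤ e.2.2) :
    entryClass e = (e.1, ⟨e.2.swap, (not_le.1 h).le⟩) := by simp [entryClass, h]

theorem sym2_entryClass {n : ℕ} (e : κ × Fin n × Fin n) :
    s((entryClass e).2.1.1, (entryClass e).2.1.2) = s(e.2.1, e.2.2) := by
  by_cases h : e.2.1 ≤ e.2.2
  · rw [entryClass_of_le h]
  · rw [entryClass_of_not_le h]
    exact Sym2.eq_swap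

theorem entryClass_swap {n : ℕ} (τ : κ) (p : Fin n × Fin n) :
    entryClass (τ, p.swap) = entryClass (τ, p) := by
  obtain ⟨i, j⟩ := p
  rcases lt_trichotomy i j with hij | rfl | hij
  · rw [entryClass_of_not_le (by simpa using hij), entryClass_of_le (by simpa using hij.le)]
    rfl
  · rfl
  · rw [entryClass_of_not_le (e := (τ, i, j)) (by simpa using hij),
      entryClass_of_le (by simpa using hij.le)]

theorem entryCov_eq_zero [DecidableEq κ] {n : ℕ} (ρ : κ → ℝ) {e f : κ × Fin n × Fin n}
    (h : entryClass e ≠ entryClass f) : entryCov ρ e f = 0 := by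
  rw [entryCov]
  by_cases h1 : e.1 = f.1
  · have h2 : e.2 ≠ f.2 := fun h2 => h (by rw [Prod.ext h1 h2])
    have h3 : e.2 ≠ f.2.swap := fun h3 => h <| by
      have : e = (f.1, f.2.swap) := Prod.ext h1 h3
      rw [this, entryClass_swap]
    simp [h2, h3]
  · rw [if_neg h1]

variable {Ω : ℕ → Type*} [∀ n, MeasurableSpace (Ω n)]

/-- The entries of independent elliptic random matrices. -/
structure IsEllipticFamily [DecidableEq κ] (μ : ∀ n, Measure (Ω n))
    (x : ∀ n, κ × Fin n × Fin n → Ω n → ℝ)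
    (ρ : κ → ℝ) : Prop where
  measurable : ∀ n e, Measurable (x n e)
  indep : ∀ n, iIndepFun (fun (c : κ × {p : Fin n × Fin n // p.1 ≤ p.2}) ω =>
    (x n (c.1, c.2.1) ω, x n (c.1, c.2.1.swap) ω)) (μ n)
  mean : ∀ n e, ∫ ω, x n e ω ∂μ n = 0
  cov : ∀ n e f, ∫ ω, x n e ω * x n f ω ∂μ n = entryCov ρ e f
  moments : ∀ k : ℕ, ∃ C : ℝ, ∀ n e,
    Integrable (fun ω => |x n e ω| ^ k) (μ n) ∧ ∫ ω, |x n e ω| ^ k ∂μ n ≤ C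

theorem prod_abs_le_one_add_sum {k : ℕ} (y : Fin k → ℝ) :
    ∏ t, |y t| ≤ 1 + ∑ t, |y t| ^ k := by
  rcases isEmpty_or_nonempty (Fin k) with h | h
  · simp
  obtain ⟨s, -, hs⟩ := Finset.exists_max_image Finset.univ (fun t => |y t|) Finset.univ_nonempty
  calc ∏ t, |y t| ≤ ∏ _t : Fin k, |y s| :=
        Finset.prod_le_prod (fun _ _ => abs_nonneg _) fun t _ => hs t (Finset.mem_univ t)
    _ = |y s| ^ k := by simp
    _ ≤ ∑ t, |y t| ^ k :=
        Finset.single_le_sum (f := fun t => |y t| ^ k) (fun t _ => by positivity)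
          (Finset.mem_univ s)
    _ ≤ _ := by linarith

/-- Factorisation of the expectation of a product over the classes of independent entries. -/
theorem integral_prod_eq_prod_class [Fintype κ] [DecidableEq κ] {Ω : Type*} [MeasurableSpace Ω]
    {μ : Measure Ω} {n k : ℕ}
    {x : κ × Fin n × Fin n → Ω → ℝ} (hm : ∀ e, Measurable (x e))
    (hi : iIndepFun (fun (c : κ × {p : Fin n × Fin n // p.1 ≤ p.2}) ω =>
      (x (c.1, c.2.1) ω, x (c.1, c.2.1.swap) ω)) μ) (e : Fin k → κ × Fin n × Fin n) :
    ∫ ω, ∏ t, x (e t) ω ∂μ =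
      ∏ c, ∫ ω, ∏ t with entryClass (e t) = c, x (e t) ω ∂μ := by
  have hf : ∀ c : κ × {p : Fin n × Fin n // p.1 ≤ p.2}, Measurable fun ab : ℝ × ℝ =>
      ∏ t with entryClass (e t) = c, if (e t).2.1 ≤ (e t).2.2 then ab.1 else ab.2 := by
    intro c
    refine Finset.measurable_fun_prod _ fun t _ => ?_
    split_ifs
    · exact measurable_fst
    · exact measurable_snd
  have hfx : ∀ c ω, (∏ t with entryClass (e t) = c, if (e t).2.1 ≤ (e t).2.2 then
      x (c.1, c.2.1) ω else x (c.1, c.2.1.swap) ω) =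
      ∏ t with entryClass (e t) = c, x (e t) ω := by
    intro c ω
    refine Finset.prod_congr rfl fun t ht => ?_
    rw [Finset.mem_filter] at ht
    rw [← ht.2]
    split_ifs with h
    · rw [entryClass_of_le h]
    · rw [entryClass_of_not_le h]
      simp
  have h1 := (hi.comp _ hf).integral_fun_prod_eq_prod_integral fun c =>
    ((hf c).comp ((hm _).prodMk (hm _))).aestronglyMeasurable
  simp only [Function.comp_def, hfx] at h1
  rw [← h1]
  refine integral_congr_ae (ae_of_all _ fun ω => ?_)
  exact (Finset.prod_fiberwise Finset.univ (fun t => entryClass (e t)) fun t => x (e t) ω).symm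

namespace IsEllipticFamily

variable [DecidableEq κ] {μ : ∀ n, Measure (Ω n)}
  {x : ∀ n, κ × Fin n × Fin n → Ω n → ℝ} {ρ : κ → ℝ}

/-- A product of `k` numbers is bounded by one plus the sum of their `k`-th powers, so the uniform
`k`-th moments suffice. -/
theorem exists_bound [∀ n, IsProbabilityMeasure (μ n)] (h : IsEllipticFamily μ x ρ) (k : ℕ) :
    ∃ C : ℝ, 0 ≤ C ∧ ∀ n (e : Fin k → κ × Fin n × Fin n),
      Integrable (fun ω => ∏ t, x n (e t) ω) (μ n) ∧ |∫ ω, ∏ t, x n (e t) ω ∂μ n| ≤ C := by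
  obtain ⟨C, hC⟩ := h.moments k
  refine ⟨1 + k * |C|, by positivity, fun n e => ?_⟩
  have hint : Integrable (fun ω => 1 + ∑ t, |x n (e t) ω| ^ k) (μ n) :=
    (integrable_const _).add (integrable_finsetSum _ fun t _ => (hC n (e t)).1)
  have hle : ∀ ω, ‖∏ t, x n (e t) ω‖ ≤ 1 + ∑ t, |x n (e t) ω| ^ k := by
    intro ω
    rw [Real.norm_eq_abs, Finset.abs_prod]
    exact prod_abs_le_one_add_sum _
  refine ⟨hint.mono' (Finset.measurable_fun_prod _ fun t _ =>
    h.measurable n (e t)).aestronglyMeasurable (ae_of_all _ hle), ?_⟩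
  refine (norm_integral_le_of_norm_le hint (ae_of_all _ hle)).trans ?_
  rw [integral_add (integrable_const _) (integrable_finsetSum _ fun t _ => (hC n (e t)).1),
    integral_finsetSum _ fun t _ => (hC n (e t)).1]
  have : ∑ t, ∫ ω, |x n (e t) ω| ^ k ∂μ n ≤ ∑ _t : Fin k, |C| :=
    Finset.sum_le_sum fun t _ => (hC n (e t)).2.trans (le_abs_self C)
  simpa using this

theorem integral_prod_eq_zero [Fintype κ] (h : IsEllipticFamily μ x ρ) {n k : ℕ}
    (e : Fin k → κ × Fin n × Fin n) (c : κ × {p : Fin n × Fin n // p.1 ≤ p.2})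
    (hc : (Finset.univ.filter fun t => entryClass (e t) = c).card = 1) :
    ∫ ω, ∏ t, x n (e t) ω ∂μ n = 0 := by
  rw [integral_prod_eq_prod_class (h.measurable n) (h.indep n)]
  refine Finset.prod_eq_zero (Finset.mem_univ c) ?_
  obtain ⟨t, ht⟩ := Finset.card_eq_one.1 hc
  simp only [ht, Finset.prod_singleton, h.mean]

/-- After factorisation over independent classes, each factor is a total mass, a mean or a
covariance, and these coincide in the two families. -/
theorem integral_prod_eq_of_card_le_two [∀ n, IsProbabilityMeasure (μ n)] [Fintype κ]
    {Ω' : ℕ → Type*} [∀ n, MeasurableSpace (Ω' n)]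
    {μ' : ∀ n, Measure (Ω' n)} [∀ n, IsProbabilityMeasure (μ' n)]
    {x' : ∀ n, κ × Fin n × Fin n → Ω' n → ℝ} (h : IsEllipticFamily μ x ρ)
    (h' : IsEllipticFamily μ' x' ρ) {n k : ℕ} (e : Fin k → κ × Fin n × Fin n)
    (hc : ∀ c, (Finset.univ.filter fun t => entryClass (e t) = c).card ≤ 2) :
    ∫ ω, ∏ t, x n (e t) ω ∂μ n = ∫ ω, ∏ t, x' n (e t) ω ∂μ' n := by
  rw [integral_prod_eq_prod_class (h.measurable n) (h.indep n),
    integral_prod_eq_prod_class (h'.measurable n) (h'.indep n)]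
  refine Finset.prod_congr rfl fun c _ => ?_
  have := hc c
  interval_cases hcard : (Finset.univ.filter fun t => entryClass (e t) = c).card
  · rw [Finset.card_eq_zero] at hcard
    simp [hcard]
  · obtain ⟨t, ht⟩ := Finset.card_eq_one.1 hcard
    simp only [ht, Finset.prod_singleton, h.mean, h'.mean]
  · obtain ⟨s, t, hst, ht⟩ := Finset.card_eq_two.1 hcard
    simp only [ht, Finset.prod_pair hst, h.cov, h'.cov]

end IsEllipticFamily

end EllipticFamily

/-! ### Counting walks by their vertices -/

section WalkCounting

theorem Matrix.ofFn_prod_apply {R : Type*} [CommSemiring R] {n k : ℕ}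
    (M : Fin k → Matrix (Fin n) (Fin n) R) (i j : Fin n) :
    (List.ofFn M).prod i j = ∑ v : Fin (k + 1) → Fin n,
      if v 0 = i ∧ v (Fin.last k) = j then ∏ t, M t (v t.castSucc) (v t.succ) else 0 := by
  induction k generalizing i with
  | zero =>
    rw [List.ofFn_zero, List.prod_nil, Matrix.one_apply,
      ← Equiv.sum_comp (Equiv.funUnique (Fin 1) (Fin n)).symm]
    simp only [Equiv.funUnique_symm_apply, uniqueElim_const, Finset.univ_eq_empty,
      Finset.prod_empty, ite_and, Finset.sum_ite_eq', Finset.mem_univ, if_true]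
  | succ k ih =>
    rw [List.ofFn_succ, List.prod_cons, Matrix.mul_apply,
      ← Equiv.sum_comp (Fin.consEquiv fun _ : Fin (k + 2) => Fin n), Fintype.sum_prod_type]
    have h1 : ∀ (a : Fin n) (v : Fin (k + 1) → Fin n),
        (if (Fin.consEquiv fun _ : Fin (k + 2) => Fin n) (a, v) 0 = i ∧
          (Fin.consEquiv fun _ : Fin (k + 2) => Fin n) (a, v) (Fin.last (k + 1)) = j then
          ∏ t, M t ((Fin.consEquiv fun _ : Fin (k + 2) => Fin n) (a, v) t.castSucc)
            ((Fin.consEquiv fun _ : Fin (k + 2) => Fin n) (a, v) t.succ) else 0) =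
        if a = i then (if v (Fin.last k) = j then
          M 0 i (v 0) * ∏ t : Fin k, M t.succ (v t.castSucc) (v t.succ) else 0) else 0 := by
      intro a v
      have h2 : Fin.last (k + 1) = (Fin.last k).succ := rfl
      simp only [Fin.consEquiv_apply, Fin.cons_zero, h2, Fin.cons_succ, ite_and]
      split_ifs with ha hb
      · rw [Fin.prod_univ_succ]
        simp [ha]
      · rfl
      · rfl
    simp only [h1, Finset.sum_ite_irrel, Finset.sum_const_zero, Finset.sum_ite_eq',
      Finset.mem_univ, if_true]
    simp only [ih, Finset.mul_sum]
    rw [Finset.sum_comm]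
    refine Finset.sum_congr rfl fun v _ => ?_
    rw [Finset.sum_eq_single (v 0)]
    · simp
    · intro b _ hb
      simp [hb.symm]
    · simp

/-- A connected graph has at most one vertex more than edges: a step of the walk to a new vertex
uses a new edge. -/
theorem card_image_le_card_edges {V : Type*} [DecidableEq V] {k : ℕ} (v : Fin (k + 1) → V) :
    (Finset.univ.image v).card ≤
      (Finset.univ.image fun t : Fin k => s(v t.castSucc, v t.succ)).card + 1 := by
  induction k with
  | zero => exact (Finset.card_image_le).trans (by simp)
  | succ k ih =>
    have h1 : Finset.univ.image v =
        insert (v (Fin.last _)) (Finset.univ.image fun t : Fin (k + 1) => v t.castSucc) := by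
      ext a
      simp only [Finset.mem_image, Finset.mem_univ, true_and, Finset.mem_insert,
        Fin.exists_fin_succ']
      tauto
    have h2 : (Finset.univ.image fun t : Fin (k + 1) => s(v t.castSucc, v t.succ)) =
        insert s(v (Fin.last k).castSucc, v (Fin.last _))
          (Finset.univ.image fun t : Fin k => s(v t.castSucc.castSucc, v t.succ.castSucc)) := by
      ext a
      simp only [Finset.mem_image, Finset.mem_univ, true_and, Finset.mem_insert,
        Fin.exists_fin_succ', Fin.succ_castSucc, Fin.succ_last]
      tauto
    have h3 := ih fun t => v t.castSucc
    by_cases hmem : v (Fin.last (k + 1)) ∈ Finset.univ.image fun t : Fin (k + 1) => v t.castSucc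
    · rw [h1, Finset.insert_eq_of_mem hmem, h2]
      exact h3.trans (Nat.add_le_add_right (Finset.card_le_card (Finset.subset_insert _ _)) 1)
    · have hmem' : s(v (Fin.last k).castSucc, v (Fin.last _)) ∉
          Finset.univ.image fun t : Fin k => s(v t.castSucc.castSucc, v t.succ.castSucc) := by
        intro hm
        obtain ⟨t, -, ht⟩ := Finset.mem_image.1 hm
        refine hmem (Finset.mem_image.2 ?_)
        rcases Sym2.eq_iff.1 ht with h | h
        · exact ⟨t.succ, Finset.mem_univ _, h.2⟩
        · exact ⟨t.castSucc, Finset.mem_univ _, h.1⟩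
      rw [h1, h2, Finset.card_insert_of_notMem hmem, Finset.card_insert_of_notMem hmem']
      exact Nat.add_le_add_right h3 1

/-- A map with at most `r` values factors through `Fin r`. -/
theorem card_filter_image_le {n : ℕ} (k r : ℕ) (hn : n ≠ 0) :
    (Finset.univ.filter fun v : Fin k → Fin n => (Finset.univ.image v).card ≤ r).card ≤
      r ^ k * n ^ r := by
  have h1 : (Finset.univ.filter fun v : Fin k → Fin n => (Finset.univ.image v).card ≤ r) ⊆
      Finset.univ.image fun q : (Fin k → Fin r) × (Fin r → Fin n) => q.2 ∘ q.1 := by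
    intro v hv
    have hv' := (Finset.mem_filter.1 hv).2
    set s := Finset.univ.image v with hs
    have hmem : ∀ t, v t ∈ s := fun t => Finset.mem_image_of_mem v (Finset.mem_univ t)
    refine Finset.mem_image.2 ⟨⟨fun t => Fin.castLE hv' (s.equivFin ⟨v t, hmem t⟩), fun i =>
      if h : (i : ℕ) < s.card then s.equivFin.symm ⟨i, h⟩ else ⟨0, Nat.pos_of_ne_zero hn⟩⟩,
      Finset.mem_univ _, ?_⟩
    funext t
    simp
  refine (Finset.card_le_card h1).trans (Finset.card_image_le.trans (le_of_eq ?_))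
  simp

theorem norm_sum_le_of_image_card {n k s : ℕ} (f : (Fin k → Fin n) → ℂ) {B : ℝ} (hB : 0 ≤ B)
    (hf : ∀ v, ‖f v‖ ≤ B) (hs : ∀ v, f v ≠ 0 → 2 * (Finset.univ.image v).card ≤ s) (hn : n ≠ 0) :
    ‖∑ v, f v‖ ≤ B * s ^ k * √n ^ s := by
  have hn1 : (1 : ℝ) ≤ √n := Real.one_le_sqrt.2 (by exact_mod_cast Nat.pos_of_ne_zero hn)
  set r := s / 2 with hr
  set S := Finset.univ.filter fun v : Fin k → Fin n => (Finset.univ.image v).card ≤ r with hS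
  have h1 : ∑ v, f v = ∑ v ∈ S, f v := by
    refine (Finset.sum_subset (Finset.subset_univ _) fun v _ hv => ?_).symm
    by_contra h
    refine hv (Finset.mem_filter.2 ⟨Finset.mem_univ _, ?_⟩)
    have := hs v h
    omega
  have h2 : (S.card : ℝ) ≤ r ^ k * (n : ℝ) ^ r := by
    exact_mod_cast card_filter_image_le k r hn
  have h3 : (n : ℝ) ^ r ≤ √n ^ s := by
    calc (n : ℝ) ^ r = √n ^ (2 * r) := by rw [pow_mul, Real.sq_sqrt (Nat.cast_nonneg n)]
      _ ≤ √n ^ s := pow_le_pow_right₀ hn1 (by omega)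
  have h4 : (r : ℝ) ≤ s := by exact_mod_cast Nat.div_le_self s 2
  calc ‖∑ v, f v‖ ≤ ∑ _v ∈ S, B := by
        rw [h1]
        exact norm_sum_le_of_le _ fun v _ => hf v
    _ = S.card * B := by simp
    _ ≤ (r ^ k * (n : ℝ) ^ r) * B := by gcongr
    _ ≤ (s ^ k * √n ^ s) * B := by gcongr
    _ = _ := by ring

end WalkCounting

/-! ### The trace of a word as a sum over closed walks -/

section WordTrace

variable {κ : Type*}

/-- The scaled matrix `τ` of the family `x`, transposed if `ε = true`. -/
noncomputable def familyMatrix {Ω : Type*} {n : ℕ} (x : κ × Fin n × Fin n → Ω → ℝ) (b : κ × Bool) :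
    Ω → Matrix (Fin n) (Fin n) ℂ :=
  fun ω => Matrix.of fun i j => (((√(n : ℝ))⁻¹ * x (entryPos b i j) ω : ℝ) : ℂ)

/-- The contribution of the closed walk `v` to the expected trace of the word `W`. -/
noncomputable def walkTerm {Ω : Type*} [MeasurableSpace Ω] (μ : Measure Ω) {n : ℕ}
    (x : κ × Fin n × Fin n → Ω → ℝ) (W : List (κ × Bool)) (v : Fin (W.length + 1) → Fin n) : ℂ :=
  if v 0 = v (Fin.last _) then
    ((∫ ω, ∏ t, x (entryPos (W.get t) (v t.castSucc) (v t.succ)) ω ∂μ : ℝ) : ℂ) else 0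

theorem meanTrace_familyMatrix {Ω : Type*} [MeasurableSpace Ω] {μ : Measure Ω} {n : ℕ}
    {x : κ × Fin n × Fin n → Ω → ℝ} (W : List (κ × Bool))
    (hint : ∀ e : Fin W.length → κ × Fin n × Fin n, Integrable (fun ω => ∏ t, x (e t) ω) μ) :
    meanTrace μ (fun ω => (W.map fun b => familyMatrix x b ω).prod) =
      ((((√(n : ℝ))⁻¹ : ℝ) : ℂ) ^ (W.length + 2)) * ∑ v, walkTerm μ x W v := by
  have h1 : ∀ ω, ((W.map fun b => familyMatrix x b ω).prod).trace =
      ∑ v : Fin (W.length + 1) → Fin n, if v 0 = v (Fin.last _) then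
        (((√(n : ℝ))⁻¹ : ℝ) : ℂ) ^ W.length *
          ((∏ t, x (entryPos (W.get t) (v t.castSucc) (v t.succ)) ω : ℝ) : ℂ) else 0 := by
    intro ω
    have h2 : (W.map fun b => familyMatrix x b ω) =
        List.ofFn fun t => familyMatrix x (W.get t) ω := by
      conv_lhs => rw [← List.ofFn_get W, List.map_ofFn]
      rfl
    rw [h2, Matrix.trace]
    simp only [Matrix.diag_apply, Matrix.ofFn_prod_apply]
    rw [Finset.sum_comm]
    refine Finset.sum_congr rfl fun v _ => ?_
    simp only [ite_and, Finset.sum_ite_eq, Finset.mem_univ, if_true]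
    by_cases hv : v 0 = v (Fin.last _)
    · rw [if_pos hv.symm, if_pos hv]
      simp [familyMatrix, Finset.prod_mul_distrib]
    · rw [if_neg (Ne.symm hv), if_neg hv]
  have h3 : (n : ℂ)⁻¹ = (((√(n : ℝ))⁻¹ : ℝ) : ℂ) ^ 2 := by
    rw [← Complex.ofReal_pow, inv_pow, Real.sq_sqrt (Nat.cast_nonneg n)]
    simp
  simp only [meanTrace, h1]
  rw [integral_finsetSum, h3, pow_add, mul_comm (_ ^ W.length), mul_assoc]
  · congr 1
    rw [Finset.mul_sum]
    refine Finset.sum_congr rfl fun v _ => ?_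
    rw [walkTerm]
    split_ifs
    · rw [integral_const_mul, integral_complex_ofReal]
    · simp
  · intro v _
    split_ifs
    · exact ((hint _).ofReal).const_mul _
    · exact integrable_zero _ _ _

end WordTrace

/-! ### Multiplicities of entry classes along a walk -/

section ClassCounting

theorem two_mul_card_image_le {k : ℕ} {T : Type*} [DecidableEq T] (f : Fin k → T)
    (h : ∀ c, (Finset.univ.filter fun t => f t = c).card ≠ 1) :
    2 * (Finset.univ.image f).card ≤ k := by
  have h2 : 2 * (Finset.univ.image f).card ≤ (Finset.univ : Finset (Fin k)).card := by
    refine Finset.mul_card_image_le_card _ _ fun c hc => ?_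
    obtain ⟨t, -, ht⟩ := Finset.mem_image.1 hc
    have h0 : 0 < (Finset.univ.filter fun t => f t = c).card :=
      Finset.card_pos.2 ⟨t, by simp [ht]⟩
    have := h c
    omega
  simpa using h2

theorem two_mul_card_image_lt {k : ℕ} {T : Type*} [DecidableEq T] (f : Fin k → T)
    (h : ∀ c, (Finset.univ.filter fun t => f t = c).card ≠ 1)
    (h' : ∃ c, 2 < (Finset.univ.filter fun t => f t = c).card) :
    2 * (Finset.univ.image f).card < k := by
  obtain ⟨c₀, hc₀⟩ := h'
  have h1 := Finset.card_eq_sum_card_image f Finset.univ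
  rw [Finset.card_univ, Fintype.card_fin] at h1
  rw [mul_comm, ← smul_eq_mul, ← Finset.sum_const]
  conv_rhs => rw [h1]
  refine Finset.sum_lt_sum (fun c hc => ?_) ⟨c₀, ?_, hc₀⟩
  · obtain ⟨t, -, ht⟩ := Finset.mem_image.1 hc
    have h0 : 0 < (Finset.univ.filter fun t => f t = c).card :=
      Finset.card_pos.2 ⟨t, by simp [ht]⟩
    have := h c
    omega
  · obtain ⟨t, ht⟩ := Finset.card_pos.1 (zero_lt_two.trans hc₀)
    exact Finset.mem_image.2 ⟨t, Finset.mem_univ _, (Finset.mem_filter.1 ht).2⟩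

/-- Forgetting the matrix index maps classes onto the undirected edges of the walk; transposed
letters do not change the edge. -/
theorem card_image_le_card_classes {κ : Type*} [DecidableEq κ] {n : ℕ} (W : List (κ × Bool))
    (v : Fin (W.length + 1) → Fin n) :
    (Finset.univ.image v).card ≤ (Finset.univ.image fun t =>
      entryClass (entryPos (W.get t) (v t.castSucc) (v t.succ))).card + 1 := by
  refine (card_image_le_card_edges v).trans (Nat.add_le_add_right ?_ 1)
  have h : (Finset.univ.image fun t : Fin W.length => s(v t.castSucc, v t.succ)) =
      (Finset.univ.image fun t => entryClass (entryPos (W.get t) (v t.castSucc) (v t.succ))).image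
        fun c => s(c.2.1.1, c.2.1.2) := by
    rw [Finset.image_image]
    refine Finset.image_congr fun t _ => ?_
    rw [Function.comp_apply, sym2_entryClass]
    cases hb : (W.get t).2
    · simp only [entryPos, hb, Bool.false_eq_true, if_false]
    · simp only [entryPos, hb, if_true]
      exact Sym2.eq_swap
  rw [h]
  exact Finset.card_image_le

end ClassCounting

/-! ### Boundedness and universality of traces -/

namespace IsEllipticFamily

variable {κ : Type*} [Fintype κ] [DecidableEq κ] {Ω : ℕ → Type*} [∀ n, MeasurableSpace (Ω n)]
  {μ : ∀ n, Measure (Ω n)} [∀ n, IsProbabilityMeasure (μ n)]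
  {x : ∀ n, κ × Fin n × Fin n → Ω n → ℝ} {ρ : κ → ℝ}

/-- The normalised traces of words in elliptic random matrices are bounded. -/
theorem exists_norm_meanTrace_le (h : IsEllipticFamily μ x ρ) (W : List (κ × Bool)) :
    ∃ C : ℝ, ∀ n,
      ‖meanTrace (μ n) (fun ω => (W.map fun b => familyMatrix (x n) b ω).prod)‖ ≤ C := by
  obtain ⟨B, hB0, hB⟩ := h.exists_bound W.length
  refine ⟨B * (W.length + 2 : ℕ) ^ (W.length + 1), fun n => ?_⟩
  rcases eq_or_ne n 0 with rfl | hn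
  · simp only [meanTrace, Nat.cast_zero, inv_zero, zero_mul, norm_zero]
    positivity
  have hn' : (0 : ℝ) < √n := Real.sqrt_pos.2 (by exact_mod_cast Nat.pos_of_ne_zero hn)
  rw [meanTrace_familyMatrix W fun e => (hB n e).1, norm_mul, norm_pow, Complex.norm_real,
    Real.norm_eq_abs, abs_of_pos (inv_pos.2 hn'), inv_pow, inv_mul_le_iff₀ (by positivity),
    mul_comm (√(n : ℝ) ^ _)]
  refine norm_sum_le_of_image_card _ hB0 (fun v => ?_) (fun v hv => ?_) hn
  · rw [walkTerm]
    split_ifs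
    · rw [Complex.norm_real]
      exact (hB n _).2
    · simpa using hB0
  · have h1 : ∀ c, (Finset.univ.filter fun t => entryClass
        (entryPos (W.get t) (v t.castSucc) (v t.succ)) = c).card ≠ 1 := by
      intro c hc
      refine hv ?_
      rw [walkTerm]
      split_ifs
      · rw [h.integral_prod_eq_zero _ c hc, Complex.ofReal_zero]
      · rfl
    -- Every class occurs at least twice, so twice the number of vertices is at most `W.length + 2`,
    -- which matches the normalisation exactly.
    have h2 := two_mul_card_image_le _ h1
    have h3 := card_image_le_card_classes W v
    omega

/-- The normalised traces of words in elliptic random matrices are universal. -/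
theorem tendsto_meanTrace_sub {Ω' : ℕ → Type*} [∀ n, MeasurableSpace (Ω' n)]
    {μ' : ∀ n, Measure (Ω' n)} [∀ n, IsProbabilityMeasure (μ' n)]
    {x' : ∀ n, κ × Fin n × Fin n → Ω' n → ℝ} (h : IsEllipticFamily μ x ρ)
    (h' : IsEllipticFamily μ' x' ρ) (W : List (κ × Bool)) :
    Tendsto (fun n => meanTrace (μ n) (fun ω => (W.map fun b => familyMatrix (x n) b ω).prod) -
      meanTrace (μ' n) (fun ω => (W.map fun b => familyMatrix (x' n) b ω).prod)) atTop (𝓝 0) := by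
  obtain ⟨B, hB0, hB⟩ := h.exists_bound W.length
  obtain ⟨B', hB0', hB'⟩ := h'.exists_bound W.length
  refine squeeze_zero_norm' (a := fun n : ℕ =>
    (B + B') * (W.length + 1 : ℕ) ^ (W.length + 1) * (√n)⁻¹) ?_ ?_
  · filter_upwards [eventually_ne_atTop 0] with n hn
    have hn' : (0 : ℝ) < √n := Real.sqrt_pos.2 (by exact_mod_cast Nat.pos_of_ne_zero hn)
    rw [meanTrace_familyMatrix W fun e => (hB n e).1, meanTrace_familyMatrix W fun e => (hB' n e).1,
      ← mul_sub, ← Finset.sum_sub_distrib, norm_mul, norm_pow, Complex.norm_real,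
      Real.norm_eq_abs, abs_of_pos (inv_pos.2 hn'), inv_pow, inv_mul_le_iff₀ (by positivity)]
    have key : ‖∑ v, (walkTerm (μ n) (x n) W v - walkTerm (μ' n) (x' n) W v)‖ ≤
        (B + B') * (W.length + 1 : ℕ) ^ (W.length + 1) * √n ^ (W.length + 1) := by
      refine norm_sum_le_of_image_card _ (by positivity) (fun v => ?_) (fun v hv => ?_) hn
      · rw [walkTerm, walkTerm]
        split_ifs
        · rw [← Complex.ofReal_sub, Complex.norm_real]
          exact (norm_sub_le _ _).trans (add_le_add (hB n _).2 (hB' n _).2)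
        · simp only [sub_self, norm_zero]
          positivity
      · have h1 : ∀ c, (Finset.univ.filter fun t => entryClass
            (entryPos (W.get t) (v t.castSucc) (v t.succ)) = c).card ≠ 1 := by
          intro c hc
          refine hv ?_
          rw [walkTerm, walkTerm]
          split_ifs
          · rw [h.integral_prod_eq_zero _ c hc, h'.integral_prod_eq_zero _ c hc, sub_self]
          · exact sub_self _
        have h2 : ∃ c, 2 < (Finset.univ.filter fun t => entryClass
            (entryPos (W.get t) (v t.castSucc) (v t.succ)) = c).card := by
          by_contra! hc
          refine hv ?_
          rw [walkTerm, walkTerm]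
          split_ifs
          · rw [h.integral_prod_eq_of_card_le_two h' _ hc, sub_self]
          · exact sub_self _
        -- A class of multiplicity at least three makes the inequality strict, and the number of
        -- walks drops by a factor `√n`.
        have h3 := two_mul_card_image_lt _ h1 h2
        have h4 := card_image_le_card_classes W v
        omega
    refine key.trans (le_of_eq ?_)
    rw [pow_succ (√(n : ℝ)) (W.length + 1)]
    field_simp
  · have h1 : Tendsto (fun n : ℕ => (√(n : ℝ))⁻¹) atTop (𝓝 0) :=
      tendsto_inv_atTop_zero.comp (Real.tendsto_sqrt_atTop.comp tendsto_natCast_atTop_atTop)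
    simpa using h1.const_mul ((B + B') * (W.length + 1 : ℕ) ^ (W.length + 1))

end IsEllipticFamily

/-! ### Convergence of words in Gaussian and deterministic matrices -/

section GaussianConvergence

open scoped Matrix.Norms.L2Operator

variable {κ : Type*}

theorem star_familyMatrix {Ω : Type*} {n : ℕ} (x : κ × Fin n × Fin n → Ω → ℝ) (b : κ × Bool)
    (ω : Ω) : star (familyMatrix x b ω) = familyMatrix x (b.1, !b.2) ω := by
  ext i j
  rw [Matrix.star_apply]
  simp only [familyMatrix, Matrix.of_apply]
  rw [RCLike.star_def, Complex.conj_ofReal]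
  cases h : b.2 <;> simp [entryPos, h]

theorem List.prod_map_flatten_replicate {L A : Type*} [Monoid A] (f : L → A) (y z : L) (p : ℕ) :
    (((List.replicate p [y, z]).flatten).map f).prod = (f y * f z) ^ p := by
  induction p with
  | zero => simp
  | succ p ih => rw [List.replicate_succ, List.flatten_cons, List.map_append, List.prod_append, ih,
      pow_succ']; simp

theorem meanTrace_const {Ω : Type*} [MeasurableSpace Ω] (μ : Measure Ω) [IsProbabilityMeasure μ]
    {n : ℕ} (P : Matrix (Fin n) (Fin n) ℂ) :
    meanTrace μ (fun _ => P) = (n : ℂ)⁻¹ * P.trace := by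
  simp [meanTrace]

variable {Ω : ℕ → Type*} [∀ n, MeasurableSpace (Ω n)]
  {μ : ∀ n, Measure (Ω n)}
  {x : ∀ n, κ × Fin n × Fin n → Ω n → ℝ} {ρ : κ → ℝ}

theorem IsEllipticFamily.isEllipticGaussian [DecidableEq κ] (h : IsEllipticFamily μ x ρ)
    (hG : ∀ n, HasGaussianLaw (fun ω e => x n e ω) (μ n)) (n : ℕ) :
    IsEllipticGaussian (μ n) (x n) ρ := ⟨hG n, h.mean n, h.cov n⟩

theorem eval_letterMatrix [Fintype κ] {Ω X Y : Type*} {n : ℕ} (x : κ × Fin n × Fin n → Ω → ℝ)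
    (v : X → κ × Bool → ℂ) (D : Y → Matrix (Fin n) (Fin n) ℂ) (ω : Ω) (y : X ⊕ Y) :
    (letterMatrix v D y).map (MvPolynomial.eval fun e => (x e ω : ℂ)) =
      Sum.elim (fun a => ∑ b, v a b • familyMatrix x b ω) D y := by
  rcases y with a | y
  · ext i j
    simp [letterMatrix, familyMatrix, Matrix.sum_apply, mul_assoc]
  · ext i j
    simp [letterMatrix]

theorem IsEllipticFamily.hasAllMoments [DecidableEq κ] (h : IsEllipticFamily μ x ρ) (n : ℕ)
    (e : κ × Fin n × Fin n) : HasAllMoments (x n e) (μ n) :=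
  HasAllMoments.of_integrable_abs_pow (h.measurable n e).aestronglyMeasurable fun k => by
    obtain ⟨C, hC⟩ := h.moments k
    exact (hC n e).1

variable [∀ n, IsProbabilityMeasure (μ n)]

theorem IsEllipticFamily.sqrtMoments [Fintype κ] [DecidableEq κ] (h : IsEllipticFamily μ x ρ)
    (b : κ × Bool) :
    SqrtMoments μ (fun n ω => ‖familyMatrix (x n) b ω‖) := by
  refine sqrtMoments_opNorm _ (fun n i j => ?_) fun p => ?_
  · exact ((HasAllMoments.const _).mul (h.hasAllMoments n _)).ofReal
  · obtain ⟨C, hC⟩ := h.exists_norm_meanTrace_le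
      (List.replicate p [(b.1, !b.2), b]).flatten
    refine ⟨C, fun n => ?_⟩
    have := hC n
    simp only [List.prod_map_flatten_replicate] at this
    simpa only [star_familyMatrix] using this

theorem sqrtMoments_deterministic {Y : Type*} (D : ∀ n, Y → Matrix (Fin n) (Fin n) ℂ)
    (t : List Y → ℂ)
    (hD : ∀ u : List Y, Tendsto (fun n : ℕ => (n : ℂ)⁻¹ * (u.map (D n)).prod.trace) atTop (𝓝 (t u)))
    (y y' : Y) (hy : ∀ n, D n y' = star (D n y)) :
    SqrtMoments μ (fun n _ => ‖D n y‖) := by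
  refine sqrtMoments_opNorm (fun n _ => D n y) (fun n i j => HasAllMoments.const _) fun p => ?_
  obtain ⟨C, hC⟩ := (Metric.isBounded_range_of_tendsto _
    (hD (List.replicate p [y', y]).flatten)).exists_norm_le
  refine ⟨C, fun n => ?_⟩
  have := hC _ ⟨n, rfl⟩
  simp only [List.prod_map_flatten_replicate, hy] at this
  rw [meanTrace_const]
  exact this

/-- Words in Gaussian elliptic random matrices and deterministic matrices converge to the solution
of the Schwinger-Dyson equations. -/
theorem tendsto_meanTrace_of_gaussian [Fintype κ] [DecidableEq κ] (h : IsEllipticFamily μ x ρ)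
    (hG : ∀ n, HasGaussianLaw (fun ω e => x n e ω) (μ n)) {X Y : Type*} [Fintype X] [Fintype Y]
    (v : X → κ × Bool → ℂ) (D : ∀ n, Y → Matrix (Fin n) (Fin n) ℂ)
    (hstar : ∀ y, ∃ y', ∀ n, D n y' = star (D n y)) (M : List (X ⊕ Y) → ℂ)
    (hM : SchwingerDyson (letterCov ρ v 0) M)
    (hD : ∀ u : List Y, Tendsto (fun n : ℕ => (n : ℂ)⁻¹ * (u.map (D n)).prod.trace) atTop
      (𝓝 (M (u.map Sum.inr)))) (W : List (X ⊕ Y)) :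
    (∀ n, Integrable (fun ω => ((W.map (Sum.elim (fun a => ∑ b, v a b • familyMatrix (x n) b ω)
      (D n))).prod).trace) (μ n)) ∧
    Tendsto (fun n => meanTrace (μ n) fun ω =>
      (W.map (Sum.elim (fun a => ∑ b, v a b • familyMatrix (x n) b ω) (D n))).prod) atTop
      (𝓝 (M W)) := by
  have hw := fun n => (h.isEllipticGaussian hG n).isWickSystem v (D n)
  have heval : ∀ n W ω, MvPolynomial.eval (fun e => (x n e ω : ℂ))
      (matWord (letterMatrix v (D n)) W).trace =
      ((W.map (Sum.elim (fun a => ∑ b, v a b • familyMatrix (x n) b ω) (D n))).prod).trace := by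
    intro n W ω
    rw [trace_map, matWord_map]
    simp only [eval_letterMatrix, matWord]
  refine ⟨fun n => ?_, ?_⟩
  · simp only [← heval]
    exact (hw n).integrable _
  -- One random bound for the norms of all letters; the summand `1` makes powers of `K` increase
  -- with the exponent.
  let K : ∀ n, Ω n → ℝ := fun n ω =>
    1 + (∑ a, ∑ b, ‖v a b‖ * ‖familyMatrix (x n) b ω‖ + ∑ y, ‖D n y‖)
  have hKm : SqrtMoments μ K := by
    refine (SqrtMoments.const 1).add (SqrtMoments.add ?_ ?_)
    · exact SqrtMoments.sum _ fun a _ => SqrtMoments.sum _ fun b _ =>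
        (h.sqrtMoments b).const_mul ‖v a b‖
    · refine SqrtMoments.sum _ fun y _ => ?_
      obtain ⟨y', hy'⟩ := hstar y
      exact sqrtMoments_deterministic D (fun u => M (u.map Sum.inr)) hD y y' hy'
  have hK1 : ∀ n ω, 1 ≤ K n ω := fun n ω => le_add_of_nonneg_right (by positivity)
  have habs : ∀ n ω, |K n ω| = K n ω := fun n ω => abs_of_nonneg (zero_le_one.trans (hK1 n ω))
  have hZ : ∀ n ω y, ‖(letterMatrix v (D n) y).map (MvPolynomial.eval fun e => (x n e ω : ℂ))‖ ≤
      K n ω := by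
    intro n ω y
    rw [eval_letterMatrix]
    have h0 : 0 ≤ ∑ a, ∑ b, ‖v a b‖ * ‖familyMatrix (x n) b ω‖ := by positivity
    have h0' : 0 ≤ ∑ y, ‖D n y‖ := by positivity
    rcases y with a | y
    · have h1 : ‖∑ b, v a b • familyMatrix (x n) b ω‖ ≤
          ∑ b, ‖v a b‖ * ‖familyMatrix (x n) b ω‖ :=
        norm_sum_le_of_le _ fun b _ => (norm_smul_le _ _)
      have h2 := Finset.single_le_sum (f := fun a => ∑ b, ‖v a b‖ * ‖familyMatrix (x n) b ω‖)
        (fun a _ => by positivity) (Finset.mem_univ a)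
      simp only [Sum.elim_inl, K]
      linarith
    · have h2 := Finset.single_le_sum (f := fun y => ‖D n y‖)
        (fun a _ => by positivity) (Finset.mem_univ y)
      simp only [Sum.elim_inr, K]
      linarith
  have hB : ∀ r a y, ‖covExt (letterCov ρ v r) a (y : X ⊕ Y)‖ ≤
      ∑ r, ∑ a, ∑ a', ‖letterCov ρ v r a a'‖ := by
    intro r a y
    rcases y with a' | y
    · calc ‖letterCov ρ v r a a'‖ ≤ ∑ a', ‖letterCov ρ v r a a'‖ :=
            Finset.single_le_sum (f := fun a' => ‖letterCov ρ v r a a'‖)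
              (fun _ _ => norm_nonneg _) (Finset.mem_univ a')
        _ ≤ ∑ a, ∑ a', ‖letterCov ρ v r a a'‖ :=
            Finset.single_le_sum (f := fun a => ∑ a', ‖letterCov ρ v r a a'‖)
              (fun _ _ => by positivity) (Finset.mem_univ a)
        _ ≤ _ := Finset.single_le_sum (f := fun r => ∑ a, ∑ a', ‖letterCov ρ v r a a'‖)
              (fun _ _ => by positivity) (Finset.mem_univ r)
    · simp only [covExt, Sum.elim_inr, norm_zero]
      positivity
  have key := IsWickSystem.tendsto_expect_traceProd hw hK1
    (fun n k => by simpa only [habs] using hKm.integrable_abs_pow n k)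
    (fun k => by simpa only [habs] using hKm.2 k) hZ (by positivity) hB M hM
    (fun n u => (n : ℂ)⁻¹ * (u.map (D n)).prod.trace) (fun n u ω => ?_) hD [W]
  · simp only [List.map_cons, List.map_nil, List.prod_singleton] at key
    refine key.congr fun n => ?_
    rw [IsWickSystem.expect_apply, meanTrace, ← integral_const_mul]
    refine integral_congr_ae (ae_of_all _ fun ω => ?_)
    simp only [IsWickSystem.traceProd, List.map_cons, List.map_nil, List.prod_singleton]
    rw [normTrace, MvPolynomial.smul_eval, heval]
  · rw [normTrace, MvPolynomial.smul_eval, heval, List.map_map]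
    rfl

end GaussianConvergence

/-! ### From elliptic matrix sequences to families of entries -/

section EllipticCovariance

variable {κ : Type*} [DecidableEq κ] {n : ℕ}

theorem eq_or_eq_swap_of_entryClass_eq {κ : Type*} {e f : κ × Fin n × Fin n}
    (h : entryClass e = entryClass f) : f = e ∨ f = (e.1, e.2.swap) := by
  obtain ⟨τ, p⟩ := e
  obtain ⟨τ', p'⟩ := f
  by_cases h1 : p.1 ≤ p.2 <;> by_cases h2 : p'.1 ≤ p'.2
  · rw [entryClass_of_le h1, entryClass_of_le h2] at h
    simp only [Prod.mk.injEq, Subtype.mk.injEq] at h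
    simp [h.1, h.2]
  · rw [entryClass_of_le h1, entryClass_of_not_le h2] at h
    simp only [Prod.mk.injEq, Subtype.mk.injEq] at h
    simp [h.1, h.2]
  · rw [entryClass_of_not_le h1, entryClass_of_le h2] at h
    simp only [Prod.mk.injEq, Subtype.mk.injEq] at h
    simp [h.1, h.2]
  · rw [entryClass_of_not_le h1, entryClass_of_not_le h2] at h
    simp only [Prod.mk.injEq, Subtype.mk.injEq, Prod.swap_inj] at h
    simp [h.1, h.2]

theorem entryCov_self (ρ : κ → ℝ) (e : κ × Fin n × Fin n) : entryCov ρ e e = 1 := by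
  rw [entryCov, if_pos rfl, if_pos rfl]
  by_cases he : e.2 = e.2.swap
  · rw [if_pos he, if_pos ⟨rfl, he⟩]
    ring
  · rw [if_neg he, if_neg fun h => he h.2]
    ring

theorem entryCov_swap (ρ : κ → ℝ) (e : κ × Fin n × Fin n) (he : e.2 ≠ e.2.swap) :
    entryCov ρ e (e.1, e.2.swap) = ρ e.1 := by
  rw [entryCov, if_pos rfl, if_neg he, if_pos (by simp), if_neg fun h => he h.1]
  ring

end EllipticCovariance

section OfMatrices

variable {κ : Type*} [Fintype κ] {Ω : ℕ → Type*} [∀ n, MeasurableSpace (Ω n)]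
  {μ : ∀ n, Measure (Ω n)} {A : ∀ n, κ → Ω n → Matrix (Fin n) (Fin n) ℝ}
  {ρ : κ → ℝ}

theorem isEllipticFamily_of_matrixSeq [DecidableEq κ]
    (hA : ∀ τ, IsEllipticMatrixSeq μ (fun n => A n τ) (ρ τ))
    (hindep : ∀ n, iIndepFun (fun (τ : κ) ω (p : Fin n × Fin n) => A n τ ω p.1 p.2) (μ n)) :
    IsEllipticFamily μ (fun n e ω => A n e.1 ω e.2.1 e.2.2) ρ := by
  have hm : ∀ n (e : κ × Fin n × Fin n), Measurable fun ω => A n e.1 ω e.2.1 e.2.2 :=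
    fun n e => (hA e.1).measurable n e.2.1 e.2.2
  have hi : ∀ n, iIndepFun (fun (c : κ × {p : Fin n × Fin n // p.1 ≤ p.2}) ω =>
      (A n c.1 ω c.2.1.1 c.2.1.2, A n c.1 ω c.2.1.2 c.2.1.1)) (μ n) := by
    intro n
    refine iIndepFun_uncurry' (X := fun (τ : κ) (p : {p : Fin n × Fin n // p.1 ≤ p.2}) ω =>
      (A n τ ω p.1.1 p.1.2, A n τ ω p.1.2 p.1.1)) (fun τ p => ?_) ?_ fun τ => (hA τ).indep n
    · exact (hm n (τ, p.1)).prodMk (hm n (τ, p.1.swap))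
    · exact (hindep n).comp (fun _ a (p : {p : Fin n × Fin n // p.1 ≤ p.2}) =>
        (a p.1, a p.1.swap)) fun τ => measurable_pi_lambda _ fun p =>
          (measurable_pi_apply _).prodMk (measurable_pi_apply _)
  refine ⟨hm, hi, fun n e => (hA e.1).mean n e.2.1 e.2.2, fun n e f => ?_, fun k => ?_⟩
  · by_cases hc : entryClass e = entryClass f
    · rcases eq_or_eq_swap_of_entryClass_eq hc with rfl | rfl
      · rw [entryCov_self]
        simpa only [sq] using (hA f.1).variance n f.2.1 f.2.2
      -- For a diagonal entry the swap is the entry itself, so its variance enters and not the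
      -- correlation.
      · by_cases he : e.2 = e.2.swap
        · rw [← he, entryCov_self]
          simpa only [sq] using (hA e.1).variance n e.2.1 e.2.2
        · rw [entryCov_swap ρ e he]
          refine (hA e.1).correlation n e.2.1 e.2.2 fun h => he ?_
          exact Prod.ext h h.symm
    · rw [entryCov_eq_zero ρ hc]
      have h1 : ∀ e : κ × Fin n × Fin n, ∃ g : ℝ × ℝ → ℝ, Measurable g ∧
          (fun ω => A n e.1 ω e.2.1 e.2.2) = g ∘ fun ω =>
            (A n (entryClass e).1 ω (entryClass e).2.1.1 (entryClass e).2.1.2,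
              A n (entryClass e).1 ω (entryClass e).2.1.2 (entryClass e).2.1.1) := by
        intro e
        by_cases he : e.2.1 ≤ e.2.2
        · exact ⟨Prod.fst, measurable_fst, by rw [entryClass_of_le he]; rfl⟩
        · exact ⟨Prod.snd, measurable_snd, by rw [entryClass_of_not_le he]; rfl⟩
      obtain ⟨g, hg, hge⟩ := h1 e
      obtain ⟨g', hg', hgf⟩ := h1 f
      have h2 := ((hi n).indepFun hc).comp hg hg'
      rw [← hge, ← hgf] at h2
      rw [h2.integral_fun_mul_eq_mul_integral (hm n e).aestronglyMeasurable
        (hm n f).aestronglyMeasurable, (hA e.1).mean n e.2.1 e.2.2, zero_mul]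
  · choose C hC using fun τ => (hA τ).moments k
    refine ⟨∑ τ, |C τ|, fun n e => ⟨(hC e.1 n e.2.1 e.2.2).1, ?_⟩⟩
    exact (hC e.1 n e.2.1 e.2.2).2.trans ((le_abs_self _).trans
      (Finset.single_le_sum (f := fun τ => |C τ|) (fun _ _ => abs_nonneg _) (Finset.mem_univ e.1)))

theorem hasGaussianLaw_of_iIndepFun
    (hindep : ∀ n, iIndepFun (fun (τ : κ) ω (p : Fin n × Fin n) => A n τ ω p.1 p.2) (μ n))
    (hG : ∀ n τ, HasGaussianLaw (fun ω (p : Fin n × Fin n) => A n τ ω p.1 p.2) (μ n)) (n : ℕ) :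
    HasGaussianLaw (fun ω (e : κ × Fin n × Fin n) => A n e.1 ω e.2.1 e.2.2) (μ n) := by
  have h1 := (hindep n).hasGaussianLaw (hG n)
  exact h1.map_fun (ContinuousLinearMap.pi fun e : κ × Fin n × Fin n =>
    (ContinuousLinearMap.proj (R := ℝ) (φ := fun _ : Fin n × Fin n => ℝ) e.2).comp
      (ContinuousLinearMap.proj (R := ℝ) (φ := fun _ : κ => Fin n × Fin n → ℝ) e.1))

end OfMatrices

/-! ### A Gaussian model with given correlations -/

section GaussianModel

variable {κ : Type*} [Fintype κ]

/-- Uncorrelated blocks of a jointly Gaussian vector are independent, and every entry is standard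
normal, so the moment bounds are uniform. -/
theorem IsEllipticFamily.of_gaussian [DecidableEq κ] {Ω : ℕ → Type*} [∀ n, MeasurableSpace (Ω n)]
    {μ : ∀ n, Measure (Ω n)} [∀ n, IsProbabilityMeasure (μ n)]
    {x : ∀ n, κ × Fin n × Fin n → Ω n → ℝ} {ρ : κ → ℝ} (hm : ∀ n e, Measurable (x n e))
    (hG : ∀ n, HasGaussianLaw (fun ω e => x n e ω) (μ n)) (hmean : ∀ n e, ∫ ω, x n e ω ∂μ n = 0)
    (hcov : ∀ n e f, ∫ ω, x n e ω * x n f ω ∂μ n = entryCov ρ e f) :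
    IsEllipticFamily μ x ρ := by
  have hlp : ∀ n e, MemLp (x n e) 2 (μ n) := fun n e => ((hG n).eval e).memLp_two
  have hcov' : ∀ n e f, cov[x n e, x n f; μ n] = entryCov ρ e f := by
    intro n e f
    rw [covariance_eq_sub (hlp n e) (hlp n f), hmean, zero_mul, sub_zero, ← hcov]
    rfl
  refine ⟨hm, fun n => ?_, hmean, hcov, fun k => ⟨∫ t, |t| ^ k ∂(gaussianReal 0 1), fun n e => ?_⟩⟩
  · have h1 : HasGaussianLaw (fun ω (c : κ × {p : Fin n × Fin n // p.1 ≤ p.2}) (b : Bool) =>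
        x n (c.1, if b then c.2.1 else c.2.1.swap) ω) (μ n) :=
      (hG n).map_fun (ContinuousLinearMap.pi fun c : κ × {p : Fin n × Fin n // p.1 ≤ p.2} =>
        ContinuousLinearMap.pi fun b : Bool => ContinuousLinearMap.proj (R := ℝ)
          (φ := fun _ : κ × Fin n × Fin n => ℝ) (c.1, if b then c.2.1 else c.2.1.swap))
    have h2 := h1.iIndepFun_of_covariance_eval
      (X := fun (c : κ × {p : Fin n × Fin n // p.1 ≤ p.2}) (b : Bool) ω =>
          x n (c.1, if b then c.2.1 else c.2.1.swap) ω)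
      (fun c c' hcc b b' => by
        rw [hcov']
        refine entryCov_eq_zero ρ fun h => hcc ?_
        have h3 : ∀ (c : κ × {p : Fin n × Fin n // p.1 ≤ p.2}) (b : Bool),
            entryClass (c.1, if b then c.2.1 else c.2.1.swap) = c := by
          intro c b
          cases b
          · simp only [Bool.false_eq_true, if_false]
            rw [entryClass_swap, entryClass_of_le c.2.2]
          · simp only [if_true]
            rw [entryClass_of_le c.2.2]
        rw [← h3 c b, h, h3])
    exact h2.comp (fun _ a => (a true, a false)) fun _ =>
      (measurable_pi_apply _).prodMk (measurable_pi_apply _)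
  · have hmap : (μ n).map (x n e) = gaussianReal 0 1 := by
      rw [((hG n).eval e).map_eq_gaussianReal, ← covariance_self (hm n e).aemeasurable, hcov',
        entryCov_self, hmean]
      simp
    have hmeas : AEStronglyMeasurable (fun t : ℝ => |t| ^ k) ((μ n).map (x n e)) := by
      fun_prop
    refine ⟨?_, le_of_eq ?_⟩
    · exact (HasAllMoments.norm fun k => ((hG n).eval e).memLp (by simp)).pow k |>.integrable
    · rw [← hmap, integral_map (hm n e).aemeasurable hmeas]

/-- The entries of a Gaussian elliptic random matrix, built from independent Gaussians. -/
noncomputable def modelEntry {κ : Type*} (ρ : κ → ℝ) {n : ℕ} (e : κ × Fin n × Fin n)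
    (ω : κ × Fin n × Fin n → ℝ) : ℝ :=
  (if e.2.1 ≤ e.2.2 then 1 else ρ e.1) * ω ((entryClass e).1, (entryClass e).2.1) +
    (if e.2.1 ≤ e.2.2 then 0 else √(1 - ρ e.1 ^ 2)) * ω e

/-- The law of an array of independent standard Gaussians. -/
noncomputable abbrev modelMeasure (κ : Type*) [Fintype κ] (n : ℕ) :
    Measure (κ × Fin n × Fin n → ℝ) := Measure.pi fun _ => gaussianReal 0 1

theorem hasGaussianLaw_modelMeasure (n : ℕ) :
    HasGaussianLaw (fun (ω : κ × Fin n × Fin n → ℝ) e => ω e) (modelMeasure κ n) := by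
  refine iIndepFun.hasGaussianLaw (X := fun e (ω : κ × Fin n × Fin n → ℝ) => ω e) (fun e => ?_)
    (iIndepFun_pi (X := fun _ t => t) fun _ => aemeasurable_id)
  refine ⟨?_⟩
  rw [(measurePreserving_eval (fun _ : κ × Fin n × Fin n => gaussianReal 0 1) e).map_eq]
  infer_instance

theorem integral_modelMeasure (n : ℕ) (e : κ × Fin n × Fin n) :
    ∫ ω, ω e ∂modelMeasure κ n = 0 := by
  have := integral_comp_eval (μ := fun _ : κ × Fin n × Fin n => gaussianReal 0 1) (i := e)
    (f := fun t : ℝ => t) (by fun_prop)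
  rw [this]
  simp

theorem integral_mul_modelMeasure [DecidableEq κ] (n : ℕ) (e f : κ × Fin n × Fin n) :
    ∫ ω, ω e * ω f ∂modelMeasure κ n = if e = f then 1 else 0 := by
  split_ifs with h
  · subst h
    have := integral_comp_eval (μ := fun _ : κ × Fin n × Fin n => gaussianReal 0 1) (i := e)
      (f := fun t : ℝ => t * t) (by fun_prop)
    rw [this]
    have h1 := variance_eq_sub (μ := gaussianReal 0 1) (X := id)
      (memLp_id_gaussianReal' 2 (by simp))
    rw [variance_id_gaussianReal] at h1
    simpa [sq] using h1.symm
  · have h1 := (iIndepFun_pi (μ := fun _ : κ × Fin n × Fin n => gaussianReal 0 1)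
      (X := fun _ t => t) fun _ => aemeasurable_id).indepFun h
    have h2 := h1.integral_fun_mul_eq_mul_integral
      (measurable_pi_apply e).aestronglyMeasurable (measurable_pi_apply f).aestronglyMeasurable
    rw [h2, integral_modelMeasure, zero_mul]

/-- The entry below the diagonal is `ρ` times its mirror image plus `√(1 - ρ²)` times an independent
Gaussian, which gives variance `1` and correlation `ρ`. The square root requires `ρ ∈ [-1, 1]`. -/
theorem integral_modelEntry_mul [DecidableEq κ] (ρ : κ → ℝ) (hρ : ∀ τ, ρ τ ∈ Set.Icc (-1 : ℝ) 1)
    (n : ℕ)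
    (e f : κ × Fin n × Fin n) :
    ∫ ω, modelEntry ρ e ω * modelEntry ρ f ω ∂modelMeasure κ n = entryCov ρ e f := by
  have hint : ∀ (e f : κ × Fin n × Fin n) (s : ℝ),
      Integrable (fun ω => s * (ω e * ω f)) (modelMeasure κ n) := fun e f s =>
    (((hasGaussianLaw_modelMeasure n).eval e).memLp_two.integrable_mul
      ((hasGaussianLaw_modelMeasure n).eval f).memLp_two).const_mul s
  have hexp : ∀ a b a' b' : ℝ, ∀ p q p' q' : κ × Fin n × Fin n,
      ∫ ω, (a * ω p + b * ω q) * (a' * ω p' + b' * ω q') ∂modelMeasure κ n =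
        a * a' * (if p = p' then 1 else 0) + a * b' * (if p = q' then 1 else 0) +
        b * a' * (if q = p' then 1 else 0) + b * b' * (if q = q' then 1 else 0) := by
    intro a b a' b' p q p' q'
    have h1 : ∀ ω : κ × Fin n × Fin n → ℝ, (a * ω p + b * ω q) * (a' * ω p' + b' * ω q') =
        a * a' * (ω p * ω p') + a * b' * (ω p * ω q') + b * a' * (ω q * ω p') +
          b * b' * (ω q * ω q') := fun ω => by ring
    simp only [h1]
    have i1 := hint p p' (a * a')
    have i2 := hint p q' (a * b')
    have i3 := hint q p' (b * a')
    have i4 := hint q q' (b * b')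
    have i12 : Integrable (fun ω => a * a' * (ω p * ω p') + a * b' * (ω p * ω q'))
      (modelMeasure κ n) := i1.add i2
    have i123 : Integrable (fun ω => a * a' * (ω p * ω p') + a * b' * (ω p * ω q') +
      b * a' * (ω q * ω p')) (modelMeasure κ n) := i12.add i3
    rw [integral_add i123 i4, integral_add i12 i3, integral_add i1 i2]
    simp only [integral_const_mul, integral_mul_modelMeasure]
  simp only [modelEntry, hexp]
  have hcl : ∀ e : κ × Fin n × Fin n,
      entryClass ((entryClass e).1, (entryClass e).2.1) = entryClass e := by
    intro e
    rw [entryClass_of_le (e := ((entryClass e).1, (entryClass e).2.1)) (entryClass e).2.2]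
  have hsq : ∀ τ, √(1 - ρ τ ^ 2) * √(1 - ρ τ ^ 2) = 1 - ρ τ ^ 2 := fun τ =>
    Real.mul_self_sqrt (by nlinarith [(hρ τ).1, (hρ τ).2])
  by_cases hc : entryClass e = entryClass f
  · have hself : ∀ e : κ × Fin n × Fin n, e.2.1 ≤ e.2.2 →
        ((entryClass e).1, (entryClass e).2.1) = e := fun e he => by rw [entryClass_of_le he]
    have hne : ∀ e : κ × Fin n × Fin n, ¬ e.2.1 ≤ e.2.2 →
        ((entryClass e).1, (entryClass e).2.1) ≠ e := fun e he h => by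
      have := (entryClass e).2.2
      rw [← h] at he
      exact he this
    rcases eq_or_eq_swap_of_entryClass_eq hc with rfl | hf
    · rw [entryCov_self]
      by_cases he : f.2.1 ≤ f.2.2
      · simp [he]
      · have h1 := hne f he
        simp only [he, if_false, if_true, h1, h1.symm]
        have := hsq f.1
        linarith
    · by_cases hs : e.2 = e.2.swap
      · have : f = e := by rw [hf, ← hs]
        subst this
        have he : f.2.1 ≤ f.2.2 := (congrArg Prod.fst hs).le
        rw [entryCov_self]
        simp [he]
      · have hfe : f ≠ e := fun h => hs (by rw [hf] at h; exact (congrArg Prod.snd h).symm)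
        rw [hf, entryCov_swap ρ e hs, ← hf, ← hc]
        by_cases he : e.2.1 ≤ e.2.2
        · have hf' : ¬ f.2.1 ≤ f.2.2 := by
            rw [hf]
            exact fun h => hs (Prod.ext (le_antisymm he h) (le_antisymm h he))
          simp [he, hf', hself e he, hfe.symm, show f.1 = e.1 by rw [hf]]
        · have hf' : f.2.1 ≤ f.2.2 := by
            rw [hf]
            exact (not_le.1 he).le
          have := hself f hf'
          rw [← hc] at this
          simp [he, hf', this, hfe.symm]
  · have h1 : ((entryClass e).1, (entryClass e).2.1) ≠ ((entryClass f).1, (entryClass f).2.1) :=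
      fun h => hc (by rw [← hcl e, h, hcl])
    have h2 : ((entryClass e).1, (entryClass e).2.1) ≠ f := fun h => hc (by rw [← hcl e, h])
    have h3 : e ≠ ((entryClass f).1, (entryClass f).2.1) := fun h => hc (by rw [← hcl f, ← h])
    have h4 : e ≠ f := fun h => hc (by rw [h])
    rw [entryCov_eq_zero ρ hc, if_neg h1, if_neg h2, if_neg h3, if_neg h4]
    ring

theorem hasGaussianLaw_modelEntry (ρ : κ → ℝ) (n : ℕ) :
    HasGaussianLaw (fun ω (e : κ × Fin n × Fin n) => modelEntry ρ e ω) (modelMeasure κ n) :=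
  (hasGaussianLaw_modelMeasure n).map_fun (ContinuousLinearMap.pi fun e : κ × Fin n × Fin n =>
    (if e.2.1 ≤ e.2.2 then (1 : ℝ) else ρ e.1) • ContinuousLinearMap.proj (R := ℝ)
      (φ := fun _ : κ × Fin n × Fin n => ℝ) ((entryClass e).1, (entryClass e).2.1) +
    (if e.2.1 ≤ e.2.2 then (0 : ℝ) else √(1 - ρ e.1 ^ 2)) • ContinuousLinearMap.proj (R := ℝ)
      (φ := fun _ : κ × Fin n × Fin n => ℝ) e)

theorem isEllipticFamily_modelEntry [DecidableEq κ] (ρ : κ → ℝ)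
    (hρ : ∀ τ, ρ τ ∈ Set.Icc (-1 : ℝ) 1) :
    IsEllipticFamily (modelMeasure κ) (fun _ e => modelEntry ρ e) ρ := by
  refine IsEllipticFamily.of_gaussian (fun n e => ?_) (hasGaussianLaw_modelEntry ρ) (fun n e => ?_)
    (integral_modelEntry_mul ρ hρ)
  · exact ((measurable_pi_apply _).const_mul _).add ((measurable_pi_apply _).const_mul _)
  · have hint : ∀ f : κ × Fin n × Fin n, Integrable (fun ω => ω f) (modelMeasure κ n) :=
      fun f => ((hasGaussianLaw_modelMeasure n).eval f).integrable
    simp only [modelEntry]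
    rw [integral_add ((hint _).const_mul _) ((hint _).const_mul _), integral_const_mul,
      integral_const_mul, integral_modelMeasure, integral_modelMeasure]
    ring

end GaussianModel

/-! ### Relabelling letters and adjoints in words -/

section Words

theorem splitSum_comp {L L' M : Type*} [AddCommMonoid M] [SMul ℂ M] (h : L' → L) (g : L → ℂ)
    (F : List L → List L → M) (pre W : List L') :
    splitSum g F (pre.map h) (W.map h) =
      splitSum (fun y => g (h y)) (fun U V => F (U.map h) (V.map h)) pre W := by
  induction W generalizing pre with
  | nil => rfl
  | cons y V ih =>
    have := ih (pre ++ [y])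
    rw [List.map_append] at this
    simp only [List.map_cons, splitSum]
    rw [← this]
    rfl

theorem SchwingerDyson.comp {X X' Y : Type*} {c : X → X → ℂ} {M : List (X ⊕ Y) → ℂ}
    (h : SchwingerDyson c M) (f : X' → X) :
    SchwingerDyson (fun a b => c (f a) (f b)) fun W : List (X' ⊕ Y) =>
      M (W.map (Sum.map f id)) := by
  intro u x W
  have h1 : ∀ u : List Y, (u.map (Sum.inr : Y → X' ⊕ Y)).map (Sum.map f id) =
      u.map (Sum.inr : Y → X ⊕ Y) := fun u => by simp
  have h2 := h u (f x) (W.map (Sum.map f id))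
  have h3 := splitSum_comp (Sum.map f (id : Y → Y)) (covExt c (f x))
    (fun U V => M U * M (u.map Sum.inr ++ V)) [] W
  rw [List.map_nil] at h3
  rw [h3] at h2
  simp only [List.map_append, List.map_cons, h1, Sum.map_inl, h2]
  refine congrArg (fun g => splitSum g _ [] W) ?_
  funext y
  cases y <;> rfl

/-- The letter `(i, ε)` of a word `starWord a w`. -/
def starLetter {ι A : Type*} [Star A] (a : ι → A) (p : ι × Bool) : A :=
  if p.2 then star (a p.1) else a p.1

theorem starWord_sumElim {I J A : Type*} [Monoid A] [Star A] (a : I → A) (d : J → A)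
    (w : List ((I ⊕ J) × Bool)) :
    starWord (Sum.elim a d) w =
      ((w.map (Equiv.sumProdDistrib I J Bool)).map
        (Sum.elim (starLetter a) (starLetter d))).prod := by
  rw [starWord, List.map_map]
  refine congrArg (fun f => (w.map f).prod) ?_
  funext p
  obtain ⟨i | j, ε⟩ := p <;> rfl

theorem List.prod_map_apply {Ω L : Type*} {A : Ω → Type*} [∀ ω, Monoid (A ω)]
    (f : L → ∀ ω, A ω) (W : List L) (ω : Ω) :
    (W.map f).prod ω = (W.map fun y => f y ω).prod := by
  have := map_list_prod (Pi.evalMonoidHom A ω) (W.map f)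
  simpa [List.map_map, Function.comp_def] using this

theorem starWord_apply {Ω ι A : Type*} [Monoid A] [Star A] (a : ι → Ω → A) (w : List (ι × Bool))
    (ω : Ω) : starWord a w ω = starWord (fun i => a i ω) w := by
  rw [starWord, List.prod_map_apply, starWord]
  refine congrArg (fun f => (w.map f).prod) ?_
  funext p
  split_ifs <;> rfl

end Words

/-- The empty set generates only scalars, and a centred scalar is zero. -/
theorem NCProbSpace.IsFree.sumElim_empty {ℬ : NCProbSpace.{u}} {ι : Type*} {S : ι → Set ℬ}
    (h : ℬ.IsFree S) : ℬ.IsFree (Sum.elim S fun _ : Unit => (∅ : Set ℬ)) := by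
  intro k i x hi hx hφ
  by_cases hinr : ∃ j, i j = Sum.inr ()
  · obtain ⟨j, hj⟩ := hinr
    have h1 := hx j
    rw [hj, Sum.elim_inr] at h1
    obtain ⟨r, hr⟩ := StarSubalgebra.mem_bot.1
      (StarAlgebra.adjoin_le (S := ⊥) (Set.empty_subset _) h1)
    have h2 := hφ j
    rw [← hr, Algebra.algebraMap_eq_smul_one, map_smul, ℬ.map_one, smul_eq_mul, mul_one] at h2
    have h3 : x j = 0 := by rw [← hr, h2, map_zero]
    have h4 : (List.ofFn x).prod = 0 := List.prod_eq_zero (List.mem_ofFn.2 ⟨j, h3⟩)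
    rw [h4, map_zero]
  · have h1 : ∀ j, ∃ i', i j = Sum.inl i' := by
      intro j
      rcases hij : i j with i' | ⟨⟩
      · exact ⟨i', rfl⟩
      · exact absurd ⟨j, hij⟩ hinr
    choose i' hi' using h1
    refine h k i' x (fun j hj => hi j ?_) (fun j => ?_) hφ
    · rw [hi', hi', hj]
    · have := hx j
      rwa [hi', Sum.elim_inl] at this

/-! ### A space of free elliptic elements -/

section EllipticSpace

variable {I : Type} [DecidableEq I]

/-- The coefficients of the semicircular and elliptic letters with respect to the semicircular
ones. -/
noncomputable def ellipticCoeff (ρ : I → ℝ) : (I × Bool) ⊕ (I × Bool) → I × Bool → ℂ :=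
  Sum.elim (fun p => Pi.single p 1) fun p q =>
    if q.1 = p.1 then
      if q.2 then ((√((1 + ρ p.1) / 2) : ℝ) : ℂ)
      else starLetter (fun _ : Unit => Complex.I * ((√((1 - ρ p.1) / 2) : ℝ) : ℂ)) ((), p.2)
    else 0

/-- The covariance of elliptic letters. -/
noncomputable def ellipticCov (ρ : I → ℝ) (p q : I × Bool) : ℂ :=
  if p.1 = q.1 then if p.2 = q.2 then (ρ p.1 : ℂ) else 1 else 0

/-- The form is bilinear, not sesquilinear, so the imaginary coefficients matter: equal letters give
`(1+ρ)/2 - (1-ρ)/2 = ρ`, a letter with its adjoint gives `(1+ρ)/2 + (1-ρ)/2 = 1`. -/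
theorem sum_ellipticCoeff_mul [Fintype I] (ρ : I → ℝ) (hρ : ∀ τ, ρ τ ∈ Set.Icc (-1 : ℝ) 1)
    (p q : I × Bool) :
    ∑ b, ellipticCoeff ρ (Sum.inr p) b * ellipticCoeff ρ (Sum.inr q) b = ellipticCov ρ p q := by
  obtain ⟨τ, ε⟩ := p
  obtain ⟨τ', ε'⟩ := q
  rw [Fintype.sum_prod_type, Finset.sum_eq_single τ]
  · by_cases h : τ = τ'
    · subst h
      have h1 : ((√((1 + ρ τ) / 2) : ℝ) : ℂ) * ((√((1 + ρ τ) / 2) : ℝ) : ℂ) = (1 + ρ τ) / 2 := by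
        rw [← Complex.ofReal_mul, Real.mul_self_sqrt (by linarith [(hρ τ).1])]
        push_cast
        ring
      have h2 : ((√((1 - ρ τ) / 2) : ℝ) : ℂ) * ((√((1 - ρ τ) / 2) : ℝ) : ℂ) = (1 - ρ τ) / 2 := by
        rw [← Complex.ofReal_mul, Real.mul_self_sqrt (by linarith [(hρ τ).2])]
        push_cast
        ring
      have h3 : star (Complex.I * ((√((1 - ρ τ) / 2) : ℝ) : ℂ)) =
          -(Complex.I * ((√((1 - ρ τ) / 2) : ℝ) : ℂ)) := by
        rw [RCLike.star_def, map_mul, Complex.conj_I, Complex.conj_ofReal]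
        ring
      have h4 : (Complex.I * ((√((1 - ρ τ) / 2) : ℝ) : ℂ)) *
          (Complex.I * ((√((1 - ρ τ) / 2) : ℝ) : ℂ)) = -((1 - ρ τ) / 2) := by
        rw [mul_mul_mul_comm, h2, Complex.I_mul_I]
        ring
      simp only [ellipticCoeff, ellipticCov, starLetter, Sum.elim_inr, Fintype.sum_bool, if_true,
        Bool.false_eq_true, if_false, h3]
      cases ε <;> cases ε' <;> simp only [if_true, Bool.false_eq_true, if_false, reduceCtorEq]
      · linear_combination h1 + h4
      · linear_combination h1 - h4
      · linear_combination h1 - h4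
      · linear_combination h1 + h4
    · simp [ellipticCoeff, ellipticCov, h]
  · intro b _ hb
    simp [ellipticCoeff, hb]
  · simp

theorem star_ellipticCoeff (ρ : I → ℝ) (τ : I) (ε : Bool) (q : I × Bool) :
    star (ellipticCoeff ρ (Sum.inr (τ, ε)) q) = ellipticCoeff ρ (Sum.inr (τ, !ε)) q := by
  simp only [ellipticCoeff, Sum.elim_inr, starLetter]
  have h (z : ℝ) : star (z : ℂ) = z := Complex.conj_ofReal z
  split_ifs <;> cases ε <;> simp_all

theorem letterCov_one_of_symm {κ X : Type*} [Fintype κ] [DecidableEq κ] (w : X → κ → ℂ) (a a' : X) :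
    letterCov (fun _ : κ => 1) (fun a b => if b.2 then 0 else w a b.1) 0 a a' =
      ∑ q, w a q * w a' q := by
  simp [letterCov, transposeCov, Fintype.sum_prod_type, apply_ite Complex.ofReal]

/-- With correlation one the model matrix is real symmetric, so its transpose is not a new letter.
-/
theorem familyMatrix_modelEntry_one {κ : Type*} {n : ℕ} (q : κ) (ε : Bool)
    (ω : κ × Fin n × Fin n → ℝ) :
    familyMatrix (fun e => modelEntry (fun _ : κ => 1) e) (q, ε) ω =
      familyMatrix (fun e => modelEntry (fun _ : κ => 1) e) (q, false) ω := by
  ext i j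
  have h : ∀ e : κ × Fin n × Fin n, modelEntry (fun _ => 1) e ω =
      ω ((entryClass e).1, (entryClass e).2.1) := by
    intro e
    simp [modelEntry]
  simp only [familyMatrix, Matrix.of_apply, h]
  cases ε
  · rfl
  · have := entryClass_swap q (i, j)
    simp only [entryPos, if_true, Bool.false_eq_true, if_false]
    rw [Prod.swap_prod_mk] at this
    rw [this]

end EllipticSpace

section EllipticSpaceExistence

variable {I : Type} [Fintype I] [DecidableEq I]

/-- There is a space containing elliptic elements which are free from a limit of deterministic
matrices. -/
theorem exists_elliptic_space (ρ : I → ℝ) (hρ : ∀ τ, ρ τ ∈ Set.Icc (-1 : ℝ) 1) {J : Type}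
    [Fintype J] (D : ∀ n, J → Matrix (Fin n) (Fin n) ℂ) (t : List (J × Bool) → ℂ)
    (hD : ∀ u : List (J × Bool),
      Tendsto (fun n : ℕ => (n : ℂ)⁻¹ * (starWord (D n) u).trace) atTop (𝓝 (t u))) :
    ∃ (ℬ : NCProbSpace.{0}) (e : I → ℬ) (d : J → ℬ), (∀ u, ℬ.φ (starWord d u) = t u) ∧
      (∀ τ, ℬ.IsElliptic (ρ τ) (e τ)) ∧
      ℬ.IsFree (Sum.elim (fun τ => {e τ}) fun _ : Unit => Set.range d) ∧
      SchwingerDyson (ellipticCov ρ) fun W : List ((I × Bool) ⊕ (J × Bool)) =>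
        ℬ.φ ((W.map (Sum.elim (starLetter e) (starLetter d))).prod) := by
  -- Two independent symmetric Gaussian matrices for each index: they become the free semicirculars
  -- from which the elliptic element is built.
  have hx := isEllipticFamily_modelEntry (fun _ : I × Bool => (1 : ℝ)) (by norm_num)
  set w := ellipticCoeff ρ with hw
  let v : (I × Bool) ⊕ (I × Bool) → (I × Bool) × Bool → ℂ := fun a b => if b.2 then 0 else w a b.1
  let x : ∀ n, (I × Bool) × Fin n × Fin n → ((I × Bool) × Fin n × Fin n → ℝ) → ℝ :=
    fun n e => modelEntry (fun _ : I × Bool => (1 : ℝ)) e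
  let c := letterCov (fun _ : I × Bool => (1 : ℝ)) v 0
  let M := sdFunctional c t
  have hM : SchwingerDyson c M := schwingerDyson_sdFunctional c t
  have hc : ∀ a a', c a a' = ∑ q, w a q * w a' q := letterCov_one_of_symm w
  have hDstar : ∀ y : J × Bool, ∃ y', ∀ n, starLetter (D n) y' = star (starLetter (D n) y) := by
    rintro ⟨j, ε⟩
    refine ⟨(j, !ε), fun n => ?_⟩
    cases ε <;> simp [starLetter]
  have key := fun W => tendsto_meanTrace_of_gaussian hx
    (hasGaussianLaw_modelEntry fun _ : I × Bool => (1 : ℝ)) v (fun n => starLetter (D n)) hDstar M hM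
    (fun u => by
      rw [show M (u.map Sum.inr) = t u from sdFunctional_map_inr c t u]
      exact hD u) W
  let g : ((I × Bool) ⊕ (I × Bool)) ⊕ (J × Bool) →
      MatrixSeq (fun n => (I × Bool) × Fin n × Fin n → ℝ) := fun y n ω =>
    Sum.elim (fun a => ∑ b, v a b • familyMatrix (x n) b ω) (starLetter (D n)) y
  have hg : ∀ a n ω, g (Sum.inl a) n ω = ∑ q, w a q • familyMatrix (x n) (q, false) ω := by
    intro a n ω
    simp [g, v, Fintype.sum_prod_type]
  have hsa : ∀ q n ω, star (familyMatrix (x n) (q, false) ω) = familyMatrix (x n) (q, false) ω := by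
    intro q n ω
    rw [star_familyMatrix]
    exact familyMatrix_modelEntry_one q _ ω
  have hs1 : ∀ p, star (g (Sum.inl (Sum.inl p))) = g (Sum.inl (Sum.inl p)) := by
    intro p
    funext n ω
    rw [Pi.star_apply, Pi.star_apply, hg, star_sum]
    refine Finset.sum_congr rfl fun q _ => ?_
    rw [star_smul, hsa]
    congr 1
    simp only [hw, ellipticCoeff, Sum.elim_inl, Pi.single_apply]
    split_ifs <;> simp
  have hs2 : ∀ τ ε, star (g (Sum.inl (Sum.inr (τ, ε)))) = g (Sum.inl (Sum.inr (τ, !ε))) := by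
    intro τ ε
    funext n ω
    rw [Pi.star_apply, Pi.star_apply, hg, hg, star_sum]
    refine Finset.sum_congr rfl fun q _ => ?_
    rw [star_smul, hsa, star_ellipticCoeff]
  have hs3 : ∀ j ε, star (g (Sum.inr (j, ε))) = g (Sum.inr (j, !ε)) := by
    intro j ε
    funext n ω
    rw [Pi.star_apply, Pi.star_apply]
    cases ε <;> simp [g, starLetter]
  have happ : ∀ (W : List (((I × Bool) ⊕ (I × Bool)) ⊕ (J × Bool))) n ω, (W.map g).prod n ω =
    (W.map (Sum.elim
      (fun a => ∑ b, v a b • familyMatrix (x n) b ω) (starLetter (D n)))).prod := by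
    intro W n ω
    rw [List.prod_map_apply, List.prod_map_apply]
  obtain ⟨ℬ, ev, val, hinj, hval, hlim⟩ := exists_limitSpace (modelMeasure (I × Bool)) g (by
    rintro ((p | ⟨τ, ε⟩) | ⟨j, ε⟩)
    · exact ⟨_, (hs1 p).symm⟩
    · exact ⟨_, (hs2 τ ε).symm⟩
    · exact ⟨_, (hs3 j ε).symm⟩) (fun W => by
      refine ⟨fun n => ?_, M W, ?_⟩
      · simp only [happ]
        exact (key W).1 n
      · refine (key W).2.congr fun n => ?_
        congr 1
        funext ω
        exact (happ W n ω).symm)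
  -- The limiting trace is thereby a solution of the Schwinger–Dyson equations, and freeness and
  -- semicircularity become algebraic consequences.
  have hφ : ∀ W, ℬ.φ (W.map ev).prod = M W := by
    intro W
    refine tendsto_nhds_unique (hlim W) ((key W).2.congr fun n => ?_)
    congr 1
    funext ω
    exact (happ W n ω).symm
  have hSD : SchwingerDyson c fun W => ℬ.φ (W.map ev).prod := by
    simp only [hφ]
    exact hM
  have he1 : ∀ p, star (ev (Sum.inl (Sum.inl p))) = ev (Sum.inl (Sum.inl p)) := fun p =>
    hinj (by rw [map_star, hval, hs1])
  have he2 : ∀ τ ε, star (ev (Sum.inl (Sum.inr (τ, ε)))) = ev (Sum.inl (Sum.inr (τ, !ε))) :=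
    fun τ ε => hinj (by rw [map_star, hval, hval, hs2])
  have he3 : ∀ j ε, star (ev (Sum.inr (j, ε))) = ev (Sum.inr (j, !ε)) :=
    fun j ε => hinj (by rw [map_star, hval, hval, hs3])
  have hle : starLetter (fun τ => ev (Sum.inl (Sum.inr (τ, false)))) =
      fun p => ev (Sum.inl (Sum.inr p)) := by
    funext ⟨τ, ε⟩
    cases ε <;> simp [starLetter, he2]
  have hld : starLetter (fun j => ev (Sum.inr (j, false))) = fun p => ev (Sum.inr p) := by
    funext ⟨τ, ε⟩
    cases ε <;> simp [starLetter, he3]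
  have hSDe : SchwingerDyson (ellipticCov ρ) fun W : List ((I × Bool) ⊕ (J × Bool)) =>
      ℬ.φ (W.map (Sum.elim (fun p => ev (Sum.inl (Sum.inr p))) fun p => ev (Sum.inr p))).prod := by
    have h1 := hSD.comp (Sum.inr : I × Bool → (I × Bool) ⊕ (I × Bool))
    simp only [hc, hw, sum_ellipticCoeff_mul ρ hρ, List.map_map] at h1
    convert h1 using 5
    funext y
    cases y <;> rfl
  refine ⟨ℬ, fun τ => ev (Sum.inl (Sum.inr (τ, false))), fun j => ev (Sum.inr (j, false)),
    fun u => ?_, fun τ => ?_, ?_, ?_⟩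
  · rw [starWord]
    change ℬ.φ ((u.map (starLetter fun j => ev (Sum.inr (j, false)))).prod) = t u
    rw [hld, ← sdFunctional_map_inr c t u]
    change _ = M _
    rw [← hφ, List.map_map]
    rfl
  · have hSDs : SchwingerDyson (fun b b' : Bool => if b = b' then (1 : ℂ) else 0)
        fun W : List (Bool ⊕ (J × Bool)) => ℬ.φ (W.map (Sum.elim
          (fun b => ev (Sum.inl (Sum.inl (τ, b)))) fun p => ev (Sum.inr p))).prod := by
      have h1 := hSD.comp (fun b : Bool => (Sum.inl (τ, b) : (I × Bool) ⊕ (I × Bool)))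
      have h2 : ∀ b b' : Bool, c (Sum.inl (τ, b)) (Sum.inl (τ, b')) = if b = b' then 1 else 0 := by
        intro b b'
        rw [hc]
        simp [hw, ellipticCoeff, Pi.single_apply, eq_comm (a := b)]
      simp only [h2, List.map_map] at h1
      convert h1 using 5
      funext y
      cases y <;> rfl
    refine ⟨hρ τ, ev (Sum.inl (Sum.inl (τ, true))), ev (Sum.inl (Sum.inl (τ, false))),
      ℬ.isSemicircular_of_schwingerDyson _ _ hSDs true (by simp) (he1 _),
      ℬ.isSemicircular_of_schwingerDyson _ _ hSDs false (by simp) (he1 _), ?_, ?_⟩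
    · have h1 := ℬ.isFree_of_schwingerDyson _ _ id (fun b b' h => if_neg h) hSDs
        (fun b : Bool => if b then {ev (Sum.inl (Sum.inl (τ, true)))}
          else {ev (Sum.inl (Sum.inl (τ, false)))}) ∅ (by
          intro b z hz
          have : z = ev (Sum.inl (Sum.inl (τ, b))) := by
            cases b <;> simpa using hz
          subst this
          exact ⟨⟨b, rfl, rfl⟩, b, rfl, (he1 _).symm⟩) (by simp)
      exact h1.comp_injective Sum.inl Sum.inl_injective
    -- The decomposition of the elliptic letter holds already for the matrices, and `val` is
    -- injective.
    · refine hinj ?_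
      rw [map_add, map_smul, map_smul, hval, hval, hval]
      funext n ω
      simp only [Pi.add_apply, Pi.smul_apply, hg]
      rw [Finset.smul_sum, Finset.smul_sum, ← Finset.sum_add_distrib]
      refine Finset.sum_congr rfl fun q _ => ?_
      rw [smul_smul, smul_smul, ← add_smul]
      congr 1
      obtain ⟨τ', b⟩ := q
      by_cases h : τ' = τ
      · subst h
        cases b <;> simp [hw, ellipticCoeff, starLetter]
      · simp [hw, ellipticCoeff, starLetter, h]
  · refine ℬ.isFree_of_schwingerDyson _ _ Prod.fst (fun p q h => if_neg h) hSDe _ _ ?_ ?_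
    · rintro τ z rfl
      exact ⟨⟨(τ, false), rfl, rfl⟩, (τ, true), rfl, (he2 τ false).symm⟩
    · rintro z ⟨j, rfl⟩
      exact ⟨⟨(j, false), rfl⟩, (j, true), (he3 j false).symm⟩
  · rw [hle, hld]
    exact hSDe

end EllipticSpaceExistence

theorem starWord_eq {ι A : Type*} [Monoid A] [Star A] (a : ι → A) (w : List (ι × Bool)) :
    starWord a w = (w.map (starLetter a)).prod := rfl

/-! ### Convergence to arbitrary free elliptic elements -/

section Convergence

variable {I : Type} {Ω : ℕ → Type*} [∀ n, MeasurableSpace (Ω n)]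
  {μ : ∀ n, Measure (Ω n)}

theorem starTendsto_const_iff [∀ n, IsProbabilityMeasure (μ n)] {J : Type*}
    (D : ∀ n, J → Matrix (Fin n) (Fin n) ℂ) (𝒜 : NCProbSpace.{w}) (d : J → 𝒜) :
    StarTendsto μ (fun n j _ => D n j) 𝒜 d ↔ ∀ u : List (J × Bool),
      Tendsto (fun n : ℕ => (n : ℂ)⁻¹ * (starWord (D n) u).trace) atTop
        (𝓝 (𝒜.φ (starWord d u))) := by
  refine forall_congr' fun u => ?_
  have h : ∀ n, starWord (fun (j : J) (_ : Ω n) => D n j) u = fun _ => starWord (D n) u :=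
    fun n => funext fun ω => starWord_apply _ u ω
  simp only [h, meanTrace_const]

theorem letterCov_single [Fintype I] [DecidableEq I] (ρ : I → ℝ) (p q : I × Bool) :
    letterCov ρ (fun p : I × Bool => Pi.single p 1) 0 p q = ellipticCov ρ p q := by
  rw [letterCov, Finset.sum_eq_single p, Finset.sum_eq_single q]
  · simp only [Pi.single_eq_same, one_mul, transposeCov, ellipticCov]
    split_ifs <;> simp [*]
  · intro b _ hb
    simp [Pi.single_eq_of_ne hb]
  · simp
  · intro b _ hb
    simp [Pi.single_eq_of_ne hb]
  · simp

theorem starLetter_familyMatrix {n : ℕ} {Ω : Type*} (x : I × Fin n × Fin n → Ω → ℝ) (ω : Ω)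
    (p : I × Bool) :
    starLetter (fun τ => familyMatrix x (τ, false) ω) p = familyMatrix x p ω := by
  obtain ⟨τ, ε⟩ := p
  cases ε
  · rfl
  · exact star_familyMatrix x (τ, false) ω

theorem starWord_familyMatrix {n : ℕ} {Ω : Type*} (x : I × Fin n × Fin n → Ω → ℝ)
    (w : List (I × Bool)) : starWord (fun τ => familyMatrix x (τ, false)) w =
      fun ω => (w.map fun p => familyMatrix x p ω).prod := by
  funext ω
  rw [starWord_apply, starWord_eq]
  exact congrArg (fun f => (List.map f w).prod) (funext fun p => starLetter_familyMatrix x ω p)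

/-- The matrices converge to the elements constructed in `exists_elliptic_space`, which solve the
Schwinger–Dyson equations; uniqueness of the joint distribution transfers the limit to the given
elements. -/
theorem starTendsto_of_gaussian [∀ n, IsProbabilityMeasure (μ n)] [Fintype I] [DecidableEq I]
    {x : ∀ n, I × Fin n × Fin n → Ω n → ℝ} {ρ : I → ℝ} (h : IsEllipticFamily μ x ρ)
    (hG : ∀ n, HasGaussianLaw (fun ω e => x n e ω) (μ n)) {J : Type} [Fintype J]
    (D : ∀ n, J → Matrix (Fin n) (Fin n) ℂ) {𝒜 : NCProbSpace.{w}} {d : J → 𝒜}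
    (hD : StarTendsto μ (fun n j _ => D n j) 𝒜 d) {ℬ : NCProbSpace.{v}} {e : I → ℬ} {d' : J → ℬ}
    (hd : NCProbSpace.SameStarDist 𝒜 ℬ d d') (he : ∀ τ, ℬ.IsElliptic (ρ τ) (e τ))
    (hfree : ℬ.IsFree (Sum.elim (fun τ => {e τ}) fun _ : Unit => Set.range d')) :
    StarTendsto μ (fun n => Sum.elim (fun τ => familyMatrix (x n) (τ, false)) fun j _ => D n j)
      ℬ (Sum.elim e d') := by
  rw [starTendsto_const_iff] at hD
  obtain ⟨ℬ₀, e₀, d₀, hd₀, he₀, hfree₀, hSD⟩ :=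
    exists_elliptic_space ρ (fun τ => (he τ).1) D _ hD
  intro w
  rw [← NCProbSpace.sameStarDist_sumElim he₀ he (fun u => (hd₀ u).trans (hd u)) hfree₀ hfree w,
    starWord_sumElim]
  have hDstar : ∀ y : J × Bool, ∃ y', ∀ n, starLetter (D n) y' = star (starLetter (D n) y) := by
    rintro ⟨j, ε⟩
    refine ⟨(j, !ε), fun n => ?_⟩
    cases ε <;> simp [starLetter]
  have key := (tendsto_meanTrace_of_gaussian h hG (fun p : I × Bool => Pi.single p 1)
    (fun n => starLetter (D n)) hDstar _ (by
      rw [show letterCov ρ (fun p : I × Bool => Pi.single p 1) 0 = ellipticCov ρ from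
        funext₂ (letterCov_single ρ)]
      exact hSD) (fun u => by
      have h1 := hD u
      rw [← hd₀] at h1
      simpa only [List.map_map, Sum.elim_comp_inr, starWord_eq] using h1)
    (w.map (Equiv.sumProdDistrib I J Bool))).2
  refine key.congr fun n => congrArg _ (funext fun ω => ?_)
  rw [starWord_apply]
  have h1 : (fun i => Sum.elim (fun τ => familyMatrix (x n) (τ, false)) (fun j _ => D n j) i ω) =
      Sum.elim (fun τ => familyMatrix (x n) (τ, false) ω) (D n) := by
    funext i
    cases i <;> rfl
  rw [h1, starWord_sumElim]
  refine congrArg (fun f => (List.map f _).prod) (funext fun i => ?_)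
  rcases i with p | j
  · simp only [Sum.elim_inl, starLetter_familyMatrix]
    rw [Finset.sum_eq_single p]
    · simp
    · intro b _ hb
      simp [Pi.single_eq_of_ne hb]
    · simp
  · rfl

theorem StarTendsto.comp {ι ι' : Type*} {X : ∀ n, ι → Ω n → Matrix (Fin n) (Fin n) ℂ}
    {𝒜 : NCProbSpace.{w}} {a : ι → 𝒜} (h : StarTendsto μ X 𝒜 a) (f : ι' → ι) :
    StarTendsto μ (fun n i => X n (f i)) 𝒜 (fun i => a (f i)) := by
  intro w
  have := h (w.map (Prod.map f id))
  simpa only [starWord, List.map_map, Function.comp_def, Prod.map_fst, Prod.map_snd, id_eq]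
      using this

theorem trace_one_tendsto :
    Tendsto (fun n : ℕ => (n : ℂ)⁻¹ * (1 : Matrix (Fin n) (Fin n) ℂ).trace) atTop (𝓝 1) := by
  refine tendsto_const_nhds.congr' ?_
  filter_upwards [eventually_ne_atTop 0] with n hn
  rw [Matrix.trace_one, Fintype.card_fin, inv_mul_cancel₀ (Nat.cast_ne_zero.2 hn)]

theorem tendsto_starWord_of_isEmpty {J : Type*} [IsEmpty J]
    (D : ∀ n, J → Matrix (Fin n) (Fin n) ℂ) (u : List (J × Bool)) :
    Tendsto (fun n : ℕ => (n : ℂ)⁻¹ * (starWord (D n) u).trace) atTop (𝓝 1) := by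
  rcases u with _ | ⟨p, -⟩
  · exact trace_one_tendsto
  · exact isEmptyElim p.1

/-- Universality replaces the entries by the Gaussian model, to which the Gaussian case applies with
an empty family of deterministic matrices. -/
theorem IsEllipticFamily.starTendsto [∀ n, IsProbabilityMeasure (μ n)] [Fintype I] [DecidableEq I]
    {x : ∀ n, I × Fin n × Fin n → Ω n → ℝ} {ρ : I → ℝ} (h : IsEllipticFamily μ x ρ)
    {ℬ : NCProbSpace.{v}} {e : I → ℬ} (he : ∀ τ, ℬ.IsElliptic (ρ τ) (e τ))
    (hfree : ℬ.IsFree fun τ => {e τ}) :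
    StarTendsto μ (fun n τ => familyMatrix (x n) (τ, false)) ℬ e := by
  have hmodel := isEllipticFamily_modelEntry ρ fun τ => (he τ).1
  have hD : StarTendsto (modelMeasure I)
      (fun n (j : Empty) _ => (j.elim : Matrix (Fin n) (Fin n) ℂ)) ℬ Empty.elim := by
    rw [starTendsto_const_iff]
    rintro (_ | ⟨⟨j, -⟩, -⟩)
    · simpa [starWord, ℬ.map_one] using trace_one_tendsto
    · exact j.elim
  have h1 := (starTendsto_of_gaussian hmodel
      (hasGaussianLaw_modelEntry ρ) _ hD (fun _ => rfl) he (by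
    rw [Set.range_eq_empty]
    exact hfree.sumElim_empty)).comp Sum.inl
  intro w
  have h2 := (h.tendsto_meanTrace_sub hmodel w).add (h1 w)
  rw [zero_add] at h2
  refine h2.congr fun n => ?_
  simp only [Sum.elim_inl, starWord_familyMatrix, sub_add_cancel]

end Convergence

/-- Already for size `2`, the second moments of `a₀₁ ± a₁₀` equal `2 ± 2ρ` and are nonnegative. -/
theorem IsEllipticMatrixSeq.correlation_mem_Icc {Ω : ℕ → Type*} [∀ n, MeasurableSpace (Ω n)]
    {μ : ∀ n, Measure (Ω n)} {A : ∀ n, Ω n → Matrix (Fin n) (Fin n) ℝ} {ρ : ℝ}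
    (hA : IsEllipticMatrixSeq μ A ρ) : ρ ∈ Set.Icc (-1 : ℝ) 1 := by
  have hlp : ∀ i j : Fin 2, MemLp (fun ω => A 2 ω i j) 2 (μ 2) := by
    intro i j
    rw [memLp_two_iff_integrable_sq (hA.measurable 2 i j).aestronglyMeasurable]
    obtain ⟨C, hC⟩ := hA.moments 2
    simpa only [sq_abs] using (hC 2 i j).1
  have hint : ∀ s : ℝ, ∫ ω, (A 2 ω 0 1 + s * A 2 ω 1 0) ^ 2 ∂μ 2 = 1 + 2 * s * ρ + s ^ 2 := by
    intro s
    have h1 : ∀ ω, (A 2 ω 0 1 + s * A 2 ω 1 0) ^ 2 =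
        (A 2 ω 0 1 ^ 2 + 2 * s * (A 2 ω 0 1 * A 2 ω 1 0)) + s ^ 2 * A 2 ω 1 0 ^ 2 :=
      fun ω => by ring
    simp only [h1]
    have h01 := (hlp 0 1).integrable_sq
    have h10 := (hlp 1 0).integrable_sq
    have hm : Integrable (fun ω => A 2 ω 0 1 * A 2 ω 1 0) (μ 2) :=
      (hlp 0 1).integrable_mul (hlp 1 0)
    have h02 : Integrable (fun ω => A 2 ω 0 1 ^ 2 + 2 * s * (A 2 ω 0 1 * A 2 ω 1 0)) (μ 2) :=
      h01.add (hm.const_mul _)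
    rw [integral_add h02 (h10.const_mul _),
      integral_add h01 (hm.const_mul _), integral_const_mul, integral_const_mul,
      hA.variance, hA.variance, hA.correlation 2 0 1 (by decide)]
    ring
  have h1 := hint 1
  have h2 := hint (-1)
  have h3 : 0 ≤ ∫ ω, (A 2 ω 0 1 + 1 * A 2 ω 1 0) ^ 2 ∂μ 2 :=
    integral_nonneg fun _ => sq_nonneg _
  have h4 : 0 ≤ ∫ ω, (A 2 ω 0 1 + -1 * A 2 ω 1 0) ^ 2 ∂μ 2 :=
    integral_nonneg fun _ => sq_nonneg _
  constructor <;> linarith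

theorem scaledMatrix_eq_familyMatrix {κ Ω : Type*} {n : ℕ}
    (A : κ → Ω → Matrix (Fin n) (Fin n) ℝ) (τ : κ) :
    scaledMatrix (A τ) = familyMatrix (fun e ω => A e.1 ω e.2.1 e.2.2) (τ, false) := by
  funext ω
  ext i j
  simp [scaledMatrix, familyMatrix, entryPos]

theorem theorem3p2 {m : ℕ} {Ω : ℕ → Type u} [∀ n, MeasurableSpace (Ω n)]
    (μ : ∀ n, Measure (Ω n)) [∀ n, IsProbabilityMeasure (μ n)]
    (A : ∀ n, Fin m → Ω n → Matrix (Fin n) (Fin n) ℝ) (ρ : Fin m → ℝ)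
    (hA : ∀ τ, IsEllipticMatrixSeq μ (fun n => A n τ) (ρ τ))
    (hindep : ∀ n, iIndepFun (fun (τ : Fin m) ω (p : Fin n × Fin n) => A n τ ω p.1 p.2) (μ n)) :
    -- free elliptic elements with parameters `ρ τ` exist, and the scaled matrices converge to them
    ((∃ (ℬ : NCProbSpace.{0}) (e : Fin m → ℬ),
        (∀ τ, ℬ.IsElliptic (ρ τ) (e τ)) ∧ ℬ.IsFree (fun τ => {e τ})) ∧
      (∀ (ℬ : NCProbSpace.{v}) (e : Fin m → ℬ),
        (∀ τ, ℬ.IsElliptic (ρ τ) (e τ)) → ℬ.IsFree (fun τ => {e τ}) →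
          StarTendsto μ (fun n τ => scaledMatrix (A n τ)) ℬ e)) ∧
    -- the Gaussian case, with deterministic matrices
    ((∀ n τ, HasGaussianLaw (fun ω (p : Fin n × Fin n) => A n τ ω p.1 p.2) (μ n)) →
      ∀ (l : ℕ) (D : ∀ n, Fin l → Matrix (Fin n) (Fin n) ℂ) (𝒜 : NCProbSpace.{w})
        (d : Fin l → 𝒜),
        StarTendsto μ (fun n j _ => D n j) 𝒜 d →
        (∃ (ℬ : NCProbSpace.{0}) (e : Fin m → ℬ) (d' : Fin l → ℬ),
          NCProbSpace.SameStarDist 𝒜 ℬ d d' ∧ (∀ τ, ℬ.IsElliptic (ρ τ) (e τ)) ∧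
          ℬ.IsFree (Sum.elim (fun τ => {e τ}) (fun _ : Unit => Set.range d'))) ∧
        (∀ (ℬ : NCProbSpace.{v}) (e : Fin m → ℬ) (d' : Fin l → ℬ),
          NCProbSpace.SameStarDist 𝒜 ℬ d d' → (∀ τ, ℬ.IsElliptic (ρ τ) (e τ)) →
          ℬ.IsFree (Sum.elim (fun τ => {e τ}) (fun _ : Unit => Set.range d')) →
            StarTendsto μ
              (fun n => Sum.elim (fun τ => scaledMatrix (A n τ)) (fun j _ => D n j))
              ℬ (Sum.elim e d'))) := by
  have hx := isEllipticFamily_of_matrixSeq hA hindep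
  have hρ : ∀ τ, ρ τ ∈ Set.Icc (-1 : ℝ) 1 := fun τ => (hA τ).correlation_mem_Icc
  refine ⟨⟨?_, fun ℬ e he hfree => ?_⟩, fun hG l D 𝒜 d hD => ⟨?_, ?_⟩⟩
  · obtain ⟨ℬ, e, d, -, he, hfree, -⟩ := exists_elliptic_space ρ hρ
      (fun n (j : Empty) => (j.elim : Matrix (Fin n) (Fin n) ℂ)) (fun _ => 1)
      (tendsto_starWord_of_isEmpty _)
    exact ⟨ℬ, e, he, hfree.comp_injective Sum.inl Sum.inl_injective⟩
  · simpa only [scaledMatrix_eq_familyMatrix] using hx.starTendsto he hfree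
  · obtain ⟨ℬ, e, d', hd, he, hfree, -⟩ := exists_elliptic_space ρ hρ D
      (fun u => 𝒜.φ (starWord d u)) ((starTendsto_const_iff D 𝒜 d).1 hD)
    exact ⟨ℬ, e, d', fun u => (hd u).symm, he, hfree⟩
  · intro ℬ e d' hd he hfree
    simpa only [scaledMatrix_eq_familyMatrix] using
      starTendsto_of_gaussian hx (hasGaussianLaw_of_iIndepFun hindep hG) D hD hd he hfree
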